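/- Let $S^1=\mathbb R/\mathbb Z$, $S^1_{4\pi}=\mathbb R/4\pi\mathbb Z$ and $s>5/2$. Let $$\mathrm{Diff}_0^s(S^1)=\{\varphi=\mathrm{id}+h \mid h\in H^s(S^1;\mathbb R),\ h(0)=0,\ h_x>-1\},$$ an open subset of the affine space $\mathrm{id}+H^s_0(S^1;\mathbb R)$, where $H^s_0(S^1;\mathbb R)=\{u\in H^s(S^1;\mathbb R)\mid u(0)=0\}$. Let $H^{s-1}(S^1;S^1_{4\pi})$ be the Banach manifold, modelled on $H^{s-1}(S^1;\mathbb R)$, of the maps $S^1\to S^1_{4\pi}$ of Sobolev class $H^{s-1}$, i.e. of the maps $x\mapsto 4\pi kx+a(x)$ mod $4\pi$ with $k\in\mathbb Z$ and $a\in H^{s-1}(S^1;\mathbb R)$. Let $G^s$ be the semidirect product of $\mathrm{Diff}_0^s(S^1)$ and $H^{s-1}(S^1;S^1_{4\pi})$, with multiplication $(\varphi,\alpha)(\psi,\beta)=(\varphi\circ\psi,\ \beta+\alpha\circ\psi)$; as a Banach manifold it is the product of the two factors. Equip $G^s$ with the right-invariant weak Riemannian metric $$\langle U,V\rangle_{(\varphi,\alpha)}=\big\langle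 (U_1\circ\varphi^{-1},U_2\circ\varphi^{-1}),(V_1\circ\varphi^{-1},V_2\circ\varphi^{-1})\big\rangle_{(\mathrm{id},0)},\qquad \langle (u,\rho),(v,\tau)\rangle_{(\mathrm{id},0)}=\frac14\int_{S^1}(u_xv_x+\rho\tau)\,dx,$$ for $U=(U_1,U_2)$ and $V=(V_1,V_2)$ in $T_{(\varphi,\alpha)}G^s\simeq H_0^s(S^1;\mathbb R)\times H^{s-1}(S^1;\mathbb R)$. Let $S^{\infty,s-1}=\{f\in H^{s-1}(S^1;\mathbb C)\mid \int_{S^1}|f|^2dx=1\}$, with the topology of $H^{s-1}$ and the manifold structure given by the two stereographic projections from the constant functions $\pm1$ onto $1^\perp=\{h\in H^{s-1}(S^1;\mathbb C)\mid \mathrm{Re}\int_{S^1} h\,dx=0\}$. Let $\mathcal U^{s-1}$ be the open submanifold of $S^{\infty,s-1}$ that consists of the nowhere vanishing functions, with the weak Riemannian metric $\langle X,Y\rangle_{L^2}=\mathrm{Re}\int_{S^1}X\overline Y\,dx$ inherited from $L^2(S^1;\mathbb C)$. **Theorem.** For every $s>5/2$ the map $$\Phi:G^s\to\mathcal U^{s-1},\qquad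 \Phi(\varphi,\alpha)=\sqrt{\varphi_x}\,e^{i\alpha/2},$$ is a ($C^\infty$) diffeomorphism and an isometry, i.e. $\langle T\Phi\, U,T\Phi\, V\rangle_{L^2}=\langle U,V\rangle_{(\varphi,\alpha)}$ for all $(\varphi,\alpha)\in G^s$ and $U,V\in T_{(\varphi,\alpha)}G^s$. In particular, $G^s$ is isometric to a subset of the unit sphere of $L^2(S^1;\mathbb C)$, namely $\mathcal U^{s-1}$: $\Phi$, regarded as a map into $L^2(S^1;\mathbb C)$, is injective with values in the unit sphere. -/

import Mathlib

open MeasureTheory AddCircle Function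
open scoped Manifold ContDiff Topology

noncomputable section

namespace TwoHS

/-! ### Sobolev spaces on the circle of length one -/

/-- The circle of length one. Integrals over it are taken against `haarAddCircle`, which is
the normalised Lebesgue measure `dx`. -/
abbrev S1 : Type := UnitAddCircle

/-- The weight `(1 + n²)^(t/2)`. -/
def sobolevWeight (t : ℝ) (n : ℤ) : ℝ := (1 + (n : ℝ) ^ 2) ^ (t / 2)

/-- The weighted Fourier coefficients `(1 + n²)^(t/2) f̂(n)`. -/
def weightedCoeff (t : ℝ) (f : C(S1, ℂ)) (n : ℤ) : ℂ :=
  ((sobolevWeight t n : ℝ) : ℂ) * fourierCoeff f n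

theorem integrable_cm (f : C(S1, ℂ)) : Integrable f haarAddCircle :=
  f.continuous.integrable_of_hasCompactSupport (HasCompactSupport.of_compactSpace _)

theorem weightedCoeff_add (t : ℝ) (f g : C(S1, ℂ)) :
    weightedCoeff t (f + g) = weightedCoeff t f + weightedCoeff t g := by
  funext n
  have h := congrFun (fourierCoeff.add (integrable_cm f) (integrable_cm g)) n
  simp only [weightedCoeff, Pi.add_apply, ContinuousMap.coe_add] at h ⊢
  rw [h, mul_add]

theorem weightedCoeff_smul (t : ℝ) (c : ℂ) (f : C(S1, ℂ)) :
    weightedCoeff t (c • f) = c • weightedCoeff t f := by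
  funext n
  have h := fourierCoeff.const_smul (T := 1) f c n
  simp only [weightedCoeff, Pi.smul_apply, ContinuousMap.coe_smul, smul_eq_mul] at h ⊢
  rw [show fourierCoeff (c • ⇑f) n = c * fourierCoeff (⇑f) n from h]
  ring

theorem weightedCoeff_zero (t : ℝ) : weightedCoeff t 0 = 0 := by
  funext n
  simp [weightedCoeff, fourierCoeff]

/-- The functions of Sobolev class `H^t`, i.e. `∑ (1 + n²)^t |f̂(n)|² < ∞`, as a space of continuous
functions. For `t > 1/2`, the only case in which it is used, every `L²` function with this property
has exactly one continuous representative. -/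
def sobolevSubmodule (t : ℝ) : Submodule ℂ C(S1, ℂ) where
  carrier := {f | Memℓp (weightedCoeff t f) 2}
  add_mem' := by
    intro f g hf hg
    have h := Memℓp.add (show Memℓp (weightedCoeff t f) 2 from hf)
      (show Memℓp (weightedCoeff t g) 2 from hg)
    rw [← weightedCoeff_add] at h
    exact h
  zero_mem' := by
    have h : Memℓp (0 : ∀ _ : ℤ, ℂ) 2 := zero_memℓp
    rw [← weightedCoeff_zero t] at h
    exact h
  smul_mem' := by
    intro c f hf
    have h := Memℓp.const_smul (show Memℓp (weightedCoeff t f) 2 from hf) c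
    rw [← weightedCoeff_smul] at h
    exact h

/-- The Hilbert space `H^t(S¹; ℂ)`. -/
def HC (t : ℝ) : Type := ↥(sobolevSubmodule t)

namespace HC

variable {t : ℝ}

instance : AddCommGroup (HC t) := inferInstanceAs (AddCommGroup ↥(sobolevSubmodule t))

instance : Module ℂ (HC t) := inferInstanceAs (Module ℂ ↥(sobolevSubmodule t))

/-- The underlying continuous function. -/
def toCM : HC t →ₗ[ℂ] C(S1, ℂ) := (sobolevSubmodule t).subtype

theorem toCM_injective : Injective (toCM : HC t → C(S1, ℂ)) := Subtype.val_injective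

instance : FunLike (HC t) S1 ℂ where
  coe f := toCM f
  coe_injective _ _ h := toCM_injective (DFunLike.coe_injective h)

/-- The weighted Fourier coefficients as an element of `ℓ²`. -/
def toEll2 : HC t →ₗ[ℂ] lp (fun _ : ℤ => ℂ) 2 where
  toFun f := ⟨weightedCoeff t (toCM f), f.2⟩
  map_add' f g := Subtype.ext (weightedCoeff_add t (toCM f) (toCM g))
  map_smul' c f := Subtype.ext (weightedCoeff_smul t c (toCM f))

theorem sobolevWeight_pos (t : ℝ) (n : ℤ) : 0 < sobolevWeight t n :=
  Real.rpow_pos_of_pos (by positivity) _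

theorem toEll2_injective : Injective (toEll2 : HC t →ₗ[ℂ] lp (fun _ : ℤ => ℂ) 2) := by
  rw [← LinearMap.ker_eq_bot, LinearMap.ker_eq_bot']
  intro f hf
  have h0 : fourierCoeff (toCM f) = 0 := by
    funext n
    have h := congrArg (fun u : lp (fun _ : ℤ => ℂ) 2 => u n) hf
    have hw : ((sobolevWeight t n : ℝ) : ℂ) ≠ 0 :=
      Complex.ofReal_ne_zero.mpr (sobolevWeight_pos t n).ne'
    have h' : ((sobolevWeight t n : ℝ) : ℂ) * fourierCoeff (toCM f) n = 0 := h
    simpa using (mul_eq_zero.mp h').resolve_left hw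
  apply toCM_injective
  ext x
  have hs := has_pointwise_sum_fourier_series_of_summable (f := toCM f)
    (by rw [h0]; exact summable_zero) x
  rw [h0] at hs
  simp only [Pi.zero_apply, zero_smul] at hs
  simpa using hs.unique hasSum_zero

/-- The norm of `H^t(S¹; ℂ)` is `‖f‖² = ∑ (1 + n²)^t |f̂(n)|²`. -/
instance : NormedAddCommGroup (HC t) :=
  NormedAddCommGroup.induced _ _ (toEll2 : HC t →ₗ[ℂ] _) toEll2_injective

instance : NormedSpace ℂ (HC t) := NormedSpace.induced ℂ _ _ (toEll2 : HC t →ₗ[ℂ] _)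

theorem norm_def (f : HC t) : ‖f‖ = ‖toEll2 f‖ := rfl

@[simp] theorem coe_add (f g : HC t) : ⇑(f + g) = ⇑f + ⇑g := rfl
@[simp] theorem coe_zero : ⇑(0 : HC t) = 0 := rfl
@[simp] theorem coe_sub (f g : HC t) : ⇑(f - g) = ⇑f - ⇑g := rfl
@[simp] theorem coe_neg (f : HC t) : ⇑(-f) = -⇑f := rfl
@[simp] theorem coe_smul (c : ℂ) (f : HC t) : ⇑(c • f) = c • ⇑f := rfl
@[simp] theorem coe_real_smul (c : ℝ) (f : HC t) : ⇑(c • f) = c • ⇑f := by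
  funext x
  rw [← Complex.coe_smul, coe_smul]
  simp

theorem continuous_coe (f : HC t) : Continuous f := (toCM f).continuous

theorem summable_weight {r : ℝ} (hr : 1 / 2 < r) :
    Summable fun n : ℤ => sobolevWeight (-r) n ^ (2 : ℝ) := by
  have h1 : Summable fun n : ℤ => |(n : ℝ)| ^ (-(2 * r)) :=
    Real.summable_abs_int_rpow (by linarith)
  refine Summable.of_norm_bounded_eventually h1 ?_
  have : ∀ᶠ n : ℤ in Filter.cofinite, n ≠ 0 := by
    rw [Filter.eventually_cofinite]
    simp
  filter_upwards [this] with n hn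
  have hn' : 0 < |(n : ℝ)| := abs_pos.mpr (by exact_mod_cast hn)
  rw [Real.norm_of_nonneg (by positivity [sobolevWeight_pos (-r) n]), sobolevWeight,
    ← Real.rpow_mul (by positivity), show -(2 * r) = 2 * (-r) by ring, Real.rpow_mul hn'.le,
    Real.rpow_two, sq_abs, show -r / 2 * 2 = -r by ring]
  exact Real.rpow_le_rpow_of_nonpos (by rw [← sq_abs]; positivity) (by linarith) (by linarith)

/-- Weighted `ℓ¹` bound for the Fourier coefficients. -/
theorem exists_weighted_bound {r : ℝ} (hr : 1 / 2 < t - r) : ∃ C : ℝ, ∀ f : HC t,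
    (Summable fun n : ℤ => sobolevWeight r n * ‖fourierCoeff (toCM f) n‖) ∧
      ∑' n : ℤ, sobolevWeight r n * ‖fourierCoeff (toCM f) n‖ ≤ C * ‖f‖ := by
  refine ⟨(∑' n : ℤ, sobolevWeight (-(t - r)) n ^ (2 : ℝ)) ^ (1 / (2 : ℝ)), fun f => ?_⟩
  have hsplit : ∀ n : ℤ, sobolevWeight r n * ‖fourierCoeff (toCM f) n‖ =
      sobolevWeight (-(t - r)) n * ‖toEll2 f n‖ := by
    intro n
    have : ‖toEll2 f n‖ = sobolevWeight t n * ‖fourierCoeff (toCM f) n‖ := by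
      change ‖((sobolevWeight t n : ℝ) : ℂ) * fourierCoeff (toCM f) n‖ = _
      rw [norm_mul, Complex.norm_real, Real.norm_of_nonneg (sobolevWeight_pos t n).le]
    rw [this, ← mul_assoc]
    congr 1
    rw [sobolevWeight, sobolevWeight, sobolevWeight, ← Real.rpow_add (by positivity)]
    congr 1
    ring
  have h2 : Summable fun n : ℤ => ‖toEll2 f n‖ ^ (2 : ℝ) := by
    have := (memℓp_gen_iff (p := 2) (by norm_num)).mp (toEll2 f).2
    simpa using this
  have key := Real.inner_le_Lp_mul_Lq_tsum_of_nonneg Real.HolderConjugate.two_two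
    (f := fun n : ℤ => sobolevWeight (-(t - r)) n) (g := fun n : ℤ => ‖toEll2 f n‖)
    (fun n => (sobolevWeight_pos _ n).le) (fun n => norm_nonneg _) (summable_weight hr) h2
  have hs := Real.summable_mul_of_Lp_Lq_of_nonneg Real.HolderConjugate.two_two
    (f := fun n : ℤ => sobolevWeight (-(t - r)) n) (g := fun n : ℤ => ‖toEll2 f n‖)
    (fun n => (sobolevWeight_pos _ n).le) (fun n => norm_nonneg _) (summable_weight hr) h2
  simp_rw [hsplit]
  refine ⟨hs, key.trans (le_of_eq ?_)⟩
  rw [norm_def, lp.norm_eq_tsum_rpow (by norm_num)]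
  simp

theorem sobolevWeight_zero (n : ℤ) : sobolevWeight 0 n = 1 := by simp [sobolevWeight]

theorem hasSum_fourier (ht : 1 / 2 < t) (f : HC t) (x : S1) :
    HasSum (fun n : ℤ => fourierCoeff (toCM f) n • fourier n x) (f x) := by
  obtain ⟨C, hC⟩ := exists_weighted_bound (t := t) (r := 0) (by linarith)
  have h := (hC f).1
  simp only [sobolevWeight_zero, one_mul] at h
  exact has_pointwise_sum_fourier_series_of_summable h.of_norm x

/-- The Sobolev inequality. -/
theorem exists_sup_bound (ht : 1 / 2 < t) : ∃ C : ℝ, ∀ (f : HC t) (x : S1), ‖f x‖ ≤ C * ‖f‖ := by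
  obtain ⟨C, hC⟩ := exists_weighted_bound (t := t) (r := 0) (by linarith)
  refine ⟨C, fun f x => ?_⟩
  obtain ⟨h1, h2⟩ := hC f
  simp only [sobolevWeight_zero, one_mul] at h1 h2
  refine le_trans ?_ h2
  rw [← (hasSum_fourier ht f x).tsum_eq]
  refine tsum_of_norm_bounded h1.hasSum fun n => ?_
  rw [norm_smul, fourier_apply, Circle.norm_coe, mul_one]

/-- For `t > 3/2` the elements of `H^t` are differentiable, and the derivative is bounded by the
norm. -/
theorem exists_deriv (ht : 3 / 2 < t) : ∃ C : ℝ, ∀ f : HC t, ∃ g : C(S1, ℂ),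
    (∀ y : ℝ, HasDerivAt (fun y : ℝ => f (y : S1)) (g (y : S1)) y) ∧ ‖g‖ ≤ C * ‖f‖ := by
  obtain ⟨C, hC⟩ := exists_weighted_bound (t := t) (r := 1) (by linarith)
  refine ⟨2 * Real.pi * C, fun f => ?_⟩
  obtain ⟨h1, h2⟩ := hC f
  set c : ℤ → ℂ := fun n => fourierCoeff (toCM f) n with hc
  let G : ℤ → C(S1, ℂ) := fun n => (c n * (2 * Real.pi * Complex.I * n)) • fourier n
  have hG : ∀ n, ‖G n‖ ≤ 2 * Real.pi * (sobolevWeight 1 n * ‖c n‖) := by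
    intro n
    have hn : |(n : ℝ)| ≤ sobolevWeight 1 n := by
      rw [sobolevWeight, ← Real.sqrt_eq_rpow, ← Real.sqrt_sq_eq_abs]
      exact Real.sqrt_le_sqrt (by linarith)
    have : ‖G n‖ = 2 * Real.pi * (|(n : ℝ)| * ‖c n‖) := by
      simp only [G, norm_smul, norm_mul, fourier_norm]
      simp [abs_of_pos Real.pi_pos]
      ring
    rw [this]
    have := Real.pi_pos
    gcongr
  have hsum : Summable fun n : ℤ => 2 * Real.pi * (sobolevWeight 1 n * ‖c n‖) := h1.mul_left _
  have hGs : Summable G := Summable.of_norm_bounded hsum hG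
  refine ⟨∑' n, G n, fun y => ?_, ?_⟩
  · have hd := hasDerivAt_tsum (g := fun (n : ℤ) (y : ℝ) => c n * fourier n (y : S1))
      (g' := fun (n : ℤ) (y : ℝ) => G n (y : S1)) hsum
      (fun n y => by
        have := (hasDerivAt_fourier 1 n y).const_mul (c n)
        refine this.congr_deriv ?_
        simp [G]
        ring)
      (fun n y => ((G n).norm_coe_le_norm _).trans (hG n)) (y₀ := 0)
      (by simpa using (hasSum_fourier (by linarith) f ((0 : ℝ) : S1)).summable) y
    have e1 : (fun z : ℝ => ∑' n : ℤ, c n * fourier n (z : S1)) = fun z : ℝ => f (z : S1) := by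
      funext z
      simpa using (hasSum_fourier (by linarith) f (z : S1)).tsum_eq
    rw [e1] at hd
    rw [ContinuousMap.tsum_apply hGs] at hd
    exact hd
  · calc ‖∑' n, G n‖ ≤ ∑' n : ℤ, 2 * Real.pi * (sobolevWeight 1 n * ‖c n‖) :=
          tsum_of_norm_bounded hsum.hasSum hG
      _ = 2 * Real.pi * ∑' n : ℤ, sobolevWeight 1 n * ‖c n‖ := tsum_mul_left
      _ ≤ 2 * Real.pi * (C * ‖f‖) := by
          have := Real.pi_pos
          gcongr
      _ = _ := by ring

theorem one_mem (t : ℝ) : (1 : C(S1, ℂ)) ∈ sobolevSubmodule t := by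
  have h1 : (1 : C(S1, ℂ)) = fourier 0 := by
    ext x
    simp
  have h2 : ∀ n : ℤ, n ∉ ({0} : Finset ℤ) → ‖weightedCoeff t 1 n‖ ^ (2 : ENNReal).toReal = 0 := by
    intro n hn
    have hn' : n ≠ 0 := by simpa using hn
    have h3 : fourierCoeff (1 : C(S1, ℂ)) n = 0 := by
      rw [h1, fourierCoeff_fourier, Pi.single_eq_of_ne hn']
    rw [weightedCoeff, h3]
    simp
  exact (memℓp_gen_iff (by norm_num)).mpr (summable_of_ne_finset_zero h2)

/-- The constant function `1`. -/
instance : One (HC t) := ⟨⟨1, one_mem t⟩⟩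

@[simp] theorem coe_one : ⇑(1 : HC t) = 1 := rfl

end HC

/-! ### Real-valued Sobolev functions -/

/-- A real-valued function regarded as a complex-valued one. -/
def complexify : C(S1, ℝ) →ₗ[ℝ] C(S1, ℂ) where
  toFun f := ⟨fun x => (f x : ℂ), by fun_prop⟩
  map_add' f g := by ext x; simp
  map_smul' c f := by ext x; simp

/-- The Hilbert space `H^t(S¹; ℝ)` of the real-valued functions in `H^t(S¹; ℂ)`. -/
def HR (t : ℝ) : Type := ↥(((sobolevSubmodule t).restrictScalars ℝ).comap complexify)

namespace HR

variable {t : ℝ}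

instance : AddCommGroup (HR t) :=
  inferInstanceAs (AddCommGroup ↥(((sobolevSubmodule t).restrictScalars ℝ).comap complexify))

instance : Module ℝ (HR t) :=
  inferInstanceAs (Module ℝ ↥(((sobolevSubmodule t).restrictScalars ℝ).comap complexify))

/-- The underlying continuous function. -/
def toCM : HR t →ₗ[ℝ] C(S1, ℝ) :=
  (((sobolevSubmodule t).restrictScalars ℝ).comap complexify).subtype

theorem toCM_injective : Injective (toCM : HR t → C(S1, ℝ)) := Subtype.val_injective

instance : FunLike (HR t) S1 ℝ where
  coe f := toCM f
  coe_injective _ _ h := toCM_injective (DFunLike.coe_injective h)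

/-- The inclusion of `H^t(S¹; ℝ)` into `H^t(S¹; ℂ)`. -/
def toHC : HR t →ₗ[ℝ] HC t where
  toFun f := ⟨complexify (toCM f), f.2⟩
  map_add' f g := DFunLike.coe_injective (by
    funext x
    exact Complex.ofReal_add (toCM f x) (toCM g x))
  map_smul' c f := DFunLike.coe_injective (by
    have F : ∃ F : HC t, F = ⟨complexify (toCM f), f.2⟩ := ⟨_, rfl⟩
    obtain ⟨F, hF⟩ := F
    rw [← hF, RingHom.id_apply, HC.coe_real_smul, hF]
    funext x
    exact congrArg (fun u : C(S1, ℂ) => u x) (complexify.map_smul c (toCM f)))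

theorem toHC_apply (f : HR t) (x : S1) : toHC f x = (f x : ℂ) := rfl

theorem toHC_injective : Injective (toHC : HR t →ₗ[ℝ] HC t) := by
  intro f g h
  apply DFunLike.coe_injective
  funext x
  have := DFunLike.congr_fun h x
  rwa [toHC_apply, toHC_apply, Complex.ofReal_inj] at this

/-- The norm of `H^t(S¹; ℝ)` is the restriction of the norm of `H^t(S¹; ℂ)`. -/
instance : NormedAddCommGroup (HR t) :=
  NormedAddCommGroup.induced _ _ (toHC : HR t →ₗ[ℝ] HC t) toHC_injective

instance : NormedSpace ℝ (HR t) := NormedSpace.induced ℝ _ _ (toHC : HR t →ₗ[ℝ] HC t)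

theorem norm_def (f : HR t) : ‖f‖ = ‖toHC f‖ := rfl

@[simp] theorem coe_add (f g : HR t) : ⇑(f + g) = ⇑f + ⇑g := rfl
@[simp] theorem coe_zero : ⇑(0 : HR t) = 0 := rfl
@[simp] theorem coe_sub (f g : HR t) : ⇑(f - g) = ⇑f - ⇑g := rfl
@[simp] theorem coe_neg (f : HR t) : ⇑(-f) = -⇑f := rfl
@[simp] theorem coe_smul (c : ℝ) (f : HR t) : ⇑(c • f) = c • ⇑f := rfl

theorem continuous_coe (f : HR t) : Continuous f := (toCM f).continuous

theorem exists_sup_bound (ht : 1 / 2 < t) : ∃ C : ℝ, ∀ f : HR t, ‖toCM f‖ ≤ C * ‖f‖ := by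
  obtain ⟨C, hC⟩ := HC.exists_sup_bound ht
  refine ⟨C, fun f => (ContinuousMap.norm_le_of_nonempty _).mpr fun x => ?_⟩
  have := hC (toHC f) x
  rwa [toHC_apply, Complex.norm_real] at this

theorem continuous_toCM (ht : 1 / 2 < t) : Continuous (toCM : HR t → C(S1, ℝ)) := by
  obtain ⟨C, hC⟩ := exists_sup_bound ht
  exact (LinearMap.mkContinuous toCM C hC).continuous

end HR

/-- The derivative `u_x` of a function on the circle. -/
def circleDeriv (u : S1 → ℝ) (x : S1) : ℝ := deriv (fun y : ℝ => u (x + (y : S1))) 0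

theorem circleDeriv_eq {u : S1 → ℝ} {y d : ℝ}
    (h : HasDerivAt (fun y : ℝ => u (y : S1)) d y) : circleDeriv u (y : S1) = d := by
  have h' : HasDerivAt (fun z : ℝ => u (z : S1)) d (y + 0) := by simpa using h
  have := h'.comp_const_add y 0
  simpa [circleDeriv, AddCircle.coe_add] using this.deriv

theorem HR.exists_deriv {t : ℝ} (ht : 3 / 2 < t) : ∃ C : ℝ, ∀ f : HR t, ∃ g : C(S1, ℝ),
    (∀ y : ℝ, HasDerivAt (fun y : ℝ => f (y : S1)) (g (y : S1)) y) ∧ ‖g‖ ≤ C * ‖f‖ := by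
  obtain ⟨C, hC⟩ := HC.exists_deriv ht
  refine ⟨C, fun f => ?_⟩
  obtain ⟨g, hg, hg'⟩ := hC (HR.toHC f)
  refine ⟨⟨fun x => (g x).re, by fun_prop⟩, fun y => ?_,
    (ContinuousMap.norm_le_of_nonempty _).mpr fun x => ?_⟩
  · have := (Complex.reCLM.hasFDerivAt.comp_hasDerivAt y (hg y))
    exact this
  · exact ((Complex.abs_re_le_norm _).trans (g.norm_coe_le_norm x)).trans hg'

theorem HR.hasDerivAt {t : ℝ} (ht : 3 / 2 < t) (f : HR t) (y : ℝ) :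
    HasDerivAt (fun y : ℝ => f (y : S1)) (circleDeriv f (y : S1)) y := by
  obtain ⟨C, hC⟩ := HR.exists_deriv ht
  obtain ⟨g, hg, -⟩ := hC f
  rw [circleDeriv_eq (hg y)]
  exact hg y

/-- The condition `h_x > -1` is open in `H^t` for `t > 3/2`. -/
theorem isOpen_deriv_gt {t : ℝ} (ht : 3 / 2 < t) :
    IsOpen {h : HR t | ∀ x, -1 < circleDeriv h x} := by
  obtain ⟨C, hC⟩ := HR.exists_deriv ht
  choose g hg hgC using hC
  have key : ∀ (f : HR t) (x : S1), circleDeriv f x = g f x := by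
    intro f x
    induction x using QuotientAddGroup.induction_on with
    | H y => exact circleDeriv_eq (hg f y)
  let D : HR t →ₗ[ℝ] C(S1, ℝ) :=
    { toFun := g
      map_add' := fun a b => by
        ext x
        induction x using QuotientAddGroup.induction_on with
        | H y => exact (hg (a + b) y).unique ((hg a y).add (hg b y))
      map_smul' := fun c a => by
        ext x
        induction x using QuotientAddGroup.induction_on with
        | H y => exact (hg (c • a) y).unique ((hg a y).const_smul c) }
  have hD : Continuous g := (LinearMap.mkContinuous D C hgC).continuous
  have : {h : HR t | ∀ x, -1 < circleDeriv h x} =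
      g ⁻¹' {u : C(S1, ℝ) | Set.MapsTo u Set.univ (Set.Ioi (-1))} := by
    ext h
    simp [key, Set.MapsTo]
  rw [this]
  exact (ContinuousMap.isOpen_setOfPred_mapsTo isCompact_univ isOpen_Ioi).preimage hD

/-! ### The diffeomorphism group `Diff₀^s(S¹)` -/

/-- The closed subspace `H_0^s(S¹; ℝ)` of the `u` in `H^s(S¹; ℝ)` with `u(0) = 0`. -/
def H0 (s : ℝ) : Submodule ℝ (HR s) where
  carrier := {u | u 0 = 0}
  add_mem' {a b} (ha : a 0 = 0) (hb : b 0 = 0) := by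
    change a 0 + b 0 = 0
    rw [ha, hb, add_zero]
  zero_mem' := rfl
  smul_mem' c a (ha : a 0 = 0) := by
    change c * a 0 = 0
    rw [ha, mul_zero]

/-- `Diff₀^s(S¹)` in its global chart: the diffeomorphism `φ = id + h` is given by the function `h`
in `H_0^s(S¹; ℝ)`, subject to `h_x > -1`. -/
def diff0Opens (s : ℝ) [hs : Fact (3 / 2 < s)] : TopologicalSpace.Opens (H0 s) where
  carrier := {h | ∀ x, -1 < circleDeriv (h : HR s) x}
  is_open' := (isOpen_deriv_gt hs.out).preimage continuous_subtype_val

/-- The Banach manifold `Diff₀^s(S¹)`. -/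
abbrev Diff0 (s : ℝ) [Fact (3 / 2 < s)] : Type := ↥(diff0Opens s)

theorem coe_eq_coe {a b : ℝ} : (a : S1) = (b : S1) ↔ ∃ n : ℤ, a = b + n := by
  rw [← sub_eq_zero, ← AddCircle.coe_sub, AddCircle.coe_eq_zero_iff]
  refine exists_congr fun n => ?_
  rw [zsmul_eq_mul, mul_one]
  constructor <;> intro h <;> linarith

namespace Diff0

variable {s : ℝ} [hs : Fact (3 / 2 < s)]

/-- The displacement `h = φ - id`. -/
def disp (φ : Diff0 s) : HR s := φ.1.1

/-- The derivative `φ_x = 1 + h_x`. -/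
def derivative (φ : Diff0 s) (x : S1) : ℝ := 1 + circleDeriv φ.disp x

/-- The map `φ : S¹ → S¹`. -/
def toFun (φ : Diff0 s) (x : S1) : S1 := x + (φ.disp x : S1)

/-- The lift of `φ` to the real line. -/
def lift (φ : Diff0 s) (y : ℝ) : ℝ := y + φ.disp (y : S1)

theorem toFun_coe (φ : Diff0 s) (y : ℝ) : φ.toFun (y : S1) = (φ.lift y : S1) := by
  simp [toFun, lift]

theorem hasDerivAt_lift (φ : Diff0 s) (y : ℝ) : HasDerivAt φ.lift (φ.derivative (y : S1)) y :=
  (hasDerivAt_id y).add (φ.disp.hasDerivAt hs.out y)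

theorem derivative_pos (φ : Diff0 s) (x : S1) : 0 < φ.derivative x := by
  have : -1 < circleDeriv φ.disp x := φ.2 x
  rw [derivative]
  linarith

theorem strictMono_lift (φ : Diff0 s) : StrictMono φ.lift :=
  strictMono_of_deriv_pos fun y => by
    rw [(φ.hasDerivAt_lift y).deriv]
    exact φ.derivative_pos _

theorem lift_add_int (φ : Diff0 s) (y : ℝ) (n : ℤ) : φ.lift (y + n) = φ.lift y + n := by
  have : ((y + n : ℝ) : S1) = (y : S1) := coe_eq_coe.mpr ⟨n, rfl⟩
  rw [lift, lift, this]
  ring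

theorem continuous_toFun (φ : Diff0 s) : Continuous φ.toFun :=
  continuous_id.add ((AddCircle.continuous_mk' 1).comp φ.disp.continuous_coe)

theorem surjective_lift (φ : Diff0 s) : Surjective φ.lift := by
  have hc : Continuous φ.lift := continuous_iff_continuousAt.mpr fun y =>
    (φ.hasDerivAt_lift y).continuousAt
  have hb : ∀ y : ℝ, |φ.disp (y : S1)| ≤ ‖HR.toCM φ.disp‖ := fun y =>
    (HR.toCM φ.disp).norm_coe_le_norm _
  refine hc.surjective ?_ ?_
  · refine Filter.tendsto_atTop_mono (fun y => ?_)
      (Filter.tendsto_atTop_add_const_right _ (-‖HR.toCM φ.disp‖) Filter.tendsto_id)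
    have := (abs_le.mp (hb y)).1
    simp only [lift, id]
    linarith
  · refine Filter.tendsto_atBot_mono (fun y => ?_)
      (Filter.tendsto_atBot_add_const_right _ ‖HR.toCM φ.disp‖ Filter.tendsto_id)
    have := (abs_le.mp (hb y)).2
    simp only [lift, id]
    linarith

theorem bijective_toFun (φ : Diff0 s) : Bijective φ.toFun := by
  constructor
  · intro a b
    induction a using QuotientAddGroup.induction_on with
    | H a =>
      induction b using QuotientAddGroup.induction_on with
      | H b =>
        intro h
        have h' : (φ.lift a : S1) = (φ.lift b : S1) := by
          rw [← toFun_coe, ← toFun_coe]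
          exact h
        obtain ⟨n, hn⟩ := coe_eq_coe.mp h'
        rw [← lift_add_int] at hn
        exact coe_eq_coe.mpr ⟨n, φ.strictMono_lift.injective hn⟩
  · intro b
    induction b using QuotientAddGroup.induction_on with
    | H b =>
      obtain ⟨a, ha⟩ := φ.surjective_lift b
      exact ⟨(a : S1), by rw [toFun_coe, ha]⟩

/-- `φ` as a homeomorphism of the circle. -/
def toHomeomorph (φ : Diff0 s) : S1 ≃ₜ S1 :=
  Continuous.homeoOfEquivCompactToT2 (f := Equiv.ofBijective φ.toFun φ.bijective_toFun)
    φ.continuous_toFun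

end Diff0

/-! ### Sobolev maps into the circle of length `4π` -/

instance fact_four_pi_pos : Fact (0 < 4 * Real.pi) := ⟨by positivity⟩

/-- The circle of length `4π`. -/
abbrev S4π : Type := AddCircle (4 * Real.pi)

/-- `x ↦ 4πk x + a(x)` modulo `4π` is a lift of the map `α`, with winding number `k`. -/
def IsLift {t : ℝ} (α : C(S1, S4π)) (k : ℤ) (a : HR t) : Prop :=
  ∀ x : ℝ, α (x : S1) = ((4 * Real.pi * k * x + a (x : S1) : ℝ) : S4π)

/-- The maps `S¹ → S¹_{4π}` of Sobolev class `H^t`: the continuous maps whose lift to the universal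
covers is, up to the linear function given by the winding number, a function of class `H^t`. -/
def CircMap (t : ℝ) : Type := {α : C(S1, S4π) // ∃ (k : ℤ) (a : HR t), IsLift α k a}

namespace CircMap

variable {t : ℝ}

instance : FunLike (CircMap t) S1 S4π where
  coe α := α.1
  coe_injective _ _ h := Subtype.ext (DFunLike.coe_injective h)

/-- The class of `4πk x + a(x)` modulo `4π`. -/
def mkFun (k : ℤ) (a : HR t) (x : S1) : S4π :=
  k • (AddCircle.equivAddCircle 1 (4 * Real.pi) one_ne_zero (by positivity) x) + (a x : S4π)

theorem mkFun_coe (k : ℤ) (a : HR t) (x : ℝ) :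
    mkFun k a (x : S1) = ((4 * Real.pi * k * x + a (x : S1) : ℝ) : S4π) := by
  rw [mkFun, AddCircle.equivAddCircle_apply_mk, AddCircle.coe_add, ← AddCircle.coe_zsmul]
  congr 2
  simp
  ring

/-- The element of `H^t(S¹; S¹_{4π})` with lift `4πk x + a(x)`. -/
def mk (k : ℤ) (a : HR t) : CircMap t :=
  ⟨⟨mkFun k a, by
    have h1 : Continuous
      (AddCircle.homeomorphAddCircle 1 (4 * Real.pi) one_ne_zero (by positivity)) :=
      Homeomorph.continuous _
    exact (h1.const_smul k).add ((AddCircle.continuous_mk' _).comp a.continuous_coe)⟩,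
    k, a, fun x => mkFun_coe k a x⟩

theorem mk_coe (k : ℤ) (a : HR t) (x : ℝ) :
    mk k a (x : S1) = ((4 * Real.pi * k * x + a (x : S1) : ℝ) : S4π) := mkFun_coe k a x

theorem exists_mk (α : CircMap t) : ∃ (k : ℤ) (a : HR t), mk k a = α := by
  obtain ⟨α, k, a, h⟩ := α
  refine ⟨k, a, DFunLike.coe_injective (funext fun x => ?_)⟩
  induction x using QuotientAddGroup.induction_on with
  | H y => exact (mk_coe k a y).trans (h y).symm

/-- Two lifts of the same map have the same winding number and differ by a constant. -/
theorem mk_eq_mk {k j : ℤ} {a b : HR t} :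
    mk k a = mk j b ↔ k = j ∧ ∃ m : ℤ, ∀ x : S1, a x = b x + 4 * Real.pi * m := by
  have hpi := Real.pi_pos
  constructor
  · intro h
    have h1 : ∀ x : ℝ, ∃ m : ℤ,
        (4 * Real.pi * k * x + a (x : S1)) - (4 * Real.pi * j * x + b (x : S1)) =
          m * (4 * Real.pi) := by
      intro x
      have := DFunLike.congr_fun h (x : S1)
      rw [mk_coe, mk_coe, ← sub_eq_zero, ← AddCircle.coe_sub, AddCircle.coe_eq_zero_iff] at this
      obtain ⟨m, hm⟩ := this
      exact ⟨m, by rw [← hm, zsmul_eq_mul]⟩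
    choose m hm using h1
    have hmc : Continuous fun x : ℝ => (m x : ℝ) := by
      have e : (fun x : ℝ => (m x : ℝ)) = fun x : ℝ =>
          ((4 * Real.pi * k * x + a (x : S1)) - (4 * Real.pi * j * x + b (x : S1))) /
            (4 * Real.pi) := by
        funext x
        rw [hm x]
        field_simp
      rw [e]
      have ha : Continuous fun x : ℝ => a (x : S1) :=
        a.continuous_coe.comp (AddCircle.continuous_mk' 1)
      have hb : Continuous fun x : ℝ => b (x : S1) :=
        b.continuous_coe.comp (AddCircle.continuous_mk' 1)
      exact ((((continuous_const.mul continuous_id).add ha).sub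
        ((continuous_const.mul continuous_id).add hb))).div_const _
    have hmc' : Continuous m := Int.isClosedEmbedding_coe_real.isInducing.continuous_iff.mpr hmc
    have hconst : ∀ x : ℝ, m x = m 0 := fun x =>
      PreconnectedSpace.constant inferInstance hmc'
    have hk : k = j := by
      have e0 := hm 0
      have e1 := hm 1
      rw [hconst 1] at e1
      have c1 : ((1 : ℝ) : S1) = ((0 : ℝ) : S1) := coe_eq_coe.mpr ⟨1, by norm_num⟩
      rw [c1] at e1
      have : 4 * Real.pi * ((k : ℝ) - j) = 0 := by linarith
      have := (mul_eq_zero.mp this).resolve_left (by positivity)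
      exact_mod_cast sub_eq_zero.mp this
    refine ⟨hk, m 0, fun x => ?_⟩
    induction x using QuotientAddGroup.induction_on with
    | H y =>
      have e := hm y
      rw [hconst y, hk] at e
      change a (y : S1) = b (y : S1) + _
      linarith
  · rintro ⟨rfl, m, h⟩
    refine DFunLike.coe_injective (funext fun x => ?_)
    induction x using QuotientAddGroup.induction_on with
    | H y =>
      refine (mk_coe k a y).trans (Eq.trans ?_ (mk_coe k b y).symm)
      rw [← sub_eq_zero, ← AddCircle.coe_sub, AddCircle.coe_eq_zero_iff]
      refine ⟨m, ?_⟩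
      have := h (y : S1)
      rw [this, zsmul_eq_mul]
      ring

/-- The final topology for the maps `a ↦ 4πk x + a(x)`, for all `k`. -/
instance : TopologicalSpace (CircMap t) :=
  ⨆ k : ℤ, TopologicalSpace.coinduced (mk k : HR t → CircMap t) inferInstance

theorem isOpen_iff {U : Set (CircMap t)} :
    IsOpen U ↔ ∀ k : ℤ, IsOpen ((mk k : HR t → CircMap t) ⁻¹' U) := by
  change IsOpen[⨆ k : ℤ, TopologicalSpace.coinduced (mk k : HR t → CircMap t) inferInstance] U ↔ _
  rw [isOpen_iSup_iff]
  exact forall_congr' fun k => isOpen_coinduced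

theorem continuous_mk (k : ℤ) : Continuous (mk k : HR t → CircMap t) :=
  continuous_def.mpr fun _ hU => isOpen_iff.mp hU k

/-- The constant functions. -/
def const (t : ℝ) (c : ℝ) : HR t :=
  ⟨ContinuousMap.const _ c, by
    have h : complexify (ContinuousMap.const S1 c) = (c : ℂ) • (1 : C(S1, ℂ)) := by
      ext x
      simp [complexify]
    change complexify (ContinuousMap.const S1 c) ∈ sobolevSubmodule t
    rw [h]
    exact (sobolevSubmodule t).smul_mem _ (HC.one_mem t)⟩

theorem const_apply (c : ℝ) (x : S1) : const t c x = c := rfl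

theorem isOpenMap_mk (k : ℤ) : IsOpenMap (mk k : HR t → CircMap t) := by
  intro V hV
  refine isOpen_iff.mpr fun j => ?_
  by_cases hkj : k = j
  · subst hkj
    have : mk k ⁻¹' (mk k '' V) =
        ⋃ m : ℤ, (fun b : HR t => b + const t (4 * Real.pi * m)) ⁻¹' V := by
      ext b
      simp only [Set.mem_preimage, Set.mem_image, Set.mem_iUnion]
      constructor
      · rintro ⟨a, ha, hab⟩
        obtain ⟨-, m, hm⟩ := mk_eq_mk.mp hab
        refine ⟨m, ?_⟩
        have : b + const t (4 * Real.pi * m) = a :=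
          DFunLike.coe_injective (funext fun x => (hm x).symm)
        rwa [this]
      · rintro ⟨m, hm⟩
        exact ⟨_, hm, mk_eq_mk.mpr ⟨rfl, m, fun x => rfl⟩⟩
    rw [this]
    exact isOpen_iUnion fun m => hV.preimage (continuous_id.add continuous_const)
  · have : mk j ⁻¹' (mk k '' V) = ∅ := by
      ext b
      simp only [Set.mem_preimage, Set.mem_image, Set.mem_empty_iff_false, iff_false]
      rintro ⟨a, -, hab⟩
      exact hkj (mk_eq_mk.mp hab).1
    rw [this]
    exact isOpen_empty

/-- The functions that are uniformly less than `2π` away from `a`. -/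
def nearby (a : HR t) : Set (HR t) := {b | ∀ x, |b x - a x| < 2 * Real.pi}

theorem isOpen_nearby [ht : Fact (1 / 2 < t)] (a : HR t) : IsOpen (nearby a) := by
  have : nearby a = (fun b : HR t => HR.toCM b - HR.toCM a) ⁻¹'
      {u : C(S1, ℝ) | Set.MapsTo u Set.univ (Set.Ioo (-(2 * Real.pi)) (2 * Real.pi))} := by
    ext b
    simp only [nearby, Set.mem_ofPred_eq, Set.mem_preimage, Set.MapsTo, Set.mem_univ,
      forall_const, Set.mem_Ioo, abs_lt]
    rfl
  rw [this]
  exact (ContinuousMap.isOpen_setOfPred_mapsTo isCompact_univ isOpen_Ioo).preimage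
    ((HR.continuous_toCM ht.out).sub continuous_const)

theorem mem_nearby (a : HR t) : a ∈ nearby a := fun x => by
  rw [sub_self, abs_zero]
  positivity

theorem injOn_mk (k : ℤ) (a : HR t) : Set.InjOn (mk k) (nearby a) := by
  intro b hb c hc h
  obtain ⟨-, m, hm⟩ := mk_eq_mk.mp h
  have hpi := Real.pi_pos
  have h0 : |4 * Real.pi * (m : ℝ)| < 4 * Real.pi := by
    have e : 4 * Real.pi * (m : ℝ) = (b 0 - a 0) - (c 0 - a 0) := by
      rw [hm 0]
      ring
    rw [e]
    have := abs_sub (b 0 - a 0) (c 0 - a 0)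
    have := hb 0
    have := hc 0
    linarith
  have hm0 : m = 0 := by
    rw [abs_mul, abs_of_pos (by positivity)] at h0
    have h1 : |(m : ℝ)| < 1 := by
      by_contra hcon
      push Not at hcon
      nlinarith
    have h2 : |m| < 1 := by exact_mod_cast h1
    exact Int.abs_lt_one_iff.mp h2
  refine DFunLike.coe_injective (funext fun x => ?_)
  have := hm x
  rwa [hm0, Int.cast_zero, mul_zero, add_zero] at this

/-- The chart around `mk k a`: it sends `α` to the `b` near `a` such that `4πk x + b(x)` is a lift
of `α`. -/
def chart [Fact (1 / 2 < t)] (k : ℤ) (a : HR t) : OpenPartialHomeomorph (CircMap t) (HR t) :=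
  (OpenPartialHomeomorph.ofContinuousOpenRestrict ((injOn_mk k a).toPartialEquiv (mk k) (nearby a))
    (continuous_mk k).continuousOn
    ((isOpenMap_mk k).comp (isOpen_nearby a).isOpenMap_subtype_val) (isOpen_nearby a)).symm

/-- The winding number. -/
def winding (α : CircMap t) : ℤ := α.exists_mk.choose

/-- A lift. -/
def someLift (α : CircMap t) : HR t := α.exists_mk.choose_spec.choose

theorem mk_someLift (α : CircMap t) : mk α.winding α.someLift = α :=
  α.exists_mk.choose_spec.choose_spec

instance [Fact (1 / 2 < t)] : ChartedSpace (HR t) (CircMap t) where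
  atlas := {e | ∃ (k : ℤ) (a : HR t), e = chart k a}
  chartAt α := chart α.winding α.someLift
  mem_chart_source α := ⟨α.someLift, mem_nearby _, mk_someLift α⟩
  chart_mem_atlas _ := ⟨_, _, rfl⟩

theorem transition_eq [Fact (1 / 2 < t)] {k j : ℤ} {a b x : HR t}
    (hx : x ∈ ((chart k a).symm.trans (chart j b)).source) : k = j ∧
      ∃ m : ℤ, ∀ y, x y = chart j b (mk k x) y + 4 * Real.pi * m := by
  have h : mk j (chart j b (mk k x)) = mk k x := (chart j b).left_inv hx.2
  exact mk_eq_mk.mp h.symm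

instance [ht : Fact (1 / 2 < t)] : IsManifold 𝓘(ℝ, HR t) ∞ (CircMap t) := by
  refine isManifold_of_contDiffOn _ _ _ ?_
  rintro _ _ ⟨k, a, rfl⟩ ⟨j, b, rfl⟩
  simp only [modelWithCornersSelf_coe, modelWithCornersSelf_coe_symm, Set.range_id, Set.inter_univ,
    Set.preimage_id, Function.id_comp, Function.comp_id]
  set T := (chart k a).symm.trans (chart j b) with hT
  intro x₀ hx₀
  have hev : Continuous fun x : HR t => x 0 :=
    (continuous_eval_const (F := C(S1, ℝ)) (0 : S1)).comp (HR.continuous_toCM ht.out)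
  have hTc : ContinuousAt T x₀ := T.continuousAt hx₀
  have hd : ContinuousAt (fun x : HR t => x 0 - T x 0) x₀ :=
    hev.continuousAt.sub (hev.continuousAt.comp hTc)
  have hpi : 0 < 4 * Real.pi := by positivity
  have hclose : ∀ᶠ x in 𝓝 x₀, |(x 0 - T x 0) - (x₀ 0 - T x₀ 0)| < 4 * Real.pi := by
    have := Metric.continuousAt_iff'.mp hd (4 * Real.pi) hpi
    simp only [Real.dist_eq] at this
    exact this
  have hloc : ∀ᶠ x in 𝓝 x₀, T x = x + (T x₀ - x₀) := by
    filter_upwards [hclose, T.open_source.mem_nhds hx₀] with x hx hxs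
    obtain ⟨-, m, hm⟩ := transition_eq hxs
    obtain ⟨-, m₀, hm₀⟩ := transition_eq hx₀
    change ∀ y, x y = T x y + 4 * Real.pi * m at hm
    change ∀ y, x₀ y = T x₀ y + 4 * Real.pi * m₀ at hm₀
    have e : (x 0 - T x 0) - (x₀ 0 - T x₀ 0) = 4 * Real.pi * ((m - m₀ : ℤ) : ℝ) := by
      rw [hm 0, hm₀ 0]
      push_cast
      ring
    rw [e, abs_mul, abs_of_pos hpi] at hx
    have h1 : |((m - m₀ : ℤ) : ℝ)| < 1 := by
      by_contra hcon
      push Not at hcon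
      nlinarith
    have h2 : |m - m₀| < 1 := by exact_mod_cast h1
    have h3 : m = m₀ := by
      have := Int.abs_lt_one_iff.mp h2
      omega
    refine DFunLike.coe_injective (funext fun y => ?_)
    change T x y = x y + (T x₀ y - x₀ y)
    rw [hm y, hm₀ y, h3]
    ring
  have hs : ContDiffAt ℝ ∞ (fun x : HR t => x + (T x₀ - x₀)) x₀ :=
    contDiffAt_id.add contDiffAt_const
  exact (hs.congr_of_eventuallyEq hloc).contDiffWithinAt

end CircMap

/-! ### The unit sphere and the nowhere vanishing functions -/

namespace HC

variable {t : ℝ}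

/-- The real inner product `Re ∫ f ḡ dx` of `L²(S¹; ℂ)`, for elements of `H^t(S¹; ℂ)`. -/
def l2Inner (f g : HC t) : ℝ := (∫ x, f x * (starRingEnd ℂ) (g x) ∂haarAddCircle).re

theorem integrable_mul_conj (f g : HC t) :
    Integrable (fun x => f x * (starRingEnd ℂ) (g x)) (haarAddCircle (T := 1)) :=
  (f.continuous_coe.mul (Complex.continuous_conj.comp g.continuous_coe)).integrable_of_hasCompactSupport
    (HasCompactSupport.of_compactSpace _)

theorem l2Inner_add_left (f f' g : HC t) : l2Inner (f + f') g = l2Inner f g + l2Inner f' g := by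
  rw [l2Inner, l2Inner, l2Inner, ← Complex.add_re,
    ← integral_add (integrable_mul_conj f g) (integrable_mul_conj f' g)]
  simp only [coe_add, Pi.add_apply, add_mul]

theorem l2Inner_smul_left (c : ℝ) (f g : HC t) : l2Inner (c • f) g = c * l2Inner f g := by
  rw [l2Inner, l2Inner, ← Complex.re_ofReal_mul, ← integral_const_mul]
  simp only [coe_real_smul, Pi.smul_apply, Complex.real_smul, mul_assoc]

theorem l2Inner_comm (f g : HC t) : l2Inner f g = l2Inner g f := by
  rw [l2Inner, l2Inner, ← Complex.conj_re, ← integral_conj]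
  congr 2
  funext x
  simp [mul_comm]

theorem l2Inner_add_right (f g g' : HC t) : l2Inner f (g + g') = l2Inner f g + l2Inner f g' := by
  rw [l2Inner_comm, l2Inner_add_left, l2Inner_comm g, l2Inner_comm g']

theorem l2Inner_smul_right (c : ℝ) (f g : HC t) : l2Inner f (c • g) = c * l2Inner f g := by
  rw [l2Inner_comm, l2Inner_smul_left, l2Inner_comm g]

theorem l2Inner_self (f : HC t) : l2Inner f f = ∫ x, ‖f x‖ ^ 2 ∂haarAddCircle := by
  rw [l2Inner]
  have : (fun x => f x * (starRingEnd ℂ) (f x)) = fun x => ((‖f x‖ ^ 2 : ℝ) : ℂ) := by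
    funext x
    rw [Complex.mul_conj, Complex.normSq_eq_norm_sq]
  rw [this, integral_complex_ofReal, Complex.ofReal_re]

theorem l2Inner_self_eq_zero {f : HC t} (h : l2Inner f f = 0) : f = 0 := by
  rw [l2Inner_self] at h
  have hc : Continuous fun x => ‖f x‖ ^ 2 := f.continuous_coe.norm.pow 2
  have := (integral_eq_zero_iff_of_nonneg (fun x => by positivity)
    (hc.integrable_of_hasCompactSupport (HasCompactSupport.of_compactSpace _))).mp h
  have h2 := (Continuous.ae_eq_iff_eq haarAddCircle hc continuous_const).mp this
  refine DFunLike.coe_injective (funext fun x => ?_)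
  have h3 := congrFun h2 x
  exact norm_eq_zero.mp (pow_eq_zero_iff two_ne_zero |>.mp h3)

theorem l2Inner_one_one : l2Inner (1 : HC t) 1 = 1 := by
  rw [l2Inner_self]
  simp

theorem l2Inner_one_right (f : HC t) : l2Inner f 1 = (∫ x, f x ∂haarAddCircle).re := by
  simp [l2Inner]

theorem exists_l2_bound (ht : 1 / 2 < t) : ∃ C : ℝ, ∀ f g : HC t,
    ‖l2Inner f g‖ ≤ C * ‖f‖ * ‖g‖ := by
  obtain ⟨C, hC⟩ := exists_sup_bound ht
  refine ⟨C * C, fun f g => ?_⟩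
  refine (Complex.abs_re_le_norm _).trans ?_
  have := norm_integral_le_of_norm_le_const (μ := haarAddCircle (T := 1))
    (f := fun x => f x * (starRingEnd ℂ) (g x)) (C := C * ‖f‖ * (C * ‖g‖))
    (Filter.Eventually.of_forall fun x => by
      rw [norm_mul, RCLike.norm_conj]
      exact mul_le_mul (hC f x) (hC g x) (norm_nonneg _) ((norm_nonneg _).trans (hC f x)))
  refine this.trans (le_of_eq ?_)
  simp
  ring

/-- The class of `f` in `L²(S¹; ℂ)`. -/
def toL2 (f : HC t) : Lp ℂ 2 (haarAddCircle (T := 1)) :=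
  ContinuousMap.toLp 2 haarAddCircle ℂ (toCM f)

/-- The `L²` inner product as a bounded bilinear form. -/
def l2Form (ht : 1 / 2 < t) : HC t →L[ℝ] HC t →L[ℝ] ℝ :=
  LinearMap.mkContinuous₂ (LinearMap.mk₂ ℝ l2Inner l2Inner_add_left l2Inner_smul_left
    l2Inner_add_right l2Inner_smul_right) (exists_l2_bound ht).choose (exists_l2_bound ht).choose_spec

theorem l2Form_apply (ht : 1 / 2 < t) (f g : HC t) : l2Form ht f g = l2Inner f g := rfl

theorem contDiff_l2Inner (ht : 1 / 2 < t) {E : Type*} [NormedAddCommGroup E] [NormedSpace ℝ E]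
    {n : WithTop ℕ∞} {u v : E → HC t} (hu : ContDiff ℝ n u) (hv : ContDiff ℝ n v) :
    ContDiff ℝ n fun x => l2Inner (u x) (v x) :=
  ((l2Form ht).contDiff.comp hu).clm_apply hv

end HC

/-- The closed subspace `1^⊥` of the functions `h` in `H^t(S¹; ℂ)` with `⟨h, 1⟩ = 0`. -/
def onePerp (t : ℝ) : Submodule ℝ (HC t) where
  carrier := {h | HC.l2Inner h 1 = 0}
  add_mem' {a b} (ha : HC.l2Inner a 1 = 0) (hb : HC.l2Inner b 1 = 0) := by
    change HC.l2Inner (a + b) 1 = 0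
    rw [HC.l2Inner_add_left, ha, hb, add_zero]
  zero_mem' := by
    change HC.l2Inner 0 1 = 0
    simp [HC.l2Inner]
  smul_mem' c a (ha : HC.l2Inner a 1 = 0) := by
    change HC.l2Inner (c • a) 1 = 0
    rw [HC.l2Inner_smul_left, ha, mul_zero]

/-- The functions of class `H^t` in the unit sphere of `L²(S¹; ℂ)`, with the topology of `H^t`. -/
abbrev Sph (t : ℝ) : Type := {f : HC t // ∫ x, ‖f x‖ ^ 2 ∂haarAddCircle = 1}

namespace Sph

variable {t : ℝ}

theorem l2Inner_self (f : Sph t) : HC.l2Inner f.1 f.1 = 1 := by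
  rw [HC.l2Inner_self]
  exact f.2

theorem perp_mem (f : HC t) : f - HC.l2Inner f 1 • (1 : HC t) ∈ onePerp t := by
  change HC.l2Inner (f - HC.l2Inner f 1 • (1 : HC t)) 1 = 0
  rw [sub_eq_add_neg, ← neg_smul, HC.l2Inner_add_left, HC.l2Inner_smul_left, HC.l2Inner_one_one]
  ring

/-- The orthogonal projection `f ↦ f - ⟨f, 1⟩` onto `1^⊥`. -/
def perpProj [ht : Fact (1 / 2 < t)] : HC t →L[ℝ] onePerp t :=
  (ContinuousLinearMap.id ℝ (HC t) -
    ((HC.l2Form ht.out).flip 1).smulRight (1 : HC t)).codRestrict (onePerp t) perp_mem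

/-- The function `(f - ⟨f, 1⟩) / (1 + ε ⟨f, 1⟩)`. -/
def stereoFun [Fact (1 / 2 < t)] (ε : ℝ) (f : HC t) : onePerp t :=
  (1 + ε * HC.l2Inner f 1)⁻¹ • perpProj f

/-- The function `(2 h - ε (‖h‖² - 1)) / (‖h‖² + 1)`. -/
def stereoInv (ε : ℝ) (h : HC t) : HC t :=
  (HC.l2Inner h h + 1)⁻¹ • ((2 : ℝ) • h - (ε * (HC.l2Inner h h - 1)) • (1 : HC t))

theorem l2Inner_self_nonneg (h : HC t) : 0 ≤ HC.l2Inner h h := by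
  rw [HC.l2Inner_self]
  positivity

theorem l2Inner_stereoInv_one (ε : ℝ) (h : onePerp t) : HC.l2Inner (stereoInv ε (h : HC t)) 1 =
    (HC.l2Inner (h : HC t) h + 1)⁻¹ * (-(ε * (HC.l2Inner (h : HC t) h - 1))) := by
  have h0 : HC.l2Inner (h : HC t) 1 = 0 := h.2
  rw [stereoInv, sub_eq_add_neg, ← neg_smul, HC.l2Inner_smul_left, HC.l2Inner_add_left,
    HC.l2Inner_smul_left, HC.l2Inner_smul_left, h0, HC.l2Inner_one_one]
  ring

theorem stereoInv_mem {ε : ℝ} (hε : ε * ε = 1) (h : onePerp t) :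
    ∫ x, ‖stereoInv ε (h : HC t) x‖ ^ 2 ∂haarAddCircle = 1 := by
  have h0 : HC.l2Inner (h : HC t) 1 = 0 := h.2
  have h0' : HC.l2Inner (1 : HC t) h = 0 := by rw [HC.l2Inner_comm, h0]
  have hp := l2Inner_self_nonneg (h : HC t)
  rw [← HC.l2Inner_self, stereoInv, sub_eq_add_neg, ← neg_smul]
  simp only [HC.l2Inner_smul_left, HC.l2Inner_smul_right, HC.l2Inner_add_left,
    HC.l2Inner_add_right, HC.l2Inner_one_one, h0, h0']
  have : HC.l2Inner (h : HC t) h + 1 ≠ 0 := by positivity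
  field_simp
  linear_combination (HC.l2Inner (h : HC t) h - 1) ^ 2 * hε

theorem one_add_ne_zero {ε : ℝ} (hε : ε * ε = 1) {f : Sph t} (hf : f.1 ≠ -(ε • (1 : HC t))) :
    1 + ε * HC.l2Inner f.1 1 ≠ 0 := by
  intro h
  apply hf
  rw [← sub_eq_zero, sub_neg_eq_add]
  apply HC.l2Inner_self_eq_zero
  simp only [HC.l2Inner_smul_left, HC.l2Inner_smul_right, HC.l2Inner_add_left,
    HC.l2Inner_add_right, HC.l2Inner_one_one, l2Inner_self, HC.l2Inner_comm (1 : HC t) f.1]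
  linear_combination 2 * h + hε

theorem contDiff_stereoInv (ht : 1 / 2 < t) (ε : ℝ) {n : WithTop ℕ∞} :
    ContDiff ℝ n fun h : onePerp t => stereoInv ε (h : HC t) := by
  have hv : ContDiff ℝ n fun h : onePerp t => (h : HC t) := (onePerp t).subtypeL.contDiff
  have hq : ContDiff ℝ n fun h : onePerp t => HC.l2Inner (h : HC t) h :=
    HC.contDiff_l2Inner ht hv hv
  have hi : ContDiff ℝ n fun h : onePerp t => (HC.l2Inner (h : HC t) h + 1)⁻¹ :=
    (hq.add contDiff_const).inv fun h => by
      have := l2Inner_self_nonneg (h : HC t)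
      positivity
  exact hi.smul ((contDiff_const.smul hv).sub ((contDiff_const.mul (hq.sub contDiff_const)).smul
      contDiff_const))

theorem contDiffAt_stereoFun [ht : Fact (1 / 2 < t)] (ε : ℝ) {n : WithTop ℕ∞} {f : HC t}
    (hf : 1 + ε * HC.l2Inner f 1 ≠ 0) : ContDiffAt ℝ n (stereoFun ε) f := by
  have hq : ContDiffAt ℝ n (fun f : HC t => 1 + ε * HC.l2Inner f 1) f :=
    (contDiff_const.add (contDiff_const.mul
      (HC.contDiff_l2Inner ht.out contDiff_id contDiff_const))).contDiffAt
  exact (hq.inv hf).smul perpProj.contDiff.contDiffAt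

/-- The stereographic projection from the pole `-ε`, where `ε = ± 1`. -/
def stereo [ht : Fact (1 / 2 < t)] (ε : ℝ) (hε : ε * ε = 1) :
    OpenPartialHomeomorph (Sph t) (onePerp t) where
  toFun f := stereoFun ε f.1
  invFun h := ⟨stereoInv ε h, stereoInv_mem hε h⟩
  source := {f | f.1 ≠ -(ε • (1 : HC t))}
  target := Set.univ
  map_source' _ _ := Set.mem_univ _
  map_target' h _ := by
    intro hcon
    change stereoInv ε (h : HC t) = _ at hcon
    have h1 := congrArg (fun u => HC.l2Inner u (1 : HC t)) hcon
    simp only [l2Inner_stereoInv_one, ← neg_smul, HC.l2Inner_smul_left, HC.l2Inner_one_one] at h1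
    have hp := l2Inner_self_nonneg (h : HC t)
    have hne : HC.l2Inner (h : HC t) h + 1 ≠ 0 := by positivity
    have hε0 : ε ≠ 0 := fun h0 => by simp [h0] at hε
    field_simp at h1
    linarith
  left_inv' f hf := by
    have hd := one_add_ne_zero hε hf
    have hff := l2Inner_self f
    apply Subtype.ext
    change stereoInv ε ((stereoFun ε f.1 : onePerp t) : HC t) = f.1
    set c := HC.l2Inner f.1 1 with hc
    have e1 : ((stereoFun ε f.1 : onePerp t) : HC t) = (1 + ε * c)⁻¹ • (f.1 - c • (1 : HC t)) := rfl
    have e2 : HC.l2Inner (f.1 - c • (1 : HC t)) (f.1 - c • (1 : HC t)) = 1 - c ^ 2 := by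
      rw [sub_eq_add_neg, ← neg_smul]
      simp only [HC.l2Inner_smul_left, HC.l2Inner_smul_right, HC.l2Inner_add_left,
        HC.l2Inner_add_right, HC.l2Inner_one_one, hff, HC.l2Inner_comm (1 : HC t) f.1, ← hc]
      ring
    have e3 : HC.l2Inner ((stereoFun ε f.1 : onePerp t) : HC t) (stereoFun ε f.1 : onePerp t) =
        (1 + ε * c)⁻¹ ^ 2 * (1 - c ^ 2) := by
      rw [e1, HC.l2Inner_smul_left, HC.l2Inner_smul_right, e2]
      ring
    rw [stereoInv, e3, e1]
    have e4 : (1 + ε * c)⁻¹ ^ 2 * (1 - c ^ 2) + 1 = 2 * (1 + ε * c)⁻¹ := by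
      field_simp
      linear_combination c ^ 2 * hε
    have e5 : ε * ((1 + ε * c)⁻¹ ^ 2 * (1 - c ^ 2) - 1) = -(2 * c * (1 + ε * c)⁻¹) := by
      field_simp
      linear_combination (-(2 * c) - ε * c ^ 2) * hε
    rw [e4, e5, neg_smul, sub_neg_eq_add, smul_smul, smul_sub, smul_smul]
    have e6 : (2 * (1 + ε * c)⁻¹)⁻¹ = (1 + ε * c) / 2 := by
      field_simp
    rw [e6, show (2 * (1 + ε * c)⁻¹ * c) = 2 * c * (1 + ε * c)⁻¹ by ring, sub_add_cancel, smul_smul]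
    have e7 : (1 + ε * c) / 2 * (2 * (1 + ε * c)⁻¹) = 1 := by field_simp
    rw [e7, one_smul]
  right_inv' h _ := by
    apply Subtype.ext
    change (1 + ε * HC.l2Inner (stereoInv ε (h : HC t)) 1)⁻¹ •
      (stereoInv ε (h : HC t) - HC.l2Inner (stereoInv ε (h : HC t)) 1 • (1 : HC t)) = (h : HC t)
    rw [l2Inner_stereoInv_one, stereoInv]
    have hp := l2Inner_self_nonneg (h : HC t)
    set q := HC.l2Inner (h : HC t) h with hq
    have hne : q + 1 ≠ 0 := by positivity
    have e1 : 1 + ε * ((q + 1)⁻¹ * (-(ε * (q - 1)))) = 2 * (q + 1)⁻¹ := by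
      field_simp
      linear_combination (1 - q) * hε
    rw [e1, show (q + 1)⁻¹ * (-(ε * (q - 1))) = -((q + 1)⁻¹ * (ε * (q - 1))) by ring, neg_smul,
      sub_neg_eq_add, smul_sub (q + 1)⁻¹, smul_smul (q + 1)⁻¹, smul_smul (q + 1)⁻¹, sub_add_cancel,
      smul_smul]
    have e2 : (2 * (q + 1)⁻¹)⁻¹ * ((q + 1)⁻¹ * 2) = 1 := by field_simp
    rw [e2, one_smul]
  open_source := isOpen_ne.preimage continuous_subtype_val
  open_target := isOpen_univ
  continuousOn_toFun := fun f hf =>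
    ((contDiffAt_stereoFun (n := 0) ε (one_add_ne_zero hε hf)).continuousAt.comp
      continuous_subtype_val.continuousAt).continuousWithinAt
  continuousOn_invFun := ((contDiff_stereoInv (n := 0) ht.out ε).continuous.subtype_mk _).continuousOn

/-- The projection `σ_S(f) = (f - ⟨f, 1⟩) / (1 + ⟨f, 1⟩)` from the south pole `-1`. -/
def sigmaS [Fact (1 / 2 < t)] : OpenPartialHomeomorph (Sph t) (onePerp t) := stereo 1 (by norm_num)

/-- The projection `σ_N(f) = (f - ⟨f, 1⟩) / (1 - ⟨f, 1⟩)` from the north pole `1`. -/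
def sigmaN [Fact (1 / 2 < t)] : OpenPartialHomeomorph (Sph t) (onePerp t) :=
  stereo (-1) (by norm_num)

theorem one_ne_neg_one : (1 : HC t) ≠ -1 := by
  intro h
  have := DFunLike.congr_fun h 0
  norm_num at this

open Classical in
instance [Fact (1 / 2 < t)] : ChartedSpace (onePerp t) (Sph t) where
  atlas := {sigmaS, sigmaN}
  chartAt f := if f.1 = -1 then sigmaN else sigmaS
  mem_chart_source f := by
    split_ifs with h
    · change f.1 ≠ -((-1 : ℝ) • (1 : HC t))
      rw [h, neg_smul, one_smul, neg_neg]
      exact one_ne_neg_one.symm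
    · change f.1 ≠ -((1 : ℝ) • (1 : HC t))
      rw [one_smul]
      exact h
  chart_mem_atlas f := by
    split_ifs
    · exact Or.inr rfl
    · exact Or.inl rfl

theorem contDiffOn_transition [ht : Fact (1 / 2 < t)] {ε ε' : ℝ} (hε : ε * ε = 1)
    (hε' : ε' * ε' = 1) : ContDiffOn ℝ ∞ ((stereo (t := t) ε hε).symm.trans (stereo ε' hε'))
      ((stereo (t := t) ε hε).symm.trans (stereo ε' hε')).source := by
  intro h hh
  have hne := one_add_ne_zero (f := (stereo (t := t) ε hε).symm h) hε' hh.2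
  exact ((contDiffAt_stereoFun ε' hne).comp h
    (contDiff_stereoInv ht.out ε).contDiffAt).contDiffWithinAt

instance [ht : Fact (1 / 2 < t)] : IsManifold 𝓘(ℝ, onePerp t) ∞ (Sph t) := by
  refine isManifold_of_contDiffOn _ _ _ ?_
  intro e e' he he'
  simp only [modelWithCornersSelf_coe, modelWithCornersSelf_coe_symm, Set.range_id, Set.inter_univ,
    Set.preimage_id, Function.id_comp, Function.comp_id]
  rcases he with rfl | rfl <;> rcases he' with rfl | rfl <;> exact contDiffOn_transition _ _

end Sph

theorem isOpen_nonvanishing {t : ℝ} (ht : 1 / 2 < t) : IsOpen {f : HC t | ∀ x, f x ≠ 0} := by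
  obtain ⟨C, hC⟩ := HC.exists_sup_bound ht
  have hcont : Continuous (HC.toCM : HC t → C(S1, ℂ)) :=
    (LinearMap.mkContinuous HC.toCM C fun f =>
      (ContinuousMap.norm_le_of_nonempty _).mpr (hC f)).continuous
  have : {f : HC t | ∀ x, f x ≠ 0} =
      HC.toCM ⁻¹' {u : C(S1, ℂ) | Set.MapsTo u Set.univ {0}ᶜ} := by
    ext f
    simp [Set.MapsTo]
    rfl
  rw [this]
  exact (ContinuousMap.isOpen_setOfPred_mapsTo isCompact_univ isOpen_compl_singleton).preimage hcont

/-- The open subset `𝒰^t` of nowhere vanishing functions. -/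
def nonvanishingOpens (t : ℝ) [ht : Fact (1 / 2 < t)] : TopologicalSpace.Opens (Sph t) where
  carrier := {f | ∀ x, f.1 x ≠ 0}
  is_open' := (isOpen_nonvanishing ht.out).preimage continuous_subtype_val

/-- The manifold `𝒰^t`, an open submanifold of the sphere. -/
abbrev 𝒰 (t : ℝ) [Fact (1 / 2 < t)] : Type := ↥(nonvanishingOpens t)

/-- The inclusion of `𝒰^t` into `H^t(S¹; ℂ)`. -/
def inclU {t : ℝ} [Fact (1 / 2 < t)] (f : 𝒰 t) : HC t := f.1.1

/-- The weak Riemannian metric on `𝒰^t` inherited from `L²(S¹; ℂ)`: tangent vectors are mapped to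
functions by the differential of the inclusion. -/
def metricU {t : ℝ} [Fact (1 / 2 < t)] (f : 𝒰 t) (X Y : TangentSpace 𝓘(ℝ, onePerp t) f) : ℝ :=
  HC.l2Inner (mfderiv 𝓘(ℝ, onePerp t) 𝓘(ℝ, HC t) inclU f X : HC t)
    (mfderiv 𝓘(ℝ, onePerp t) 𝓘(ℝ, HC t) inclU f Y : HC t)

/-! ### The group `G^s` as a weak Riemannian manifold -/

instance fact_three_half {s : ℝ} [h : Fact (5 / 2 < s)] : Fact (3 / 2 < s) :=
  ⟨by linarith [h.out]⟩

instance fact_sub_one {s : ℝ} [h : Fact (5 / 2 < s)] : Fact (1 / 2 < s - 1) :=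
  ⟨by linarith [h.out]⟩

/-- Pairs `(φ, α)` of a homeomorphism of the circle and a continuous map `S¹ → S¹_{4π}`. -/
@[ext]
structure SemidirectPair where
  /-- The first component `φ`. -/
  homeo : S1 ≃ₜ S1
  /-- The second component `α`. -/
  angle : C(S1, S4π)

namespace SemidirectPair

/-- The semidirect product multiplication `(φ, α) (ψ, β) = (φ ∘ ψ, β + α ∘ ψ)`. -/
instance : Mul SemidirectPair where
  mul p q := ⟨p.homeo * q.homeo, q.angle + p.angle.comp q.homeo⟩

/-- The neutral element `(id, 0)`. -/
instance : One SemidirectPair where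
  one := ⟨1, 0⟩

/-- The inverse `(φ⁻¹, - α ∘ φ⁻¹)`. -/
instance : Inv SemidirectPair where
  inv p := ⟨p.homeo⁻¹, -(p.angle.comp (p.homeo⁻¹ : S1 ≃ₜ S1))⟩

instance : Group SemidirectPair :=
  Group.ofLeftAxioms
    (fun p q r => SemidirectPair.ext (mul_assoc p.homeo q.homeo r.homeo)
      (ContinuousMap.ext fun x =>
        (add_assoc (r.angle x) (q.angle (r.homeo x)) (p.angle (q.homeo (r.homeo x)))).symm))
    (fun p => SemidirectPair.ext (one_mul p.homeo)
      (ContinuousMap.ext fun x => add_zero (p.angle x)))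
    (fun p => SemidirectPair.ext (inv_mul_cancel p.homeo)
      (ContinuousMap.ext fun x => by
        change p.angle x + -(p.angle (p.homeo.symm (p.homeo x))) = 0
        rw [Homeomorph.symm_apply_apply, add_neg_cancel]))

/-- The tangent map of the right translation by `p = (ψ, β)`, in each component: a curve
`(φ_t, α_t)` is translated to `(φ_t ∘ ψ, β + α_t ∘ ψ)`, so a tangent vector `(U₁, U₂)` is translated
to `(U₁ ∘ ψ, U₂ ∘ ψ)`. -/
def rightTranslate (p : SemidirectPair) (u : S1 → ℝ) : S1 → ℝ := u ∘ p.homeo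

end SemidirectPair

/-- The Banach manifold `G^s` underlying the semidirect product of `Diff₀^s(S¹)` and
`H^{s-1}(S¹; S¹_{4π})`. -/
abbrev G (s : ℝ) [Fact (5 / 2 < s)] : Type := Diff0 s × CircMap (s - 1)

/-- An element of `G^s` as a member of the semidirect product group of pairs. -/
def G.toPair {s : ℝ} [Fact (5 / 2 < s)] (g : G s) : SemidirectPair :=
  ⟨Diff0.toHomeomorph g.1, g.2.1⟩

/-- The model of the manifold `G^s`, with model space `H_0^s(S¹; ℝ) × H^{s-1}(S¹; ℝ)`. -/
abbrev modelG (s : ℝ) :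
    ModelWithCorners ℝ (H0 s × HR (s - 1)) (ModelProd (H0 s) (HR (s - 1))) :=
  𝓘(ℝ, H0 s).prod 𝓘(ℝ, HR (s - 1))

/-- The inner product `¼ ∫ (u_x v_x + ρ τ) dx` at the identity. -/
def metricId (u ρ v τ : S1 → ℝ) : ℝ :=
  1 / 4 * ∫ x, (circleDeriv u x * circleDeriv v x + ρ x * τ x) ∂haarAddCircle

/-- The right-invariant metric on `G^s`: its value at `g` is the inner product at the identity
of the tangent vectors right translated by `g⁻¹`. A tangent vector at `g` is a pair of functions,
by means of the charts of `G^s`. -/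
def metricG {s : ℝ} [Fact (5 / 2 < s)] (g : G s) (U V : TangentSpace (modelG s) g) : ℝ :=
  let U' : H0 s × HR (s - 1) := U
  let V' : H0 s × HR (s - 1) := V
  let p : SemidirectPair := (G.toPair g)⁻¹
  metricId (p.rightTranslate (U'.1 : HR s)) (p.rightTranslate U'.2)
    (p.rightTranslate (V'.1 : HR s)) (p.rightTranslate V'.2)

/-- The function `e^{iθ/2}` of an angle `θ` modulo `4π`. -/
def expHalf (θ : S4π) : ℂ := θ.toCircle

theorem expHalf_coe (θ : ℝ) : expHalf (θ : S4π) = Complex.exp (Complex.I * θ / 2) := by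
  rw [expHalf, AddCircle.toCircle_apply_mk, Circle.coe_exp]
  congr 1
  have : (Real.pi : ℂ) ≠ 0 := by exact_mod_cast Real.pi_ne_zero
  push_cast
  field_simp
  ring

end TwoHS

end

/-!
`Φ` lands in the sphere because `|Φ(φ, α)|² = φ_x` has integral one, and it is injective because
`|Φ|²` determines `φ` (as `φ(0) = 0`) and `Φ / |Φ|` determines `α` modulo `4π`. What needs work is
that it is onto the nowhere vanishing functions of class `H^{s-1}` and smooth in both directions.
Put `t = s - 1 > 1/2`; then `H^t(S¹; ℂ)` is a commutative Banach algebra `SobolevAlg t`, by Young's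
inequality for the convolution of Fourier coefficients, and everything is expressed through its
exponential map.

* Wiener's lemma (`SobolevAlg.isUnit_of_forall_ne_zero`): a nowhere vanishing element is invertible.
  By Gelfand theory it suffices that every character is an evaluation. The norms of `e^{2πinx}` grow
  only polynomially in `n`, so a character has modulus one at `e^{2πix}` and agrees there with an
  evaluation; trigonometric polynomials are dense.
* Logarithms (`SobolevAlg.exists_monomial_mul_exp`): every nowhere vanishing `f` is of the form
  `e^{2πikx} exp q`. The functions of this form are an open, hence closed, subgroup of the units. It
  contains the functions with values in the right half plane, which are joined to `1` by segments of
  units, so it contains the invertible trigonometric polynomials, which are products of factors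
  `e^{2πix} - a`; and these are dense.
* Smoothness: `exp` has the differential `exp q · dq`, which is invertible, so there are smooth local
  logarithms (`exists_local_log`). In the charts of `G^s` the map is
  `Φ = e^{2πikx} exp ((log φ_x + i a) / 2)` (`polar`), and its inverse sends `f` to the antiderivative
  of `|f|²` and to the class modulo `4π` of `4πkx + 2 Im log (e^{-2πikx} f)`.
* Isometry: the differential of `Φ` is `(U₁, U₂) ↦ Φ · (U₁ₓ / φ_x + i U₂) / 2`
  (`hasMFDerivAt_phiAlg`), hence the `L²` metric pulls back to
  `¼ ∫ (U₁ₓ V₁ₓ / φ_x² + U₂ V₂) φ_x dx`. This is the right-invariant metric after the change of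
  variables by `φ` (`metricG_eq`).
-/

noncomputable section

namespace TwoHS

/-! ### Fourier coefficients of continuous functions -/

/-- The `n`-th Fourier coefficient as a bounded functional on the continuous functions. -/
def fourierCoeffCLM (n : ℤ) : C(S1, ℂ) →L[ℂ] ℂ :=
  LinearMap.mkContinuous
    { toFun := fun f => fourierCoeff f n
      map_add' := fun f g => congrFun (fourierCoeff.add (integrable_cm f) (integrable_cm g)) n
      map_smul' := fun c f => fourierCoeff.const_smul (T := 1) f c n } 1 fun f => by
    refine (norm_integral_le_of_norm_le_const (C := ‖f‖)
      (Filter.Eventually.of_forall fun x => ?_)).trans ?_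
    · rw [norm_smul, fourier_apply, Circle.norm_coe, one_mul]
      exact f.norm_coe_le_norm x
    · simp

theorem fourierCoeffCLM_apply (n : ℤ) (f : C(S1, ℂ)) : fourierCoeffCLM n f = fourierCoeff f n :=
  rfl

theorem ext_fourierCoeff {f g : C(S1, ℂ)} (h : ∀ n, fourierCoeff f n = fourierCoeff g n) :
    f = g := by
  have h0 : ∀ n, fourierCoeff (f - g : C(S1, ℂ)) n = 0 := fun n => by
    rw [← fourierCoeffCLM_apply, map_sub, fourierCoeffCLM_apply, fourierCoeffCLM_apply, h, sub_self]
  have h1 : fourierCoeff (f - g : C(S1, ℂ)) = 0 := funext h0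
  ext x
  have hs := has_pointwise_sum_fourier_series_of_summable (f := f - g)
    (by rw [h1]; exact summable_zero) x
  rw [h1] at hs
  simp only [Pi.zero_apply, zero_smul] at hs
  exact sub_eq_zero.mp (hs.unique hasSum_zero)

theorem exists_fourierCoeff_eq {c : ℤ → ℂ} (hc : Summable fun n => ‖c n‖) :
    ∃ f : C(S1, ℂ), ∀ n, fourierCoeff f n = c n := by
  have hs : Summable fun m : ℤ => c m • (fourier m : C(S1, ℂ)) :=
    Summable.of_norm (by simpa [norm_smul, fourier_norm] using hc)
  refine ⟨∑' m : ℤ, c m • fourier m, fun n => ?_⟩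
  have h := (fourierCoeffCLM n).hasSum hs.hasSum
  refine h.unique ?_
  convert hasSum_single n (f := fun m => fourierCoeffCLM n (c m • (fourier m : C(S1, ℂ)))) ?_ using 1
  · rw [map_smul, fourierCoeffCLM_apply, fourierCoeff_fourier, Pi.single_eq_same, smul_eq_mul,
      mul_one]
  · intro m hm
    rw [map_smul, fourierCoeffCLM_apply, fourierCoeff_fourier, Pi.single_eq_of_ne hm.symm,
      smul_zero]

theorem fourierCoeff_fourier_mul (m n : ℤ) (g : C(S1, ℂ)) :
    fourierCoeff (fourier m * g : C(S1, ℂ)) n = fourierCoeff g (n - m) := by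
  rw [fourierCoeff, fourierCoeff]
  congr 1
  funext x
  rw [ContinuousMap.mul_apply, smul_eq_mul, smul_eq_mul, ← mul_assoc, ← fourier_add]
  congr 3
  ring

/-- The Fourier coefficients of a product are the convolution of the Fourier coefficients. -/
theorem hasSum_fourierCoeff_mul {f : C(S1, ℂ)} (g : C(S1, ℂ)) (hf : Summable (fourierCoeff f))
    (n : ℤ) : HasSum (fun m => fourierCoeff f m * fourierCoeff g (n - m))
      (fourierCoeff (f * g : C(S1, ℂ)) n) := by
  have h := (fourierCoeffCLM n).hasSum ((hasSum_fourier_series_of_summable hf).mul_right g)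
  refine HasSum.congr_fun (f := fun b => fourierCoeffCLM n (fourierCoeff f b • fourier b * g)) h
    fun m => ?_
  rw [smul_mul_assoc, map_smul, fourierCoeffCLM_apply, fourierCoeff_fourier_mul, smul_eq_mul]

/-! ### Convolution of sequences -/

section Sequences

variable {E : Type*} [NormedAddCommGroup E]

theorem memℓp_comp_equiv {u : ℤ → E} (hu : Memℓp u 2) (e : ℤ ≃ ℤ) :
    Memℓp (fun n => u (e n)) 2 := by
  have h := (memℓp_gen_iff (p := 2) (by norm_num)).mp hu
  exact (memℓp_gen_iff (p := 2) (by norm_num)).mpr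
    (h.comp_injective (i := e) e.injective)

theorem norm_comp_equiv {u : ℤ → E} (hu : Memℓp u 2) (e : ℤ ≃ ℤ) :
    ‖(⟨fun n => u (e n), memℓp_comp_equiv hu e⟩ : lp (fun _ : ℤ => E) 2)‖ =
      ‖(⟨u, hu⟩ : lp (fun _ : ℤ => E) 2)‖ := by
  rw [lp.norm_eq_tsum_rpow (by norm_num), lp.norm_eq_tsum_rpow (by norm_num)]
  congr 1
  exact e.tsum_eq fun n => ‖u n‖ ^ (2 : ENNReal).toReal

/-- Young's inequality `ℓ¹ * ℓ² ⊆ ℓ²`. The convolution is a sum of translates, which converges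
absolutely in `ℓ²`. -/
theorem exists_convolution {u v : ℤ → ℝ} (hu : Memℓp u 2) (hv : Summable fun n => |v n|) :
    ∃ w : lp (fun _ : ℤ => ℝ) 2, (∀ n, HasSum (fun m => v m * u (n - m)) (w n)) ∧
      ‖w‖ ≤ (∑' n, |v n|) * ‖(⟨u, hu⟩ : lp (fun _ : ℤ => ℝ) 2)‖ := by
  let S : ℤ → lp (fun _ : ℤ => ℝ) 2 := fun m =>
    ⟨fun n => u (n - m), memℓp_comp_equiv hu (Equiv.subRight m)⟩
  have hS : ∀ m, ‖v m • S m‖ = |v m| * ‖(⟨u, hu⟩ : lp (fun _ : ℤ => ℝ) 2)‖ := fun m => by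
    rw [norm_smul, Real.norm_eq_abs]
    congr 1
    exact norm_comp_equiv hu (Equiv.subRight m)
  have hs : Summable fun m => ‖v m • S m‖ := by
    simp_rw [hS]
    exact hv.mul_right _
  refine ⟨∑' m, v m • S m, fun n => ?_, ?_⟩
  · exact (lp.evalCLM ℝ (fun _ : ℤ => ℝ) 2 n).hasSum hs.of_norm.hasSum
  · refine (norm_tsum_le_tsum_norm hs).trans (le_of_eq ?_)
    simp_rw [hS]
    exact tsum_mul_right

end Sequences

/-! ### `H^t` as a Banach algebra -/

theorem sobolevWeight_add_le {t : ℝ} (ht : 0 ≤ t) (m k : ℤ) :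
    sobolevWeight t (m + k) ≤ 2 ^ t * (sobolevWeight t m + sobolevWeight t k) := by
  have key : ∀ a b : ℤ, (a : ℝ) ^ 2 ≤ (b : ℝ) ^ 2 →
      sobolevWeight t (a + b) ≤ 2 ^ t * sobolevWeight t b := by
    intro a b hab
    have h4 : (2 : ℝ) ^ t = 4 ^ (t / 2) := by
      rw [show (4 : ℝ) = 2 ^ (2 : ℝ) by norm_num, ← Real.rpow_mul (by norm_num)]
      congr 1
      ring
    rw [sobolevWeight, sobolevWeight, h4, ← Real.mul_rpow (by norm_num) (by positivity)]
    refine Real.rpow_le_rpow (by positivity) ?_ (by linarith)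
    push_cast
    nlinarith [sq_nonneg ((a : ℝ) - b)]
  have h2 : (0 : ℝ) < 2 ^ t := by positivity
  have hm := HC.sobolevWeight_pos t m
  have hk := HC.sobolevWeight_pos t k
  rcases le_total ((m : ℝ) ^ 2) ((k : ℝ) ^ 2) with h | h
  · exact (key m k h).trans (mul_le_mul_of_nonneg_left (by linarith) h2.le)
  · rw [add_comm m k]
    exact (key k m h).trans (mul_le_mul_of_nonneg_left (by linarith) h2.le)

namespace HC

variable {t : ℝ}

theorem norm_weightedCoeff (f : C(S1, ℂ)) (n : ℤ) :
    ‖weightedCoeff t f n‖ = sobolevWeight t n * ‖fourierCoeff f n‖ := by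
  rw [weightedCoeff, norm_mul, Complex.norm_real, Real.norm_of_nonneg (sobolevWeight_pos t n).le]

/-- For `t > 1/2` the space `H^t` is closed under multiplication, and multiplication is bounded. -/
theorem exists_mul_bound (ht : 1 / 2 < t) : ∃ K : ℝ, 0 < K ∧ ∀ f g : HC t, ∃ h : HC t,
    toCM h = toCM f * toCM g ∧ ‖h‖ ≤ K * ‖f‖ * ‖g‖ := by
  obtain ⟨C, hC⟩ := exists_weighted_bound (t := t) (r := 0) (by linarith)
  simp only [sobolevWeight_zero, one_mul] at hC
  have hC1 : 0 ≤ C * ‖(1 : HC t)‖ := (tsum_nonneg fun n => norm_nonneg _).trans (hC 1).2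
  have hC0 : 0 ≤ C := by
    by_contra hneg
    have h1 : 0 < ‖(1 : HC t)‖ := norm_pos_iff.mpr fun h => by
      have := DFunLike.congr_fun h 0
      simp at this
    nlinarith
  refine ⟨2 ^ t * (2 * C) + 1, by positivity, fun f g => ?_⟩
  set a : ℤ → ℝ := fun n => ‖fourierCoeff (toCM f) n‖ with ha
  set b : ℤ → ℝ := fun n => ‖fourierCoeff (toCM g) n‖ with hb
  have haS : Summable fun n => |a n| := by simpa [ha] using (hC f).1
  have hbS : Summable fun n => |b n| := by simpa [hb] using (hC g).1
  have hfN : Memℓp (fun n => ‖weightedCoeff t (toCM f) n‖) 2 := memℓp_norm_iff.mpr f.2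
  have hgN : Memℓp (fun n => ‖weightedCoeff t (toCM g) n‖) 2 := memℓp_norm_iff.mpr g.2
  have hfn : ‖(⟨_, hfN⟩ : lp (fun _ : ℤ => ℝ) 2)‖ = ‖f‖ := lp.norm_toNorm (x := toEll2 f)
  have hgn : ‖(⟨_, hgN⟩ : lp (fun _ : ℤ => ℝ) 2)‖ = ‖g‖ := lp.norm_toNorm (x := toEll2 g)
  obtain ⟨X, hX, hX'⟩ := exists_convolution hfN hbS
  obtain ⟨Y, hY, hY'⟩ := exists_convolution hgN haS
  rw [hfn] at hX'
  rw [hgn] at hY'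
  have haC : ∑' n, |a n| ≤ C * ‖f‖ := by simpa [ha] using (hC f).2
  have hbC : ∑' n, |b n| ≤ C * ‖g‖ := by simpa [hb] using (hC g).2
  have hle : ∀ n, ‖weightedCoeff t (toCM f * toCM g) n‖ ≤
      ((2 : ℝ) ^ t • (X + Y) : lp (fun _ : ℤ => ℝ) 2) n := by
    intro n
    have h1 := hasSum_fourierCoeff_mul (toCM g) (hC f).1.of_norm n
    have hX2 : HasSum (fun m => a m * sobolevWeight t m * b (n - m)) (X n) := by
      have := (Equiv.subLeft n).hasSum_iff.mpr (hX n)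
      refine this.congr_fun fun m => ?_
      simp [norm_weightedCoeff, ha, hb]
      ring
    have hY2 : HasSum (fun m => a m * (sobolevWeight t (n - m) * b (n - m))) (Y n) := by
      simpa [norm_weightedCoeff, ha, hb] using hY n
    have h2 := (hX2.add hY2).mul_left ((2 : ℝ) ^ t)
    rw [norm_weightedCoeff, ← h1.tsum_eq]
    have h3 : Summable fun m => ‖fourierCoeff (toCM f) m * fourierCoeff (toCM g) (n - m)‖ := by
      have hbd : ∀ k, b k ≤ ∑' n, |b n| := fun k =>
        (le_abs_self _).trans (hbS.le_tsum k fun _ _ => abs_nonneg _)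
      refine Summable.of_nonneg_of_le (fun _ => norm_nonneg _) (fun m => ?_)
        ((hC f).1.mul_right (∑' n, |b n|))
      rw [norm_mul]
      exact mul_le_mul_of_nonneg_left (hbd _) (norm_nonneg _)
    calc sobolevWeight t n * ‖∑' m, fourierCoeff (toCM f) m * fourierCoeff (toCM g) (n - m)‖
        ≤ sobolevWeight t n * ∑' m, ‖fourierCoeff (toCM f) m * fourierCoeff (toCM g) (n - m)‖ :=
          mul_le_mul_of_nonneg_left (norm_tsum_le_tsum_norm h3) (sobolevWeight_pos t n).le
      _ = ∑' m, sobolevWeight t n * ‖fourierCoeff (toCM f) m * fourierCoeff (toCM g) (n - m)‖ :=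
          tsum_mul_left.symm
      _ ≤ ∑' m, 2 ^ t * (a m * sobolevWeight t m * b (n - m) +
            a m * (sobolevWeight t (n - m) * b (n - m))) := by
          refine (h3.mul_left _).tsum_le_tsum (fun m => ?_) h2.summable
          have hw := sobolevWeight_add_le (t := t) (by linarith) m (n - m)
          rw [add_sub_cancel] at hw
          rw [norm_mul]
          have hab : 0 ≤ a m * b (n - m) := by positivity
          calc sobolevWeight t n * (a m * b (n - m))
              ≤ (2 ^ t * (sobolevWeight t m + sobolevWeight t (n - m))) * (a m * b (n - m)) :=
                mul_le_mul_of_nonneg_right hw hab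
            _ = _ := by ring
      _ = _ := by
          rw [h2.tsum_eq]
          rfl
  have hmem : Memℓp (weightedCoeff t (toCM f * toCM g)) 2 :=
    (lp.memℓp ((2 : ℝ) ^ t • (X + Y) : lp (fun _ : ℤ => ℝ) 2)).mono hle
  refine ⟨⟨toCM f * toCM g, hmem⟩, rfl, ?_⟩
  have h1 : ‖(⟨_, hmem⟩ : lp (fun _ : ℤ => ℂ) 2)‖ ≤ ‖((2 : ℝ) ^ t • (X + Y) : lp (fun _ : ℤ => ℝ) 2)‖ :=
    lp.norm_mono (by norm_num) fun n => (hle n).trans (le_abs_self _)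
  have h2 := norm_add_le X Y
  rw [norm_smul, Real.norm_of_nonneg (by positivity)] at h1
  have h2t : (0 : ℝ) < 2 ^ t := by positivity
  have hf0 := norm_nonneg f
  have hg0 := norm_nonneg g
  calc _ ≤ 2 ^ t * ‖X + Y‖ := h1
    _ ≤ 2 ^ t * (C * ‖g‖ * ‖f‖ + C * ‖f‖ * ‖g‖) := by
        refine mul_le_mul_of_nonneg_left (h2.trans (add_le_add (hX'.trans ?_) (hY'.trans ?_))) h2t.le
        · exact mul_le_mul_of_nonneg_right hbC hf0
        · exact mul_le_mul_of_nonneg_right haC hg0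
    _ ≤ _ := by nlinarith [mul_nonneg hf0 hg0]

end HC

/-! ### The exponential map of a commutative Banach algebra -/

section BanachAlgebra

variable {A : Type*} [NormedCommRing A] [NormedAlgebra ℂ A] [CompleteSpace A]

theorem exp_add_banach (x y : A) :
    NormedSpace.exp (x + y) = NormedSpace.exp x * NormedSpace.exp y :=
  letI := NormedAlgebra.restrictScalars ℚ ℂ A
  NormedSpace.exp_add

theorem exp_mul_exp_neg (x : A) : NormedSpace.exp x * NormedSpace.exp (-x) = 1 := by
  rw [← exp_add_banach, add_neg_cancel, NormedSpace.exp_zero]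

/-- The exponential as a homomorphism into the group of units. -/
def expUnits (A : Type*) [NormedCommRing A] [NormedAlgebra ℂ A] [CompleteSpace A] :
    Multiplicative A →* Aˣ where
  toFun x := ⟨NormedSpace.exp x.toAdd, NormedSpace.exp (-x.toAdd), exp_mul_exp_neg _, by
    rw [mul_comm, exp_mul_exp_neg]⟩
  map_one' := Units.ext NormedSpace.exp_zero
  map_mul' x y := Units.ext (exp_add_banach x.toAdd y.toAdd)

theorem mem_range_expUnits {u : Aˣ} :
    u ∈ (expUnits A).range ↔ ∃ q : A, NormedSpace.exp q = (u : A) := by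
  constructor
  · rintro ⟨x, rfl⟩
    exact ⟨x.toAdd, rfl⟩
  · rintro ⟨q, hq⟩
    exact ⟨Multiplicative.ofAdd q, Units.ext hq⟩

theorem range_expUnits_mem_nhds : ((expUnits A).range : Set Aˣ) ∈ 𝓝 1 := by
  have h0 : HasStrictFDerivAt (NormedSpace.exp : A → A)
      ((ContinuousLinearEquiv.refl ℂ A : A ≃L[ℂ] A) : A →L[ℂ] A) 0 :=
    hasStrictFDerivAt_exp_zero (𝕂 := ℂ)
  have h1 := h0.map_nhds_eq_of_equiv
  rw [NormedSpace.exp_zero] at h1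
  have h2 : Set.range (NormedSpace.exp : A → A) ∈ 𝓝 (1 : A) := by
    rw [← h1]
    exact Filter.range_mem_map
  filter_upwards [Units.continuous_val.continuousAt (x := (1 : Aˣ)) h2] with u hu
  exact mem_range_expUnits.mpr hu

theorem isOpen_range_expUnits : IsOpen ((expUnits A).range : Set Aˣ) :=
  Subgroup.isOpen_of_mem_nhds _ range_expUnits_mem_nhds

/-- If the segment from `1` to `f` consists of units, then `f` has a logarithm: the exponentials
form a subgroup of the units that is open, hence closed. -/
theorem exists_exp_eq_of_segment {f : A}
    (h : ∀ r : ℝ, 0 ≤ r → r ≤ 1 → IsUnit (1 + (r : ℂ) • (f - 1))) :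
    ∃ q : A, NormedSpace.exp q = f := by
  let γ : unitInterval → Aˣ := fun r => (h r r.2.1 r.2.2).unit
  have hγ : Continuous γ := by
    refine Units.isOpenEmbedding_val.isInducing.continuous_iff.mpr ?_
    change Continuous fun r : unitInterval => 1 + ((r : ℝ) : ℂ) • (f - 1)
    fun_prop
  have hcl : IsClopen (γ ⁻¹' ((expUnits A).range : Set Aˣ)) :=
    ⟨(Subgroup.isClosed_of_isOpen _ isOpen_range_expUnits).preimage hγ,
      isOpen_range_expUnits.preimage hγ⟩
  have h0 : (0 : unitInterval) ∈ γ ⁻¹' ((expUnits A).range : Set Aˣ) := by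
    refine mem_range_expUnits.mpr ⟨0, ?_⟩
    rw [NormedSpace.exp_zero]
    simp [γ]
  have h1 : (1 : unitInterval) ∈ γ ⁻¹' ((expUnits A).range : Set Aˣ) := by
    rw [hcl.eq_univ ⟨0, h0⟩]
    trivial
  obtain ⟨q, hq⟩ := mem_range_expUnits.mp h1
  exact ⟨q, hq.trans (by simp [γ])⟩

theorem contDiff_exp_banach {n : WithTop ℕ∞} : ContDiff ℝ n (NormedSpace.exp : A → A) := by
  have h : AnalyticOnNhd ℂ (NormedSpace.exp : A → A) Set.univ := fun x _ =>
    NormedSpace.exp_analytic x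
  exact (contDiffOn_univ.mp (h.contDiffOn uniqueDiffOn_univ)).restrict_scalars ℝ

theorem hasFDerivAt_exp_banach (q : A) : HasFDerivAt (NormedSpace.exp : A → A)
    (NormedSpace.exp q • (1 : A →L[ℝ] A)) q := hasFDerivAt_exp (𝕂 := ℝ)

/-- Near `exp q` there is a smooth logarithm with value `q` at `exp q`. -/
theorem exists_local_log (q : A) : ∃ l : A → A, ContDiffAt ℝ ∞ l (NormedSpace.exp q) ∧
    ∀ᶠ f in 𝓝 (NormedSpace.exp q), NormedSpace.exp (l f) = f := by
  let e : A ≃L[ℝ] A := ContinuousLinearEquiv.equivOfInverse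
    (NormedSpace.exp q • (1 : A →L[ℝ] A)) (NormedSpace.exp (-q) • (1 : A →L[ℝ] A))
    (fun x => by
      change NormedSpace.exp (-q) * (NormedSpace.exp q * x) = x
      rw [← mul_assoc, mul_comm (NormedSpace.exp (-q)), exp_mul_exp_neg, one_mul])
    (fun x => by
      change NormedSpace.exp q * (NormedSpace.exp (-q) * x) = x
      rw [← mul_assoc, exp_mul_exp_neg, one_mul])
  have h1 : ContDiffAt ℝ ∞ (NormedSpace.exp : A → A) q := contDiff_exp_banach.contDiffAt
  have h2 : HasFDerivAt (NormedSpace.exp : A → A) (e : A →L[ℝ] A) q := hasFDerivAt_exp_banach q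
  have hn : (∞ : WithTop ℕ∞) ≠ 0 := by simp
  exact ⟨h1.localInverse h2 hn, h1.to_localInverse h2 hn,
    (h1.hasStrictFDerivAt' h2 hn).eventually_right_inverse⟩

end BanachAlgebra

/-! ### The Banach algebra of functions of class `H^t` -/

/-- For `t > 1/2` the functions of class `H^t` form an algebra. -/
def sobolevSubalgebra (t : ℝ) [ht : Fact (1 / 2 < t)] : Subalgebra ℂ C(S1, ℂ) :=
  (sobolevSubmodule t).toSubalgebra (HC.one_mem t) fun f g hf hg => by
    obtain ⟨K, -, hK⟩ := HC.exists_mul_bound ht.out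
    obtain ⟨h, hh, -⟩ := hK ⟨f, hf⟩ ⟨g, hg⟩
    have := h.2
    change f * g ∈ sobolevSubmodule t
    rw [← show h.1 = f * g from hh]
    exact this

/-- The algebra `H^t(S¹; ℂ)`. Its norm is a multiple of the norm of `HC t`, chosen so that it is
submultiplicative. -/
def SobolevAlg (t : ℝ) [Fact (1 / 2 < t)] : Type := ↥(sobolevSubalgebra t)

namespace SobolevAlg

variable {t : ℝ} [ht : Fact (1 / 2 < t)]

instance : CommRing (SobolevAlg t) := inferInstanceAs (CommRing ↥(sobolevSubalgebra t))

instance : Algebra ℂ (SobolevAlg t) := inferInstanceAs (Algebra ℂ ↥(sobolevSubalgebra t))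

/-- The identity map from the algebra `H^t` to the Hilbert space `H^t`. -/
def linToHC : SobolevAlg t ≃ₗ[ℂ] HC t where
  toFun f := ⟨f.1, f.2⟩
  invFun f := ⟨f.1, f.2⟩
  map_add' _ _ := rfl
  map_smul' _ _ := rfl
  left_inv _ := rfl
  right_inv _ := rfl

/-- A constant `K` with `‖f g‖ ≤ K ‖f‖ ‖g‖` in `H^t`. -/
def mulBound (t : ℝ) [ht : Fact (1 / 2 < t)] : ℝ := (HC.exists_mul_bound ht.out).choose

theorem mulBound_pos : 0 < mulBound t := (HC.exists_mul_bound ht.out).choose_spec.1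

theorem norm_mul_le_mulBound (f g : SobolevAlg t) :
    ‖linToHC (f * g)‖ ≤ mulBound t * ‖linToHC f‖ * ‖linToHC g‖ := by
  obtain ⟨h, hh, hn⟩ := (HC.exists_mul_bound ht.out).choose_spec.2 (linToHC f) (linToHC g)
  have : linToHC (f * g) = h := HC.toCM_injective hh.symm
  rw [this]
  exact hn

/-- The multiple of the identity map that induces the norm. -/
def scaledToHC : SobolevAlg t →ₗ[ℂ] HC t :=
  ((mulBound t : ℝ) : ℂ) • (linToHC (t := t)).toLinearMap

theorem scaledToHC_apply (f : SobolevAlg t) :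
    scaledToHC f = ((mulBound t : ℝ) : ℂ) • linToHC f := rfl

theorem scaledToHC_injective : Injective (scaledToHC : SobolevAlg t →ₗ[ℂ] HC t) := by
  intro f g h
  have h0 : ((mulBound t : ℝ) : ℂ) ≠ 0 := Complex.ofReal_ne_zero.mpr mulBound_pos.ne'
  rw [scaledToHC_apply, scaledToHC_apply] at h
  exact linToHC.injective (smul_right_injective (HC t) h0 h)

theorem norm_scaledToHC (f : SobolevAlg t) : ‖scaledToHC f‖ = mulBound t * ‖linToHC f‖ := by
  rw [scaledToHC_apply, norm_smul, Complex.norm_real, Real.norm_of_nonneg mulBound_pos.le]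

instance : NormedCommRing (SobolevAlg t) :=
  { NormedAddCommGroup.induced _ _ scaledToHC scaledToHC_injective,
    (inferInstance : CommRing (SobolevAlg t)) with
    norm_mul_le := fun f g => by
      change ‖scaledToHC (f * g)‖ ≤ ‖scaledToHC f‖ * ‖scaledToHC g‖
      have hK := mulBound_pos (t := t)
      rw [norm_scaledToHC, norm_scaledToHC, norm_scaledToHC]
      calc mulBound t * ‖linToHC (f * g)‖
          ≤ mulBound t * (mulBound t * ‖linToHC f‖ * ‖linToHC g‖) :=
            mul_le_mul_of_nonneg_left (norm_mul_le_mulBound f g) hK.le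
        _ = _ := by ring }

theorem norm_eq (f : SobolevAlg t) : ‖f‖ = mulBound t * ‖linToHC f‖ := norm_scaledToHC f

instance : NormedAlgebra ℂ (SobolevAlg t) where
  norm_smul_le c f := by
    rw [norm_eq, norm_eq, map_smul, norm_smul]
    exact le_of_eq (by ring)

/-- The identity map from the algebra `H^t` to the Hilbert space `H^t` is a topological
isomorphism. -/
def toHC : SobolevAlg t ≃L[ℂ] HC t :=
  ContinuousLinearEquiv.mk linToHC
    (LinearMap.mkContinuous (linToHC (t := t)).toLinearMap (mulBound t)⁻¹ fun f => by
      rw [norm_eq, inv_mul_cancel_left₀ mulBound_pos.ne']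
      rfl).continuous
    (LinearMap.mkContinuous (linToHC (t := t)).symm.toLinearMap (mulBound t) fun f => by
      rw [norm_eq]
      exact le_of_eq (congrArg _ (congrArg _ (linToHC.apply_symm_apply f)))).continuous

instance : FunLike (SobolevAlg t) S1 ℂ where
  coe f := f.1
  coe_injective _ _ h := Subtype.ext (DFunLike.coe_injective h)

@[simp] theorem toHC_apply (f : SobolevAlg t) (x : S1) : toHC f x = f x := rfl

@[simp] theorem mul_apply (f g : SobolevAlg t) (x : S1) : (f * g) x = f x * g x := rfl
@[simp] theorem add_apply (f g : SobolevAlg t) (x : S1) : (f + g) x = f x + g x := rfl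
@[simp] theorem sub_apply (f g : SobolevAlg t) (x : S1) : (f - g) x = f x - g x := rfl
@[simp] theorem one_apply (x : S1) : (1 : SobolevAlg t) x = 1 := rfl
@[simp] theorem smul_apply (c : ℂ) (f : SobolevAlg t) (x : S1) : (c • f) x = c * f x := rfl
@[simp] theorem real_smul_apply (c : ℝ) (f : SobolevAlg t) (x : S1) : (c • f) x = c * f x := by
  rw [← Complex.coe_smul, smul_apply]

/-- Evaluation at `x` as a character. -/
def eval (x : S1) : SobolevAlg t →ₐ[ℂ] ℂ where
  toFun f := f x
  map_one' := rfl
  map_mul' _ _ := rfl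
  map_zero' := rfl
  map_add' _ _ := rfl
  commutes' c := by
    rw [Algebra.algebraMap_eq_smul_one, smul_apply, one_apply, mul_one]
    rfl

theorem eval_apply (x : S1) (f : SobolevAlg t) : eval x f = f x := rfl

theorem continuous_eval (x : S1) : Continuous (eval x : SobolevAlg t → ℂ) := by
  obtain ⟨C, hC⟩ := HC.exists_sup_bound ht.out
  have h : Continuous fun f : HC t => f x :=
    (LinearMap.mkContinuous ({ toFun := fun f => f x, map_add' := fun _ _ => rfl,
                               map_smul' := fun _ _ => rfl } : HC t →ₗ[ℂ] ℂ) C fun f => hC f x).continuous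
  exact h.comp toHC.continuous

end SobolevAlg

namespace HC

variable {t : ℝ}

theorem surjective_toEll2 (ht : 1 / 2 < t) :
    Surjective (toEll2 : HC t →ₗ[ℂ] lp (fun _ : ℤ => ℂ) 2) := by
  intro c
  have h2 : Summable fun n : ℤ => ‖c n‖ ^ (2 : ℝ) := by
    simpa using (memℓp_gen_iff (p := 2) (by norm_num)).mp c.2
  have hs := Real.summable_mul_of_Lp_Lq_of_nonneg Real.HolderConjugate.two_two
    (f := fun n : ℤ => sobolevWeight (-t) n) (g := fun n : ℤ => ‖c n‖)
    (fun n => (sobolevWeight_pos _ n).le) (fun n => norm_nonneg _) (summable_weight ht) h2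
  obtain ⟨f, hf⟩ := exists_fourierCoeff_eq (c := fun n => ((sobolevWeight (-t) n : ℝ) : ℂ) * c n)
    (by simpa [abs_of_pos (sobolevWeight_pos (-t) _)] using hs)
  have hw : weightedCoeff t f = c := by
    funext n
    rw [weightedCoeff, hf, ← mul_assoc, ← Complex.ofReal_mul, sobolevWeight, sobolevWeight,
      ← Real.rpow_add (by positivity), show t / 2 + -t / 2 = 0 by ring, Real.rpow_zero,
      Complex.ofReal_one, one_mul]
  have hm : Memℓp (weightedCoeff t f) 2 := by
    rw [hw]
    exact c.2
  exact ⟨⟨f, hm⟩, Subtype.ext hw⟩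

/-- For `t > 1/2` the weighted Fourier coefficients identify `H^t` with `ℓ²`. -/
def ell2Equiv (ht : 1 / 2 < t) : HC t ≃ₗᵢ[ℂ] lp (fun _ : ℤ => ℂ) 2 where
  toLinearEquiv := LinearEquiv.ofBijective toEll2 ⟨toEll2_injective, surjective_toEll2 ht⟩
  norm_map' _ := rfl

theorem ell2Equiv_apply (ht : 1 / 2 < t) (f : HC t) (n : ℤ) :
    ell2Equiv ht f n = ((sobolevWeight t n : ℝ) : ℂ) * fourierCoeff (toCM f) n := rfl

instance [ht : Fact (1 / 2 < t)] : CompleteSpace (HC t) :=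
  (ell2Equiv ht.out).toIsometryEquiv.completeSpace

end HC

instance {t : ℝ} [ht : Fact (1 / 2 < t)] : CompleteSpace (SobolevAlg t) :=
  (completeSpace_congr (e := (SobolevAlg.toHC (t := t)).toEquiv)
    (SobolevAlg.toHC (t := t)).isUniformEmbedding).mpr inferInstance

/-! ### Trigonometric monomials -/

namespace HC

variable {t : ℝ}

theorem weightedCoeff_fourier (t : ℝ) (n : ℤ) : weightedCoeff t (fourier n) =
    (lp.single 2 n ((sobolevWeight t n : ℝ) : ℂ) : lp (fun _ : ℤ => ℂ) 2) := by
  funext m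
  rw [weightedCoeff, fourierCoeff_fourier, lp.coeFn_single]
  by_cases h : m = n
  · subst h
    simp
  · rw [Pi.single_eq_of_ne h, Pi.single_eq_of_ne h, mul_zero]

/-- The function `e^{2πinx}` as an element of `H^t`. -/
def monomial (t : ℝ) (n : ℤ) : HC t :=
  ⟨fourier n, by
    change Memℓp (weightedCoeff t (fourier n)) 2
    rw [weightedCoeff_fourier]
    exact lp.memℓp _⟩

theorem monomial_apply (n : ℤ) (x : S1) : monomial t n x = fourier n x := rfl

theorem toEll2_monomial (n : ℤ) :
    toEll2 (monomial t n) = lp.single 2 n ((sobolevWeight t n : ℝ) : ℂ) :=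
  Subtype.ext (weightedCoeff_fourier t n)

theorem norm_monomial (n : ℤ) : ‖monomial t n‖ = sobolevWeight t n := by
  rw [norm_def, toEll2_monomial, lp.norm_single (by norm_num), Complex.norm_real,
    Real.norm_of_nonneg (sobolevWeight_pos t n).le]

/-- The Fourier series of `f` converges to `f` in `H^t`. -/
theorem hasSum_monomial (ht : 1 / 2 < t) (f : HC t) :
    HasSum (fun n => fourierCoeff (toCM f) n • monomial t n) f := by
  have h := (ell2Equiv ht).symm.toContinuousLinearEquiv.toContinuousLinearMap.hasSum
    (lp.hasSum_single (by norm_num) (ell2Equiv ht f))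
  have e : ∀ n, (ell2Equiv ht).symm (lp.single 2 n (ell2Equiv ht f n)) =
      fourierCoeff (toCM f) n • monomial t n := by
    intro n
    rw [LinearIsometryEquiv.symm_apply_eq, map_smul]
    change _ = _ • toEll2 (monomial t n)
    rw [toEll2_monomial, ← lp.single_smul, ell2Equiv_apply, smul_eq_mul, mul_comm]
  have h' : HasSum (fun n => (ell2Equiv ht).symm (lp.single 2 n (ell2Equiv ht f n)))
      ((ell2Equiv ht).symm (ell2Equiv ht f)) := h
  simpa only [e, LinearIsometryEquiv.symm_apply_apply] using h'

end HC

/-- A sequence of powers with at most the growth of a Sobolev weight is bounded. -/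
theorem le_one_of_pow_le_sobolevWeight {t b C : ℝ} (hC : 0 < C)
    (h : ∀ n : ℕ, b ^ n ≤ C * sobolevWeight t n) : b ≤ 1 := by
  by_contra hb
  push Not at hb
  obtain ⟨k, hk⟩ := exists_nat_ge (t / 2)
  have h1 : ∀ n : ℕ, sobolevWeight t n ≤ ((n + 1 : ℕ) : ℝ) ^ (2 * k) := by
    intro n
    have h1n : (1 : ℝ) ≤ 1 + (n : ℝ) ^ 2 := by nlinarith [sq_nonneg (n : ℝ)]
    calc sobolevWeight t n ≤ (1 + (n : ℝ) ^ 2) ^ (k : ℝ) := by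
          rw [sobolevWeight, Int.cast_natCast]
          exact Real.rpow_le_rpow_of_exponent_le h1n hk
      _ = (1 + (n : ℝ) ^ 2) ^ k := Real.rpow_natCast _ _
      _ ≤ (((n + 1 : ℕ) : ℝ) ^ 2) ^ k := by
          refine pow_le_pow_left₀ (by positivity) ?_ k
          push_cast
          nlinarith [Nat.cast_nonneg (α := ℝ) n]
      _ = _ := (pow_mul _ _ _).symm
  have h2 := (tendsto_pow_const_div_const_pow_of_one_lt (2 * k) hb).comp
    (Filter.tendsto_add_atTop_nat 1)
  have hb0 : 0 < b := by linarith
  have h3 : (C * b)⁻¹ ≤ 0 := ge_of_tendsto' h2 fun n => by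
    have hn := (h n).trans (mul_le_mul_of_nonneg_left (h1 n) hC.le)
    simp only [comp_apply]
    rw [inv_eq_one_div, div_le_div_iff₀ (by positivity) (by positivity), pow_succ]
    nlinarith
  have h4 : 0 < (C * b)⁻¹ := by positivity
  linarith

namespace SobolevAlg

variable {t : ℝ} [ht : Fact (1 / 2 < t)]

/-- The function `e^{2πinx}` as an element of the algebra `H^t`. -/
def monomial (n : ℤ) : SobolevAlg t := toHC.symm (HC.monomial t n)

@[simp] theorem monomial_apply (n : ℤ) (x : S1) :
    (monomial n : SobolevAlg t) x = fourier n x := rfl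

theorem norm_monomial (n : ℤ) : ‖(monomial n : SobolevAlg t)‖ = mulBound t * sobolevWeight t n := by
  rw [norm_eq, ← HC.norm_monomial]
  rfl

theorem monomial_add (m n : ℤ) : (monomial (m + n) : SobolevAlg t) = monomial m * monomial n :=
  DFunLike.ext _ _ fun _ => by simp

theorem monomial_zero : (monomial 0 : SobolevAlg t) = 1 :=
  DFunLike.ext _ _ fun _ => by simp

/-- The trigonometric monomials as a homomorphism. -/
def monomialHom : Multiplicative ℤ →* SobolevAlg t where
  toFun n := monomial n.toAdd
  map_one' := monomial_zero
  map_mul' m n := monomial_add m.toAdd n.toAdd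

theorem hasSum_monomial (f : SobolevAlg t) :
    HasSum (fun n => fourierCoeff f n • (monomial n : SobolevAlg t)) f := by
  have h := (toHC (t := t)).symm.toContinuousLinearMap.hasSum
    (HC.hasSum_monomial ht.out (toHC f))
  convert h using 2 with n
  · exact (map_smul (toHC (t := t)).symm _ _).symm
  · exact (toHC.symm_apply_apply f).symm

/-! ### Wiener's lemma -/

/-- The characters of the algebra `H^t` are the evaluations: a character has modulus at most one at
`e^{2πix}` and at its inverse, since the norms of their powers grow only polynomially, and it is
determined by its values at the trigonometric monomials. -/
theorem exists_eval_eq (χ : SobolevAlg t →ₐ[ℂ] ℂ) : ∃ x : S1, ∀ f, χ f = f x := by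
  have hbound : ∀ f : SobolevAlg t, ‖χ f‖ ≤ ‖f‖ * ‖(1 : SobolevAlg t)‖ :=
    AlgHom.norm_apply_le_self_mul_norm_one χ
  have h1 : 0 < ‖(1 : SobolevAlg t)‖ := norm_pos_iff.mpr fun h => by
    have := DFunLike.congr_fun h 0
    rw [one_apply] at this
    exact one_ne_zero this
  have hK := mulBound_pos (t := t)
  have hpow : ∀ (j : ℤ) (n : ℕ), (monomial j : SobolevAlg t) ^ n = monomial (n * j) := fun j n => by
    have := (map_pow (monomialHom (t := t)) (Multiplicative.ofAdd j) n).symm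
    rw [← ofAdd_nsmul, nsmul_eq_mul] at this
    exact this
  have hle : ∀ j : ℤ, j ^ 2 = 1 → ‖χ (monomial j)‖ ≤ 1 := fun j hj => by
    refine le_one_of_pow_le_sobolevWeight (t := t) (C := mulBound t * ‖(1 : SobolevAlg t)‖)
      (by positivity) fun n => ?_
    rw [← norm_pow, ← map_pow, hpow]
    refine (hbound _).trans (le_of_eq ?_)
    have hw : sobolevWeight t (n * j) = sobolevWeight t n := by
      have hj' : (j : ℝ) ^ 2 = 1 := by exact_mod_cast hj
      rw [sobolevWeight, sobolevWeight, Int.cast_mul, mul_pow, hj', mul_one]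
    rw [norm_monomial, hw]
    ring
  have hmul : χ (monomial 1) * χ (monomial (-1)) = 1 := by
    rw [← map_mul, ← monomial_add, add_neg_cancel, monomial_zero, map_one]
  have hnorm : ‖χ (monomial 1)‖ = 1 := by
    have e := congrArg norm hmul
    rw [norm_mul, norm_one] at e
    have a := hle 1 (by norm_num)
    have b := hle (-1) (by norm_num)
    nlinarith [norm_nonneg (χ (monomial 1)), norm_nonneg (χ (monomial (-1)))]
  obtain ⟨x, hx⟩ := (homeomorphCircle (one_ne_zero (α := ℝ))).surjective
    ⟨χ (monomial 1), mem_sphere_zero_iff_norm.mpr hnorm⟩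
  have hx' : fourier 1 x = χ (monomial 1) := by
    rw [fourier_one, ← homeomorphCircle_apply (one_ne_zero (α := ℝ)), hx]
  have hhom : (χ : SobolevAlg t →* ℂ).comp monomialHom =
      ((eval x : SobolevAlg t →ₐ[ℂ] ℂ) : SobolevAlg t →* ℂ).comp monomialHom :=
    MonoidHom.ext_mint hx'.symm
  have hmon : ∀ n : ℤ, χ (monomial n) = fourier n x := fun n =>
    DFunLike.congr_fun hhom (Multiplicative.ofAdd n)
  have hχc : Continuous χ :=
    (LinearMap.mkContinuous χ.toLinearMap ‖(1 : SobolevAlg t)‖ fun f => by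
      rw [mul_comm]
      exact hbound f).continuous
  refine ⟨x, fun f => ?_⟩
  have s1 := (hasSum_monomial f).map χ hχc
  have s2 := (hasSum_monomial f).map (eval x) (continuous_eval x)
  have e : (χ ∘ fun n => fourierCoeff f n • (monomial n : SobolevAlg t)) =
      eval x ∘ fun n => fourierCoeff f n • (monomial n : SobolevAlg t) := by
    funext n
    simp only [comp_apply, map_smul, hmon, eval_apply, monomial_apply]
  rw [e] at s1
  exact s1.unique s2

/-- Wiener's lemma for `H^t`: a nowhere vanishing function is invertible. -/
theorem isUnit_of_forall_ne_zero {f : SobolevAlg t} (hf : ∀ x, f x ≠ 0) : IsUnit f := by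
  by_contra h
  obtain ⟨χ, hχ⟩ := WeakDual.CharacterSpace.exists_apply_eq_zero h
  obtain ⟨x, hx⟩ := exists_eval_eq (WeakDual.CharacterSpace.toAlgHom χ)
  exact hf x ((hx f).symm.trans hχ)

theorem ne_zero_of_isUnit {f : SobolevAlg t} (hf : IsUnit f) (x : S1) : f x ≠ 0 :=
  (hf.map (eval x)).ne_zero

@[simp] theorem exp_apply (f : SobolevAlg t) (x : S1) :
    (NormedSpace.exp f : SobolevAlg t) x = Complex.exp (f x) := by
  let _ := NormedAlgebra.restrictScalars ℚ ℂ (SobolevAlg t)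
  have := NormedSpace.map_exp (eval x : SobolevAlg t →ₐ[ℂ] ℂ) (continuous_eval x) f
  rw [eval_apply, eval_apply, ← Complex.exp_eq_exp_ℂ] at this
  exact this

/-- A function with values in the right half plane has a logarithm. -/
theorem exists_exp_eq_of_re_pos {f : SobolevAlg t} (hf : ∀ x, 0 < (f x).re) :
    ∃ q : SobolevAlg t, NormedSpace.exp q = f := by
  refine exists_exp_eq_of_segment fun r hr0 hr1 => isUnit_of_forall_ne_zero fun x h => ?_
  have h' := congrArg Complex.re h
  simp only [add_apply, one_apply, smul_apply, sub_apply, Complex.add_re, Complex.one_re,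
    Complex.re_ofReal_mul, Complex.sub_re, Complex.zero_re] at h'
  rcases hr1.lt_or_eq with h1 | h1
  · nlinarith [hf x]
  · subst h1
    linarith [hf x]

/-! ### Logarithms of nowhere vanishing functions -/

/-- The function `e^{2πix}` as a unit. -/
def monomialUnit : (SobolevAlg t)ˣ :=
  ⟨monomial 1, monomial (-1), by rw [← monomial_add, add_neg_cancel, monomial_zero],
    by rw [← monomial_add, neg_add_cancel, monomial_zero]⟩

theorem coe_monomialUnit_zpow (k : ℤ) :
    ((monomialUnit ^ k : (SobolevAlg t)ˣ) : SobolevAlg t) = monomial k := by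
  have h : (Units.coeHom (SobolevAlg t)).comp (zpowersHom _ monomialUnit) = monomialHom :=
    MonoidHom.ext_mint (by
      change ((monomialUnit ^ (1 : ℤ) : (SobolevAlg t)ˣ) : SobolevAlg t) = monomial 1
      rw [zpow_one]
      rfl)
  exact DFunLike.congr_fun h (Multiplicative.ofAdd k)

/-- The units of the form `e^{2πikx} exp q`. -/
def logUnits (t : ℝ) [Fact (1 / 2 < t)] : Subgroup (SobolevAlg t)ˣ :=
  (expUnits (SobolevAlg t)).range ⊔ Subgroup.zpowers monomialUnit

theorem isOpen_logUnits : IsOpen (logUnits t : Set (SobolevAlg t)ˣ) :=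
  Subgroup.isOpen_mono le_sup_left isOpen_range_expUnits

theorem exists_of_mem_logUnits {u : (SobolevAlg t)ˣ} (hu : u ∈ logUnits t) :
    ∃ (k : ℤ) (q : SobolevAlg t), (u : SobolevAlg t) = monomial k * NormedSpace.exp q := by
  obtain ⟨v, hv, w, ⟨k, rfl⟩, rfl⟩ := Subgroup.mem_sup.mp hu
  obtain ⟨q, hq⟩ := mem_range_expUnits.mp hv
  refine ⟨k, q, ?_⟩
  rw [Units.val_mul, ← hq, mul_comm, ← coe_monomialUnit_zpow]

/-- The linear factor `e^{2πix} - a` has a logarithm up to a monomial: one of the functions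
`1 - a e^{-2πix}` and `1 - a⁻¹ e^{2πix}` has values in the right half plane. -/
theorem linear_factor_mem {a : ℂ} {u : (SobolevAlg t)ˣ}
    (hu : (u : SobolevAlg t) = monomial 1 - algebraMap ℂ _ a) : u ∈ logUnits t := by
  have hmod : ∀ (n : ℤ) (x : S1), ‖(fourier n x : ℂ)‖ = 1 := fun n x => by
    rw [fourier_apply, Circle.norm_coe]
  have hre : ∀ (c : ℂ) (n : ℤ), ‖c‖ < 1 → ∃ q : SobolevAlg t,
      NormedSpace.exp q = 1 - c • monomial n := fun c n hc =>
    exists_exp_eq_of_re_pos fun x => by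
      have h1 : (c * fourier n x).re ≤ ‖c‖ := by
        refine (Complex.re_le_norm _).trans (le_of_eq ?_)
        rw [norm_mul, hmod, mul_one]
      simp only [sub_apply, one_apply, smul_apply, monomial_apply, Complex.sub_re, Complex.one_re]
      linarith
  have halg : ∀ (c : ℂ) (x : S1), (algebraMap ℂ (SobolevAlg t) c) x = c := fun c x => by
    rw [Algebra.algebraMap_eq_smul_one, smul_apply, one_apply, mul_one]
  rcases lt_trichotomy ‖a‖ 1 with h | h | h
  · obtain ⟨q, hq⟩ := hre a (-1) h
    have hf : u = (expUnits (SobolevAlg t)) (Multiplicative.ofAdd q) * monomialUnit := by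
      refine Units.ext ?_
      rw [Units.val_mul, hu]
      change _ = NormedSpace.exp q * monomial 1
      rw [hq, sub_mul, one_mul, smul_mul_assoc, ← monomial_add, neg_add_cancel, monomial_zero,
        Algebra.algebraMap_eq_smul_one]
    rw [hf]
    exact Subgroup.mul_mem_sup ⟨_, rfl⟩ (Subgroup.mem_zpowers _)
  · obtain ⟨x, hx⟩ := (homeomorphCircle (one_ne_zero (α := ℝ))).surjective
      ⟨a, mem_sphere_zero_iff_norm.mpr h⟩
    have hx' : fourier 1 x = a := by
      rw [fourier_one, ← homeomorphCircle_apply (one_ne_zero (α := ℝ)), hx]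
    exact absurd (by rw [hu, sub_apply, halg, monomial_apply, hx', sub_self])
      (ne_zero_of_isUnit u.isUnit x)
  · have ha : a ≠ 0 := fun h0 => by
      rw [h0, norm_zero] at h
      linarith
    obtain ⟨q, hq⟩ := hre a⁻¹ 1 (by rw [norm_inv]; exact inv_lt_one_of_one_lt₀ h)
    refine Subgroup.mem_sup_left (mem_range_expUnits.mpr
      ⟨q + algebraMap ℂ _ (Complex.log (-a)), ?_⟩)
    rw [exp_add_banach, hq, hu]
    refine DFunLike.ext _ _ fun x => ?_
    rw [mul_apply, exp_apply, halg, Complex.exp_log (neg_ne_zero.mpr ha)]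
    simp only [sub_apply, one_apply, smul_apply, monomial_apply, halg]
    field_simp
    ring

theorem polynomial_mem {p : Polynomial ℂ} {u : (SobolevAlg t)ˣ}
    (hu : (u : SobolevAlg t) = Polynomial.aeval (monomial 1) p) : u ∈ logUnits t := by
  have hmul : ∀ s : Multiset ℂ, ∀ v : (SobolevAlg t)ˣ, (v : SobolevAlg t) =
      (s.map fun a => (monomial 1 : SobolevAlg t) - algebraMap ℂ _ a).prod → v ∈ logUnits t := by
    intro s
    induction s using Multiset.induction_on with
    | empty =>
      intro v hv
      rw [Multiset.map_zero, Multiset.prod_zero] at hv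
      rw [show v = 1 from Units.ext hv]
      exact one_mem _
    | cons a s ih =>
      intro v hv
      rw [Multiset.map_cons, Multiset.prod_cons] at hv
      have hvu := v.isUnit
      rw [hv] at hvu
      obtain ⟨⟨v1, h1⟩, ⟨v2, h2⟩⟩ := IsUnit.mul_iff.mp hvu
      rw [show v = v1 * v2 from Units.ext (by rw [hv, Units.val_mul, h1, h2])]
      exact mul_mem (linear_factor_mem h1) (ih v2 h2)
  have hp := (IsAlgClosed.splits p).eq_prod_roots
  have hu' : (u : SobolevAlg t) = algebraMap ℂ _ p.leadingCoeff *
      (p.roots.map fun a => (monomial 1 : SobolevAlg t) - algebraMap ℂ _ a).prod := by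
    rw [hu]
    conv_lhs => rw [hp]
    rw [map_mul, Polynomial.aeval_C, map_multiset_prod, Multiset.map_map]
    simp only [comp_def, map_sub, Polynomial.aeval_X, Polynomial.aeval_C]
  have hunit := u.isUnit
  rw [hu'] at hunit
  obtain ⟨⟨v1, h1⟩, ⟨v2, h2⟩⟩ := IsUnit.mul_iff.mp hunit
  rw [show u = v1 * v2 from Units.ext (by rw [hu', Units.val_mul, h1, h2])]
  refine mul_mem (Subgroup.mem_sup_left (mem_range_expUnits.mpr
    ⟨algebraMap ℂ _ (Complex.log p.leadingCoeff), ?_⟩)) (hmul _ v2 h2)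
  have halg : ∀ (c : ℂ) (x : S1), (algebraMap ℂ (SobolevAlg t) c) x = c := fun c x => by
    rw [Algebra.algebraMap_eq_smul_one, smul_apply, one_apply, mul_one]
  have hne : p.leadingCoeff ≠ 0 := by
    have := ne_zero_of_isUnit v1.isUnit 0
    rwa [h1, halg] at this
  rw [h1]
  exact DFunLike.ext _ _ fun x => by rw [exp_apply, halg, halg, Complex.exp_log hne]

/-- A nowhere vanishing function of class `H^t` is of the form `e^{2πikx} exp q`. The functions of
this form are an open subgroup of the units, and the trigonometric polynomials, which are dense,
split into linear factors. -/
theorem exists_monomial_mul_exp {f : SobolevAlg t} (hf : ∀ x, f x ≠ 0) :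
    ∃ (k : ℤ) (q : SobolevAlg t), f = monomial k * NormedSpace.exp q := by
  obtain ⟨u, hu⟩ := isUnit_of_forall_ne_zero hf
  rw [← hu]
  refine exists_of_mem_logUnits ?_
  have hopen : IsOpen ((Units.val : (SobolevAlg t)ˣ → SobolevAlg t) ''
      ((fun v => u⁻¹ * v) ⁻¹' (logUnits t : Set (SobolevAlg t)ˣ))) :=
    Units.isOpenMap_val _ (isOpen_logUnits.preimage (continuous_const.mul continuous_id))
  have hmem : f ∈ ((Units.val : (SobolevAlg t)ˣ → SobolevAlg t) ''
      ((fun v => u⁻¹ * v) ⁻¹' (logUnits t : Set (SobolevAlg t)ˣ))) :=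
    ⟨u, by
      change u⁻¹ * u ∈ logUnits t
      rw [inv_mul_cancel]
      exact one_mem _, hu⟩
  obtain ⟨s, v, hv, hvs⟩ := ((hasSum_monomial f).eventually (hopen.mem_nhds hmem)).exists
  -- a shift by `N` turns the exponents in `s` into natural numbers
  obtain ⟨N, hN⟩ : ∃ N : ℤ, ∀ n ∈ s, 0 ≤ N + n :=
    ⟨∑ n ∈ s, |n|, fun n hn => by
      have h1 : |n| ≤ ∑ n ∈ s, |n| :=
        Finset.single_le_sum (f := fun n : ℤ => |n|) (fun _ _ => abs_nonneg _) hn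
      have h2 := neg_abs_le n
      linarith⟩
  have hpoly : monomialUnit ^ N * v ∈ logUnits t := by
    refine polynomial_mem (p := ∑ n ∈ s,
      Polynomial.C (fourierCoeff f n) * Polynomial.X ^ (N + n).toNat) ?_
    rw [Units.val_mul, coe_monomialUnit_zpow, hvs, map_sum, Finset.mul_sum]
    refine Finset.sum_congr rfl fun n hn => ?_
    have hpow : (monomial 1 : SobolevAlg t) ^ (N + n).toNat = monomial (N + n) := by
      have := congrArg (fun w : (SobolevAlg t)ˣ => (w : SobolevAlg t))
        (zpow_natCast (monomialUnit (t := t)) (N + n).toNat)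
      simp only [Int.toNat_of_nonneg (hN n hn), coe_monomialUnit_zpow, Units.val_pow_eq_pow_val]
        at this
      exact this.symm
    rw [map_mul, Polynomial.aeval_C, map_pow, Polynomial.aeval_X, hpow, mul_smul_comm,
      ← monomial_add, Algebra.smul_def]
  have hvmem : v ∈ logUnits t := (Subgroup.mul_mem_cancel_left _
    (Subgroup.zpow_mem _ (Subgroup.mem_sup_right (Subgroup.mem_zpowers _)) N)).mp hpoly
  have huv : u⁻¹ * v ∈ logUnits t := hv
  have := mul_mem hvmem (inv_mem huv)
  rwa [mul_inv_rev, inv_inv, mul_inv_cancel_left] at this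

end SobolevAlg

/-! ### Fourier multipliers, differentiation and integration -/

namespace HC

variable {t : ℝ}

theorem ext_fourierCoeff {f g : HC t}
    (h : ∀ n, fourierCoeff (toCM f) n = fourierCoeff (toCM g) n) : f = g :=
  toCM_injective (TwoHS.ext_fourierCoeff h)

theorem exists_multiplier {t' : ℝ} (ht' : 1 / 2 < t') {m : ℤ → ℂ} {C : ℝ}
    (hm : ∀ n, sobolevWeight t' n * ‖m n‖ ≤ C * sobolevWeight t n) :
    ∃ L : HC t →L[ℂ] HC t', ∀ f n,
      fourierCoeff (toCM (L f)) n = m n * fourierCoeff (toCM f) n := by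
  have hC : 0 ≤ C := by
    have h0 := hm 0
    have h1 := mul_nonneg (sobolevWeight_pos t' 0).le (norm_nonneg (m 0))
    have h2 := sobolevWeight_pos t 0
    by_contra hneg
    nlinarith
  have key : ∀ f : HC t, ∃ g : HC t', (∀ n, fourierCoeff (toCM g) n =
      m n * fourierCoeff (toCM f) n) ∧ ‖g‖ ≤ C * ‖f‖ := by
    intro f
    set c : ℤ → ℂ := fun n => ((sobolevWeight t' n : ℝ) : ℂ) * (m n * fourierCoeff (toCM f) n)
      with hc
    have hle : ∀ n, ‖c n‖ ≤ ‖((C : ℂ) • toEll2 f : lp (fun _ : ℤ => ℂ) 2) n‖ := by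
      intro n
      have e : ‖((C : ℂ) • toEll2 f : lp (fun _ : ℤ => ℂ) 2) n‖ =
          C * (sobolevWeight t n * ‖fourierCoeff (toCM f) n‖) := by
        rw [← norm_weightedCoeff, lp.coeFn_smul, Pi.smul_apply, norm_smul, Complex.norm_real,
          Real.norm_of_nonneg hC]
        rfl
      rw [e, hc]
      simp only [norm_mul, Complex.norm_real, Real.norm_of_nonneg (sobolevWeight_pos t' n).le]
      rw [← mul_assoc, ← mul_assoc]
      exact mul_le_mul_of_nonneg_right (hm n) (norm_nonneg _)
    have hmem : Memℓp c 2 := (lp.memℓp ((C : ℂ) • toEll2 f)).mono' hle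
    refine ⟨(ell2Equiv ht').symm ⟨c, hmem⟩, fun n => ?_, ?_⟩
    · have h := ell2Equiv_apply ht' ((ell2Equiv ht').symm ⟨c, hmem⟩) n
      rw [LinearIsometryEquiv.apply_symm_apply] at h
      have hw : ((sobolevWeight t' n : ℝ) : ℂ) ≠ 0 :=
        Complex.ofReal_ne_zero.mpr (sobolevWeight_pos t' n).ne'
      exact (mul_left_cancel₀ hw h).symm
    · rw [LinearIsometryEquiv.norm_map]
      refine (lp.norm_mono (by norm_num) hle).trans (le_of_eq ?_)
      rw [norm_smul, Complex.norm_real, Real.norm_of_nonneg hC, norm_def]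
  choose g hg hgn using key
  have hadd : ∀ f f' : HC t, ∀ n, fourierCoeff (toCM (f + f')) n =
      fourierCoeff (toCM f) n + fourierCoeff (toCM f') n := fun f f' n => by
    rw [map_add, ← fourierCoeffCLM_apply, map_add]
    rfl
  have hsmul : ∀ {r : ℝ} (c : ℂ) (f : HC r) n, fourierCoeff (toCM (c • f)) n =
      c * fourierCoeff (toCM f) n := fun c f n => by
    rw [map_smul, ← fourierCoeffCLM_apply, map_smul]
    rfl
  have hadd' : ∀ f f' : HC t', ∀ n, fourierCoeff (toCM (f + f')) n =
      fourierCoeff (toCM f) n + fourierCoeff (toCM f') n := fun f f' n => by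
    rw [map_add, ← fourierCoeffCLM_apply, map_add]
    rfl
  refine ⟨LinearMap.mkContinuous { toFun := g, map_add' := ?_, map_smul' := ?_ } C hgn, hg⟩
  · exact fun f f' => ext_fourierCoeff fun n => by
      rw [hg, hadd, hadd', hg, hg, mul_add]
  · exact fun c f => ext_fourierCoeff fun n => by
      rw [hg, hsmul, RingHom.id_apply, hsmul, hg]
      ring

theorem sobolevWeight_eq_mul_sqrt (s : ℝ) (n : ℤ) :
    sobolevWeight s n = sobolevWeight (s - 1) n * √(1 + (n : ℝ) ^ 2) := by
  rw [sobolevWeight, sobolevWeight, Real.sqrt_eq_rpow, ← Real.rpow_add (by positivity)]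
  congr 1
  ring

theorem fourierCoeff_monomial (n m : ℤ) :
    fourierCoeff (toCM (monomial t n)) m = if m = n then 1 else 0 := by
  change fourierCoeff (fourier n : C(S1, ℂ)) m = _
  rw [fourierCoeff_fourier, Pi.single_apply]

/-- Differentiation is a bounded operator from `H^s` to `H^{s-1}`. -/
theorem exists_derivCLM {s : ℝ} (hs : 3 / 2 < s) : ∃ D : HC s →L[ℂ] HC (s - 1),
    (∀ f n, fourierCoeff (toCM (D f)) n = 2 * Real.pi * Complex.I * n * fourierCoeff (toCM f) n) ∧
    ∀ (f : HC s) (y : ℝ), HasDerivAt (fun y : ℝ => f (y : S1)) (D f (y : S1)) y := by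
  have ht : 1 / 2 < s - 1 := by linarith
  obtain ⟨D, hD⟩ := exists_multiplier (t := s) ht (m := fun n : ℤ => 2 * Real.pi * Complex.I * n)
    (C := 2 * Real.pi) (fun n => by
      rw [sobolevWeight_eq_mul_sqrt s]
      have h1 : ‖(2 * Real.pi * Complex.I * n : ℂ)‖ = 2 * Real.pi * |(n : ℝ)| := by
        simp [abs_of_pos Real.pi_pos]
      have h2 : |(n : ℝ)| ≤ √(1 + (n : ℝ) ^ 2) := by
        rw [← Real.sqrt_sq_eq_abs]
        exact Real.sqrt_le_sqrt (by linarith)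
      rw [h1]
      have := sobolevWeight_pos (s - 1) n
      calc sobolevWeight (s - 1) n * (2 * Real.pi * |(n : ℝ)|)
          ≤ sobolevWeight (s - 1) n * (2 * Real.pi * √(1 + (n : ℝ) ^ 2)) := by gcongr
        _ = _ := by ring)
  refine ⟨D, hD, ?_⟩
  obtain ⟨C, hC⟩ := exists_deriv hs
  choose g hg hgC using hC
  let T : HC s →ₗ[ℂ] C(S1, ℂ) :=
    { toFun := g
      map_add' := fun a b => by
        ext x
        induction x using QuotientAddGroup.induction_on with
        | H y => exact (hg (a + b) y).unique ((hg a y).add (hg b y))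
      map_smul' := fun c a => by
        ext x
        induction x using QuotientAddGroup.induction_on with
        | H y => exact (hg (c • a) y).unique ((hg a y).const_smul c) }
  have hTc : Continuous T := (LinearMap.mkContinuous T C hgC).continuous
  obtain ⟨C', hC'⟩ := exists_sup_bound ht
  let S : HC s →ₗ[ℂ] C(S1, ℂ) := toCM ∘ₗ D.toLinearMap
  have hSc : Continuous S := (LinearMap.mkContinuous (toCM : HC (s - 1) →ₗ[ℂ] C(S1, ℂ)) C'
    (fun f => (ContinuousMap.norm_le_of_nonempty _).mpr (hC' f))).continuous.comp D.continuous
  have hmon : ∀ n, T (monomial s n) = S (monomial s n) := by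
    intro n
    have h1 : D (monomial s n) = (2 * Real.pi * Complex.I * n : ℂ) • monomial (s - 1) n := by
      refine ext_fourierCoeff fun m => ?_
      rw [hD, fourierCoeff_monomial, map_smul, ← fourierCoeffCLM_apply, map_smul,
        fourierCoeffCLM_apply, fourierCoeff_monomial, smul_eq_mul]
      split_ifs with h
      · rw [h]
      · simp
    have h2 : S (monomial s n) = toCM ((2 * Real.pi * Complex.I * n : ℂ) • monomial (s - 1) n) := by
      rw [← h1]
      rfl
    rw [h2]
    ext x
    induction x using QuotientAddGroup.induction_on with
    | H y =>
      refine (hg (monomial s n) y).unique ?_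
      refine (hasDerivAt_fourier 1 n y).congr_deriv ?_
      change _ = (2 * Real.pi * Complex.I * n : ℂ) * fourier n (y : S1)
      push_cast
      ring
  have hTS : ∀ f, T f = S f := by
    intro f
    have h1 := (hasSum_monomial (by linarith) f).map T hTc
    have h2 := (hasSum_monomial (by linarith) f).map S hSc
    have e : (T ∘ fun n => fourierCoeff (toCM f) n • monomial s n) =
        S ∘ fun n => fourierCoeff (toCM f) n • monomial s n := by
      funext n
      simp only [comp_apply, map_smul, hmon]
    rw [e] at h1
    exact h1.unique h2
  intro f y
  have := congrArg (fun u : C(S1, ℂ) => u (y : S1)) (hTS f)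
  have h3 : g f (y : S1) = D f (y : S1) := this
  rw [← h3]
  exact hg f y

/-- Integration: a bounded operator from `H^{s-1}` to `H^s` that is a right inverse of
differentiation up to the mean value. -/
theorem exists_antiderivCLM {s : ℝ} (hs : 3 / 2 < s) : ∃ J : HC (s - 1) →L[ℂ] HC s,
    ∀ (g : HC (s - 1)) (y : ℝ), HasDerivAt (fun y : ℝ => J g (y : S1))
      (g (y : S1) - ∫ x, g x ∂haarAddCircle) y := by
  obtain ⟨D, hD, hD'⟩ := exists_derivCLM hs
  obtain ⟨J, hJ⟩ := exists_multiplier (t := s - 1) (t' := s) (by linarith)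
    (m := fun n : ℤ => (2 * Real.pi * Complex.I * n)⁻¹) (C := 1) (fun n => by
      rw [sobolevWeight_eq_mul_sqrt s]
      have h1 : ‖(2 * Real.pi * Complex.I * n : ℂ)⁻¹‖ = (2 * Real.pi * |(n : ℝ)|)⁻¹ := by
        rw [norm_inv]
        simp [abs_of_pos Real.pi_pos]
      rw [h1, mul_assoc, mul_comm 1]
      refine mul_le_mul_of_nonneg_left ?_ (sobolevWeight_pos (s - 1) n).le
      by_cases hn : n = 0
      · simp [hn]
      · have hn1 : (1 : ℝ) ≤ |(n : ℝ)| := by exact_mod_cast Int.one_le_abs hn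
        have h2 : √(1 + (n : ℝ) ^ 2) ≤ 2 * |(n : ℝ)| := by
          refine Real.sqrt_le_iff.mpr ⟨by positivity, ?_⟩
          rw [mul_pow, sq_abs]
          nlinarith [sq_abs (n : ℝ)]
        have h3 := Real.pi_gt_three
        rw [← div_eq_mul_inv, div_le_one (by positivity)]
        nlinarith)
  refine ⟨J, fun g y => ?_⟩
  have hmean : fourierCoeff (toCM g) 0 = ∫ x, g x ∂haarAddCircle := by
    simp only [fourierCoeff, neg_zero, fourier_zero, one_smul]
    rfl
  have key : D (J g) = g - (∫ x, g x ∂haarAddCircle) • (1 : HC (s - 1)) := by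
    have h1 : (1 : HC (s - 1)) = monomial (s - 1) 0 := DFunLike.coe_injective (by
      funext x
      simp [monomial_apply])
    refine ext_fourierCoeff fun n => ?_
    rw [hD, hJ, map_sub, ← fourierCoeffCLM_apply, ← fourierCoeffCLM_apply, map_sub, map_smul,
      map_smul, fourierCoeffCLM_apply, fourierCoeffCLM_apply, h1, fourierCoeff_monomial,
      smul_eq_mul, ← hmean]
    by_cases hn : n = 0
    · subst hn
      simp
    · have : (2 * Real.pi * Complex.I * n : ℂ) ≠ 0 := by
        have := Real.pi_ne_zero
        simp [hn, this]
      rw [if_neg hn, mul_zero, sub_zero, mul_inv_cancel_left₀ this]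
  have h := hD' (J g) y
  rw [key] at h
  simpa using h

/-! ### Complex conjugation and real parts -/

theorem fourierCoeff_conj {f g : C(S1, ℂ)} (h : ∀ x, g x = (starRingEnd ℂ) (f x)) (n : ℤ) :
    fourierCoeff g n = (starRingEnd ℂ) (fourierCoeff f (-n)) := by
  rw [fourierCoeff, fourierCoeff, ← integral_conj]
  congr 1
  funext x
  rw [h, smul_eq_mul, smul_eq_mul, map_mul, neg_neg, fourier_neg]

theorem exists_conj (f : HC t) : ∃ g : HC t, (∀ x, g x = (starRingEnd ℂ) (f x)) ∧ ‖g‖ ≤ ‖f‖ := by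
  let g : C(S1, ℂ) := ⟨fun x => (starRingEnd ℂ) (f x), Complex.continuous_conj.comp f.continuous_coe⟩
  have hw : ∀ n, ‖weightedCoeff t g n‖ = ‖weightedCoeff t (toCM f) (Equiv.neg ℤ n)‖ := fun n => by
    rw [norm_weightedCoeff, norm_weightedCoeff, fourierCoeff_conj (f := toCM f) (g := g)
      (fun _ => rfl), RCLike.norm_conj, Equiv.neg_apply, sobolevWeight, sobolevWeight, Int.cast_neg,
      neg_sq]
  have hm := memℓp_comp_equiv (u := weightedCoeff t (toCM f)) f.2 (Equiv.neg ℤ)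
  have hg : Memℓp (weightedCoeff t g) 2 := hm.mono' fun n => (hw n).le
  refine ⟨⟨g, hg⟩, fun _ => rfl, ?_⟩
  have h1 : ‖(⟨weightedCoeff t g, hg⟩ : lp (fun _ : ℤ => ℂ) 2)‖ ≤ ‖(⟨_, hm⟩ : lp (fun _ : ℤ => ℂ) 2)‖ :=
    lp.norm_mono (by norm_num) fun n => (hw n).le
  rw [norm_comp_equiv] at h1
  exact h1

/-- Complex conjugation on `H^t`. -/
def conj : HC t →L[ℝ] HC t :=
  LinearMap.mkContinuous
    { toFun := fun f => (exists_conj f).choose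
      map_add' := fun f g => DFunLike.coe_injective (funext fun x =>
        ((exists_conj (f + g)).choose_spec.1 x).trans ((map_add (starRingEnd ℂ) (f x) (g x)).trans
          (congrArg₂ (· + ·) ((exists_conj f).choose_spec.1 x).symm
            ((exists_conj g).choose_spec.1 x).symm)))
      map_smul' := fun c f => DFunLike.coe_injective (funext fun x => by
        refine ((exists_conj (c • f)).choose_spec.1 x).trans ?_
        change _ = (c • (exists_conj f).choose) x
        rw [coe_real_smul, coe_real_smul, Pi.smul_apply, Pi.smul_apply,
          (exists_conj f).choose_spec.1 x]
        simp) } 1 fun f => by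
    rw [one_mul]
    exact (exists_conj f).choose_spec.2

theorem conj_apply (f : HC t) (x : S1) : conj f x = (starRingEnd ℂ) (f x) :=
  (exists_conj f).choose_spec.1 x

theorem exists_re (f : HC t) :
    ∃ g : HR t, (∀ x, g x = (f x).re) ∧ HR.toHC g = (1 / 2 : ℝ) • (f + conj f) := by
  let g : C(S1, ℝ) := ⟨fun x => (f x).re, Complex.continuous_re.comp f.continuous_coe⟩
  have hg : complexify g = toCM ((1 / 2 : ℝ) • (f + conj f)) := by
    ext x
    change ((f x).re : ℂ) = ((1 / 2 : ℝ) • (f + conj f)) x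
    rw [coe_real_smul, Pi.smul_apply, coe_add, Pi.add_apply, conj_apply, Complex.add_conj,
      Complex.real_smul]
    push_cast
    ring
  have hmem : complexify g ∈ sobolevSubmodule t := by
    rw [hg]
    exact ((1 / 2 : ℝ) • (f + conj f)).2
  exact ⟨⟨g, hmem⟩, fun _ => rfl, toCM_injective hg⟩

/-- The real part of a function of class `H^t`. -/
def re : HC t →L[ℝ] HR t :=
  LinearMap.mkContinuous
    { toFun := fun f => (exists_re f).choose
      map_add' := fun f g => DFunLike.coe_injective (funext fun x =>
        ((exists_re (f + g)).choose_spec.1 x).trans ((Complex.add_re (f x) (g x)).trans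
          (congrArg₂ (· + ·) ((exists_re f).choose_spec.1 x).symm
            ((exists_re g).choose_spec.1 x).symm)))
      map_smul' := fun c f => DFunLike.coe_injective (funext fun x => by
        refine ((exists_re (c • f)).choose_spec.1 x).trans ?_
        change _ = (c • (exists_re f).choose) x
        rw [coe_real_smul, HR.coe_smul, Pi.smul_apply, Pi.smul_apply,
          (exists_re f).choose_spec.1 x]
        simp) } ((1 / 2) * (1 + ‖(conj : HC t →L[ℝ] HC t)‖))
    fun f => by
      change ‖(exists_re f).choose‖ ≤ _
      rw [HR.norm_def, (exists_re f).choose_spec.2, norm_smul, Real.norm_of_nonneg (by norm_num)]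
      have h1 := norm_add_le f (conj f)
      have h2 := (conj : HC t →L[ℝ] HC t).le_opNorm f
      nlinarith

theorem re_apply (f : HC t) (x : S1) : re f x = (f x).re := (exists_re f).choose_spec.1 x

end HC

namespace HR

variable {t : ℝ}

/-- The inclusion of the real-valued functions as a bounded operator. -/
def toHCL : HR t →L[ℝ] HC t :=
  LinearMap.mkContinuous toHC 1 fun f => by
    rw [one_mul]
    exact le_of_eq rfl

/-- The derivative as a bounded operator on real-valued functions. -/
theorem exists_derivCLM {s : ℝ} (hs : 3 / 2 < s) :
    ∃ D : HR s →L[ℝ] HR (s - 1), ∀ f x, D f x = circleDeriv f x := by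
  obtain ⟨D, -, hD⟩ := HC.exists_derivCLM hs
  refine ⟨HC.re ∘L (D.restrictScalars ℝ) ∘L toHCL, fun f x => ?_⟩
  induction x using QuotientAddGroup.induction_on with
  | H y =>
    have h := Complex.reCLM.hasFDerivAt.comp_hasDerivAt y (hD (toHCL f) y)
    have h' : HasDerivAt (fun y : ℝ => f (y : S1)) ((D (toHCL f) (y : S1)).re) y := h
    exact (HC.re_apply _ _).trans (circleDeriv_eq h').symm

end HR

/-! ### The logarithm of positive functions and polar coordinates -/

namespace SobolevAlg

variable {t : ℝ} [ht : Fact (1 / 2 < t)]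

/-- The identity map to the Hilbert space `H^t`, as a real isomorphism. -/
def toHCReal : SobolevAlg t ≃L[ℝ] HC t where
  toFun := toHC
  invFun := toHC.symm
  map_add' := map_add toHC
  map_smul' c f := DFunLike.coe_injective (by
    funext x
    rw [RingHom.id_apply, HC.coe_real_smul, Pi.smul_apply, toHC_apply, toHC_apply, real_smul_apply,
      Complex.real_smul])
  left_inv := toHC.left_inv
  right_inv := toHC.right_inv
  continuous_toFun := toHC.continuous
  continuous_invFun := toHC.symm.continuous

theorem toHCReal_apply (f : SobolevAlg t) (x : S1) : toHCReal f x = f x := rfl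

/-- The real part. -/
def re : SobolevAlg t →L[ℝ] HR t := HC.re ∘L (toHCReal (t := t)).toContinuousLinearMap

theorem re_apply (f : SobolevAlg t) (x : S1) : re f x = (f x).re := HC.re_apply _ x

/-- Complex conjugation. -/
def conj : SobolevAlg t →L[ℝ] SobolevAlg t :=
  (toHCReal (t := t)).symm.toContinuousLinearMap ∘L HC.conj ∘L (toHCReal (t := t)).toContinuousLinearMap

theorem conj_apply (f : SobolevAlg t) (x : S1) : conj f x = (starRingEnd ℂ) (f x) :=
  HC.conj_apply (toHCReal f) x

end SobolevAlg

namespace HR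

variable {t : ℝ} [ht : Fact (1 / 2 < t)]

/-- The inclusion of the real-valued functions into the algebra `H^t(S¹; ℂ)`. -/
def toAlg : HR t →L[ℝ] SobolevAlg t :=
  (SobolevAlg.toHCReal (t := t)).symm.toContinuousLinearMap ∘L toHCL

@[simp] theorem toAlg_apply (f : HR t) (x : S1) : toAlg f x = (f x : ℂ) := rfl

theorem isOpen_pos : IsOpen {u : HR t | ∀ x, 0 < u x} := by
  have : {u : HR t | ∀ x, 0 < u x} =
      toCM ⁻¹' {u : C(S1, ℝ) | Set.MapsTo u Set.univ (Set.Ioi 0)} := by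
    ext h
    simp [Set.MapsTo]
    rfl
  rw [this]
  exact (ContinuousMap.isOpen_setOfPred_mapsTo isCompact_univ isOpen_Ioi).preimage
    (continuous_toCM ht.out)

theorem exists_log {u : HR t} (hu : ∀ x, 0 < u x) : ∃ L : HR t, ∀ x, L x = Real.log (u x) := by
  obtain ⟨q, hq⟩ := SobolevAlg.exists_exp_eq_of_re_pos (f := toAlg u) fun x => by
    rw [toAlg_apply, Complex.ofReal_re]
    exact hu x
  refine ⟨SobolevAlg.re q, fun x => ?_⟩
  have h := congrArg norm (DFunLike.congr_fun hq x)
  rw [SobolevAlg.exp_apply, toAlg_apply, Complex.norm_exp, Complex.norm_real,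
    Real.norm_of_nonneg (hu x).le] at h
  rw [SobolevAlg.re_apply, ← h, Real.log_exp]

open Classical in
/-- The logarithm of a positive function; it is `0` at functions that are not positive. -/
def log (u : HR t) : HR t := if h : ∀ x, 0 < u x then (exists_log h).choose else 0

theorem log_apply {u : HR t} (hu : ∀ x, 0 < u x) (x : S1) : log u x = Real.log (u x) := by
  rw [log, dif_pos hu]
  exact (exists_log hu).choose_spec x

theorem exp_toAlg_log {u : HR t} (hu : ∀ x, 0 < u x) : NormedSpace.exp (toAlg (log u)) = toAlg u :=
  DFunLike.ext _ _ fun x => by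
    rw [SobolevAlg.exp_apply, toAlg_apply, toAlg_apply, log_apply hu, ← Complex.ofReal_exp,
      Real.exp_log (hu x)]

theorem contDiffAt_log {u : HR t} (hu : ∀ x, 0 < u x) : ContDiffAt ℝ ∞ log u := by
  obtain ⟨l, hl, hle⟩ := exists_local_log (toAlg (log u))
  rw [exp_toAlg_log hu] at hl hle
  have h1 : ContDiffAt ℝ ∞ (fun v : HR t => SobolevAlg.re (l (toAlg v))) u :=
    SobolevAlg.re.contDiff.contDiffAt.comp u (hl.comp u toAlg.contDiff.contDiffAt)
  refine h1.congr_of_eventuallyEq ?_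
  filter_upwards [isOpen_pos.mem_nhds hu, toAlg.continuous.continuousAt.eventually hle] with v hv hv'
  refine DFunLike.ext _ _ fun x => ?_
  have h := congrArg norm (DFunLike.congr_fun hv' x)
  rw [SobolevAlg.exp_apply, toAlg_apply, Complex.norm_exp, Complex.norm_real,
    Real.norm_of_nonneg (hv x).le] at h
  rw [log_apply hv, SobolevAlg.re_apply, ← h, Real.log_exp]

theorem fderiv_log_apply {u : HR t} (hu : ∀ x, 0 < u x) (v : HR t) (x : S1) :
    fderiv ℝ log u v x = v x / u x := by
  have h1 : HasFDerivAt log (fderiv ℝ log u) u :=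
    ((contDiffAt_log hu).differentiableAt (by simp)).hasFDerivAt
  have h2 := (hasFDerivAt_exp_banach (toAlg (log u))).comp u
    ((toAlg (t := t)).hasFDerivAt.comp u h1)
  have h3 : (fun v : HR t => NormedSpace.exp (toAlg (log v))) =ᶠ[𝓝 u] toAlg := by
    filter_upwards [isOpen_pos.mem_nhds hu] with v hv
    exact exp_toAlg_log hv
  have h4 := h2.unique ((toAlg (t := t)).hasFDerivAt.congr_of_eventuallyEq h3)
  have h5 : NormedSpace.exp (toAlg (log u)) * toAlg (fderiv ℝ log u v) = toAlg v :=
    DFunLike.congr_fun h4 v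
  have h6 := DFunLike.congr_fun h5 x
  rw [exp_toAlg_log hu, SobolevAlg.mul_apply, toAlg_apply, toAlg_apply, toAlg_apply,
    ← Complex.ofReal_mul, Complex.ofReal_inj] at h6
  rw [← h6, mul_div_cancel_left₀ _ (hu x).ne']

end HR

theorem expHalf_mk {t : ℝ} (k : ℤ) (a : HR t) (x : S1) : expHalf (CircMap.mk k a x) =
    fourier k x * Complex.exp (1 / 2 * (Complex.I * a x)) := by
  induction x using QuotientAddGroup.induction_on with
  | H y =>
    rw [show ((QuotientAddGroup.mk y : S1)) = (y : S1) from rfl, CircMap.mk_coe, expHalf_coe,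
      fourier_coe_apply, ← Complex.exp_add]
    congr 1
    push_cast
    ring

section Polar

variable {t : ℝ} [ht : Fact (1 / 2 < t)]

/-- The exponent `(log u + i a) / 2`. -/
def polarExponent (p : HR t × HR t) : SobolevAlg t :=
  (1 / 2 : ℂ) • (HR.toAlg (HR.log p.1) + Complex.I • HR.toAlg p.2)

/-- The function `√u e^{i(4πkx + a)/2}`. -/
def polar (k : ℤ) (p : HR t × HR t) : SobolevAlg t :=
  SobolevAlg.monomial k * NormedSpace.exp (polarExponent p)

theorem polar_apply (k : ℤ) {p : HR t × HR t} (hp : ∀ x, 0 < p.1 x) (x : S1) :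
    polar k p x = ((√(p.1 x) : ℝ) : ℂ) * expHalf (CircMap.mk k p.2 x) := by
  have h2 : ((√(p.1 x) : ℝ) : ℂ) = Complex.exp (1 / 2 * (Real.log (p.1 x) : ℝ)) := by
    rw [Real.sqrt_eq_rpow, Real.rpow_def_of_pos (hp x)]
    push_cast
    congr 1
    ring
  rw [polar, SobolevAlg.mul_apply, SobolevAlg.exp_apply, SobolevAlg.monomial_apply, polarExponent,
    expHalf_mk, h2]
  simp only [SobolevAlg.smul_apply, SobolevAlg.add_apply, HR.toAlg_apply, HR.log_apply hp, mul_add,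
    Complex.exp_add]
  ring

/-- The differential of `(u, a) ↦ (log u + i a) / 2`. -/
def polarExponentDeriv (p : HR t × HR t) : HR t × HR t →L[ℝ] SobolevAlg t :=
  (1 / 2 : ℂ) • (HR.toAlg ∘L (fderiv ℝ HR.log p.1) ∘L ContinuousLinearMap.fst ℝ (HR t) (HR t) +
    Complex.I • (HR.toAlg ∘L ContinuousLinearMap.snd ℝ (HR t) (HR t)))

theorem polarExponentDeriv_apply {p : HR t × HR t} (hp : ∀ x, 0 < p.1 x) (v : HR t × HR t)
    (x : S1) : polarExponentDeriv p v x = 1 / 2 * ((v.1 x / p.1 x : ℝ) + Complex.I * v.2 x) := by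
  rw [← HR.fderiv_log_apply hp]
  rfl

theorem contDiffAt_polar (k : ℤ) {p : HR t × HR t} (hp : ∀ x, 0 < p.1 x) :
    ContDiffAt ℝ ∞ (polar k) p := by
  have h1 : ContDiffAt ℝ ∞ (fun p : HR t × HR t => HR.log p.1) p :=
    (HR.contDiffAt_log hp).comp p contDiffAt_fst
  have h2 : ContDiffAt ℝ ∞ (polarExponent (t := t)) p :=
    ((HR.toAlg.contDiff.contDiffAt.comp p h1).add
      ((HR.toAlg.contDiff.contDiffAt.comp p contDiffAt_snd).const_smul Complex.I)).const_smul _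
  exact contDiffAt_const.mul (contDiff_exp_banach.contDiffAt.comp p h2)

theorem hasFDerivAt_polar (k : ℤ) {p : HR t × HR t} (hp : ∀ x, 0 < p.1 x) :
    HasFDerivAt (polar k) (polar k p • polarExponentDeriv p) p := by
  have h1 : HasFDerivAt (fun p : HR t × HR t => HR.log p.1)
      (fderiv ℝ HR.log p.1 ∘L ContinuousLinearMap.fst ℝ (HR t) (HR t)) p :=
    ((HR.contDiffAt_log hp).differentiableAt (by simp)).hasFDerivAt.comp p hasFDerivAt_fst
  have h2 : HasFDerivAt (polarExponent (t := t)) (polarExponentDeriv p) p :=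
    HasFDerivAt.const_smul (f := fun p : HR t × HR t =>
        HR.toAlg (HR.log p.1) + Complex.I • HR.toAlg p.2)
      ((HR.toAlg.hasFDerivAt.comp p h1).add
        ((HR.toAlg.hasFDerivAt.comp p hasFDerivAt_snd).const_smul Complex.I)) (1 / 2 : ℂ)
  have h3 := ((hasFDerivAt_exp_banach (polarExponent p)).comp p h2).const_mul
    (SobolevAlg.monomial k)
  refine h3.congr_fderiv (ContinuousLinearMap.ext fun v => ?_)
  change SobolevAlg.monomial k * (NormedSpace.exp (polarExponent p) * polarExponentDeriv p v) =
    polar k p * polarExponentDeriv p v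
  rw [polar, mul_assoc]

end Polar

/-! ### Smooth maps into and out of the manifolds of nowhere vanishing functions and circle maps -/

section SphereManifold

variable {t : ℝ} [ht : Fact (1 / 2 < t)]

theorem Sph.exists_chart_eq (f : Sph t) : ∃ (ε : ℝ) (hε : ε * ε = 1),
    chartAt (onePerp t) f = Sph.stereo ε hε := by
  by_cases h : f.1 = -1
  · exact ⟨-1, by norm_num, if_pos h⟩
  · exact ⟨1, by norm_num, if_neg h⟩

variable {E H M : Type*} [NormedAddCommGroup E] [NormedSpace ℝ E] [TopologicalSpace H]
  {I : ModelWithCorners ℝ E H} [TopologicalSpace M] [ChartedSpace H M] {n : WithTop ℕ∞}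

/-- A map into `𝒰^t` is smooth if it is smooth as a map into the Hilbert space `H^t`. -/
theorem contMDiffAt_of_inclU {f : M → 𝒰 t} {x : M}
    (h : ContMDiffAt I 𝓘(ℝ, HC t) n (fun y => inclU (f y)) x) :
    ContMDiffAt I 𝓘(ℝ, onePerp t) n f x := by
  have hc : ContinuousAt f x := by
    have h1 : Topology.IsInducing (inclU : 𝒰 t → HC t) :=
      Topology.IsInducing.subtypeVal.comp Topology.IsInducing.subtypeVal
    exact h1.continuousAt_iff.mpr h.continuousAt
  refine contMDiffAt_iff_target.mpr ⟨hc, ?_⟩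
  obtain ⟨ε, hε, hchart⟩ := Sph.exists_chart_eq (f x).1
  have e : extChartAt 𝓘(ℝ, onePerp t) (f x) ∘ f = fun y => Sph.stereoFun ε (inclU (f y)) := by
    funext y
    change (chartAt (onePerp t) (f x).1) (f y).1 = _
    rw [hchart]
    rfl
  rw [e]
  have hmem : (f x).1 ∈ (Sph.stereo ε hε).source := by
    rw [← hchart]
    exact mem_chart_source _ _
  exact ContMDiffAt.comp (g := Sph.stereoFun ε) (f := fun y => inclU (f y)) x
    (Sph.contDiffAt_stereoFun ε (Sph.one_add_ne_zero hε hmem)).contMDiffAt h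

/-- The inclusion of `𝒰^t` into the Hilbert space `H^t` is smooth. -/
theorem contMDiff_inclU : ContMDiff 𝓘(ℝ, onePerp t) 𝓘(ℝ, HC t) ∞ (inclU : 𝒰 t → HC t) := by
  have h : ContMDiff 𝓘(ℝ, onePerp t) 𝓘(ℝ, HC t) ∞ (Subtype.val : Sph t → HC t) := by
    intro f
    obtain ⟨ε, hε, hchart⟩ := Sph.exists_chart_eq f
    have h1 : ContMDiffAt 𝓘(ℝ, onePerp t) 𝓘(ℝ, onePerp t) ∞ (Sph.stereo ε hε) f := by
      have := contMDiffAt_extChartAt (I := 𝓘(ℝ, onePerp t)) (n := ∞) (x := f)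
      rw [extChartAt, hchart] at this
      exact this
    have h2 := ContMDiffAt.comp (g := fun h : onePerp t => Sph.stereoInv ε (h : HC t)) f
      (Sph.contDiff_stereoInv ht.out ε (n := ∞)).contDiffAt.contMDiffAt h1
    refine h2.congr_of_eventuallyEq ?_
    have hmem : f ∈ (Sph.stereo ε hε).source := by
      rw [← hchart]
      exact mem_chart_source _ _
    filter_upwards [(Sph.stereo ε hε).open_source.mem_nhds hmem] with g hg
    exact (congrArg Subtype.val ((Sph.stereo ε hε).left_inv hg)).symm
  exact h.comp contMDiff_subtype_val

end SphereManifold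

namespace CircMap

variable {t : ℝ} [ht : Fact (1 / 2 < t)]

theorem chart_symm_apply (k : ℤ) (a b : HR t) : (chart k a).symm b = mk k b := rfl

theorem mk_chart {k : ℤ} {a : HR t} {α : CircMap t} (hα : α ∈ (chart k a).source) :
    mk k (chart k a α) = α := (chart k a).left_inv hα

theorem contMDiff_mk (k : ℤ) : ContMDiff 𝓘(ℝ, HR t) 𝓘(ℝ, HR t) ∞ (mk k : HR t → CircMap t) := by
  intro a
  have hmem : chart k a ∈ IsManifold.maximalAtlas 𝓘(ℝ, HR t) ∞ (CircMap t) :=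
    IsManifold.subset_maximalAtlas ⟨k, a, rfl⟩
  exact (contMDiffOn_symm_of_mem_maximalAtlas hmem).contMDiffAt
    ((chart k a).open_target.mem_nhds (mem_nearby a))

/-- The chart at `α` is the one around the chosen lift. -/
theorem contMDiffAt_chart (α : CircMap t) : ContMDiffAt 𝓘(ℝ, HR t) 𝓘(ℝ, HR t) ∞
    (chart α.winding α.someLift) α :=
  contMDiffAt_extChartAt (I := 𝓘(ℝ, HR t)) (n := ∞) (x := α)

theorem mem_chart_source (α : CircMap t) : α ∈ (chart α.winding α.someLift).source :=
  _root_.mem_chart_source (HR t) α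

end CircMap

/-! ### Integration over the circle -/

theorem integral_circle {E : Type*} [NormedAddCommGroup E] [NormedSpace ℝ E] (u : S1 → E) :
    ∫ x, u x ∂haarAddCircle = ∫ y in (0 : ℝ)..1, u (y : S1) := by
  rw [integral_haarAddCircle, inv_one, one_smul, ← AddCircle.intervalIntegral_preimage 1 0 u,
    zero_add]

section Diffeo

variable {s : ℝ} [hs : Fact (5 / 2 < s)]

/-- The derivative as a bounded operator from `H^s` to `H^{s-1}`. -/
def derivCLM (s : ℝ) [hs : Fact (5 / 2 < s)] : HR s →L[ℝ] HR (s - 1) :=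
  (HR.exists_derivCLM (fact_three_half (s := s)).out).choose

theorem derivCLM_apply (u : HR s) (x : S1) : derivCLM s u x = circleDeriv u x :=
  (HR.exists_derivCLM (fact_three_half (s := s)).out).choose_spec u x

/-- The derivative `φ_x = 1 + h_x`, as an element of `H^{s-1}` that depends on `h`. -/
def dispDeriv (h : H0 s) : HR (s - 1) := CircMap.const (s - 1) 1 + derivCLM s h

theorem dispDeriv_apply (φ : Diff0 s) (x : S1) : dispDeriv φ.1 x = φ.derivative x := by
  rw [dispDeriv, HR.coe_add, Pi.add_apply, derivCLM_apply]
  rfl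

theorem dispDeriv_pos (φ : Diff0 s) (x : S1) : 0 < dispDeriv φ.1 x := by
  rw [dispDeriv_apply]
  exact φ.derivative_pos x

theorem hasFDerivAt_dispDeriv (h : H0 s) :
    HasFDerivAt dispDeriv (derivCLM s ∘L (H0 s).subtypeL) h :=
  (derivCLM s ∘L (H0 s).subtypeL).hasFDerivAt.const_add _

theorem contDiff_dispDeriv : ContDiff ℝ ∞ (dispDeriv : H0 s → HR (s - 1)) :=
  contDiff_const.add (derivCLM s ∘L (H0 s).subtypeL).contDiff

theorem Diff0.continuous_derivative (φ : Diff0 s) : Continuous φ.derivative := by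
  have : φ.derivative = dispDeriv φ.1 := funext fun x => (dispDeriv_apply φ x).symm
  rw [this]
  exact HR.continuous_coe _

theorem Diff0.lift_zero (φ : Diff0 s) : φ.lift 0 = 0 := by
  have h : φ.disp 0 = 0 := φ.1.2
  rw [Diff0.lift, AddCircle.coe_zero, h, add_zero]

theorem Diff0.lift_one (φ : Diff0 s) : φ.lift 1 = 1 := by
  have := φ.lift_add_int 0 1
  rwa [φ.lift_zero, zero_add, Int.cast_one] at this

/-- The change of variables `z = φ(y)` on the circle. -/
theorem Diff0.integral_comp_mul_derivative (φ : Diff0 s) {u : S1 → ℝ} (hu : Continuous u) :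
    ∫ x, u (φ.toFun x) * φ.derivative x ∂haarAddCircle = ∫ x, u x ∂haarAddCircle := by
  rw [integral_circle, integral_circle]
  have h := intervalIntegral.integral_comp_mul_deriv (a := 0) (b := 1) (f := φ.lift)
    (f' := fun y : ℝ => φ.derivative (y : S1)) (g := fun y : ℝ => u (y : S1))
    (fun y _ => φ.hasDerivAt_lift y)
    (φ.continuous_derivative.comp (AddCircle.continuous_mk' 1)).continuousOn
    (hu.comp (AddCircle.continuous_mk' 1))
  rw [φ.lift_zero, φ.lift_one] at h
  rw [← h]
  simp only [comp_apply, Diff0.toFun_coe]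

theorem Diff0.integral_derivative (φ : Diff0 s) : ∫ x, φ.derivative x ∂haarAddCircle = 1 := by
  have := φ.integral_comp_mul_derivative (u := fun _ => 1) continuous_const
  simpa using this

end Diffeo

/-! ### The map `Φ` -/

section Phi

variable {s : ℝ} [hs : Fact (5 / 2 < s)]

/-- The function `√φ_x e^{iα/2}`. -/
def phiAlg (g : G s) : SobolevAlg (s - 1) :=
  polar g.2.winding (dispDeriv g.1.1, g.2.someLift)

theorem phiAlg_apply (g : G s) (x : S1) :
    phiAlg g x = ((√(g.1.derivative x) : ℝ) : ℂ) * expHalf (g.2 x) := by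
  rw [phiAlg, polar_apply _ (dispDeriv_pos g.1), CircMap.mk_someLift, dispDeriv_apply]

/-- Near `g₀` the map is given by polar coordinates in the charts around `g₀`. -/
theorem phiAlg_eventuallyEq (g₀ : G s) : phiAlg =ᶠ[𝓝 g₀] fun g => polar g₀.2.winding
    (dispDeriv g.1.1, CircMap.chart g₀.2.winding g₀.2.someLift g.2) := by
  filter_upwards [continuous_snd.continuousAt.eventually
    ((CircMap.chart g₀.2.winding g₀.2.someLift).open_source.mem_nhds
      (CircMap.mem_chart_source g₀.2))] with g hg
  refine DFunLike.ext _ _ fun x => ?_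
  rw [phiAlg_apply, polar_apply _ (dispDeriv_pos g.1), CircMap.mk_chart hg, dispDeriv_apply]

theorem contMDiff_phiAlg : ContMDiff (modelG s) 𝓘(ℝ, SobolevAlg (s - 1)) ∞
    (phiAlg : G s → SobolevAlg (s - 1)) := by
  intro g₀
  have h1 : ContMDiffAt (modelG s) 𝓘(ℝ, HR (s - 1)) ∞ (fun g : G s => dispDeriv g.1.1) g₀ :=
    contDiff_dispDeriv.contMDiff.contMDiffAt.comp g₀
      ((contMDiff_subtype_val (I := 𝓘(ℝ, H0 s)) (n := ∞)).contMDiffAt.comp g₀ contMDiffAt_fst)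
  have h2 : ContMDiffAt (modelG s) 𝓘(ℝ, HR (s - 1)) ∞
      (fun g : G s => CircMap.chart g₀.2.winding g₀.2.someLift g.2) g₀ :=
    (CircMap.contMDiffAt_chart g₀.2).comp g₀ contMDiffAt_snd
  have h3 : ContMDiffAt 𝓘(ℝ, HR (s - 1) × HR (s - 1)) 𝓘(ℝ, SobolevAlg (s - 1)) ∞
      (polar g₀.2.winding)
      (dispDeriv g₀.1.1, CircMap.chart g₀.2.winding g₀.2.someLift g₀.2) :=
    (contDiffAt_polar _ (dispDeriv_pos g₀.1)).contMDiffAt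
  exact (ContMDiffAt.comp (g := polar g₀.2.winding) (f := fun g : G s =>
    (dispDeriv g.1.1, CircMap.chart g₀.2.winding g₀.2.someLift g.2)) g₀ h3
    (h1.prodMk_space h2)).congr_of_eventuallyEq (phiAlg_eventuallyEq g₀)

theorem norm_expHalf (θ : S4π) : ‖expHalf θ‖ = 1 := Circle.norm_coe _

theorem expHalf_injective : Injective expHalf := fun a b h =>
  AddCircle.injective_toCircle (by positivity) (Subtype.ext h)

theorem norm_sq_phiAlg (g : G s) (x : S1) : ‖phiAlg g x‖ ^ 2 = g.1.derivative x := by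
  rw [phiAlg_apply, norm_mul, norm_expHalf, mul_one, Complex.norm_real,
    Real.norm_of_nonneg (Real.sqrt_nonneg _), Real.sq_sqrt (g.1.derivative_pos x).le]

/-- The map `Φ(φ, α) = √φ_x e^{iα/2}` into the nowhere vanishing functions in the unit sphere. -/
def phi (g : G s) : 𝒰 (s - 1) :=
  ⟨⟨SobolevAlg.toHC (phiAlg g), by
    simp only [SobolevAlg.toHC_apply, norm_sq_phiAlg]
    exact g.1.integral_derivative⟩, fun x h => by
    have h1 := norm_sq_phiAlg g x
    have h2 : phiAlg g x = 0 := h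
    rw [h2, norm_zero] at h1
    have := g.1.derivative_pos x
    norm_num at h1
    linarith⟩

theorem inclU_phi_apply (g : G s) (x : S1) : inclU (phi g) x = phiAlg g x := rfl

theorem contMDiff_phi : ContMDiff (modelG s) 𝓘(ℝ, onePerp (s - 1)) ∞ (phi : G s → 𝒰 (s - 1)) :=
  fun g => contMDiffAt_of_inclU
    ((SobolevAlg.toHCReal.contDiff.contMDiff.contMDiffAt).comp g (contMDiff_phiAlg g))

end Phi

/-! ### The inverse of `Φ` -/

section Inverse

variable {s : ℝ} [hs : Fact (5 / 2 < s)]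

/-- Evaluation at `0` as a bounded functional. -/
def evalZero (s : ℝ) [hs : Fact (3 / 2 < s)] : HR s →L[ℝ] ℝ :=
  LinearMap.mkContinuous { toFun := fun u => u 0, map_add' := fun _ _ => rfl,
                           map_smul' := fun _ _ => rfl }
    (HR.exists_sup_bound (t := s) (by linarith [hs.out])).choose fun u =>
      ((HR.toCM u).norm_coe_le_norm 0).trans
        ((HR.exists_sup_bound (t := s) (by linarith [hs.out])).choose_spec u)

theorem evalZero_apply (u : HR s) : evalZero s u = u 0 := rfl

/-- The antiderivative that vanishes at `0` of the real part of `g` minus its mean value. -/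
def antideriv (s : ℝ) [hs : Fact (5 / 2 < s)] : HC (s - 1) →L[ℝ] H0 s :=
  ((ContinuousLinearMap.id ℝ (HR s) - (evalZero s).smulRight (CircMap.const s 1)) ∘L HC.re ∘L
    ((HC.exists_antiderivCLM (fact_three_half (s := s)).out).choose.restrictScalars ℝ)).codRestrict
    (H0 s) fun g => by
      change _ - evalZero s _ * 1 = (0 : ℝ)
      rw [mul_one]
      exact sub_self _

theorem circleDeriv_antideriv (g : HC (s - 1)) (x : S1) :
    circleDeriv (antideriv s g : HR s) x = (g x - ∫ y, g y ∂haarAddCircle).re := by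
  induction x using QuotientAddGroup.induction_on with
  | H y =>
    have h := (HC.exists_antiderivCLM (fact_three_half (s := s)).out).choose_spec g y
    set J := (HC.exists_antiderivCLM (fact_three_half (s := s)).out).choose with hJ
    have h1 := (Complex.reCLM.hasFDerivAt.comp_hasDerivAt y h).sub_const
      ((HC.re (J g) : HR s) 0)
    refine circleDeriv_eq (h1.congr_of_eventuallyEq (Filter.Eventually.of_forall fun z => ?_))
    change HC.re (J g) (z : S1) - evalZero s (HC.re (J g)) * 1 =
      (J g (z : S1)).re - HC.re (J g) 0
    rw [HC.re_apply, mul_one, evalZero_apply]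

/-- An element of `Diff₀^s(S¹)` is determined by its derivative. -/
theorem Diff0.ext_derivative {φ ψ : Diff0 s} (h : ∀ x, φ.derivative x = ψ.derivative x) :
    φ = ψ := by
  have hd : ∀ y : ℝ, HasDerivAt (fun y => φ.lift y - ψ.lift y) 0 y := fun y => by
    have := (φ.hasDerivAt_lift y).sub (ψ.hasDerivAt_lift y)
    rw [h, sub_self] at this
    exact this
  have hc : ∀ y, φ.lift y - ψ.lift y = φ.lift 0 - ψ.lift 0 := fun y =>
    is_const_of_deriv_eq_zero (fun y => (hd y).differentiableAt) (fun y => (hd y).deriv) y 0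
  refine Subtype.ext (Subtype.ext (DFunLike.ext _ _ fun x => ?_))
  induction x using QuotientAddGroup.induction_on with
  | H y =>
    have := hc y
    rw [φ.lift_zero, ψ.lift_zero, Diff0.lift, Diff0.lift] at this
    change φ.disp (y : S1) = ψ.disp (y : S1)
    linarith

/-- An element of `𝒰^{s-1}` as an element of the algebra. -/
def algOfU (f : 𝒰 (s - 1)) : SobolevAlg (s - 1) := SobolevAlg.toHCReal.symm (inclU f)

theorem algOfU_apply (f : 𝒰 (s - 1)) (x : S1) : algOfU f x = inclU f x := rfl

theorem algOfU_ne_zero (f : 𝒰 (s - 1)) (x : S1) : algOfU f x ≠ 0 := f.2 x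

theorem contMDiff_algOfU : ContMDiff 𝓘(ℝ, onePerp (s - 1)) 𝓘(ℝ, SobolevAlg (s - 1)) ∞
    (algOfU : 𝒰 (s - 1) → SobolevAlg (s - 1)) :=
  SobolevAlg.toHCReal.symm.contDiff.contMDiff.comp contMDiff_inclU

/-- The displacement `∫₀ˣ (|f|² - 1)`. -/
def dispOf (f : SobolevAlg (s - 1)) : H0 s :=
  antideriv s (SobolevAlg.toHCReal (f * SobolevAlg.conj f))

theorem contDiff_dispOf : ContDiff ℝ ∞ (dispOf : SobolevAlg (s - 1) → H0 s) :=
  (antideriv s).contDiff.comp (SobolevAlg.toHCReal.contDiff.comp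
    (contDiff_id.mul SobolevAlg.conj.contDiff))

theorem one_add_circleDeriv_dispOf (f : 𝒰 (s - 1)) (x : S1) :
    1 + circleDeriv (dispOf (algOfU f) : HR s) x = ‖inclU f x‖ ^ 2 := by
  have h : ∀ x, SobolevAlg.toHCReal (algOfU f * SobolevAlg.conj (algOfU f)) x =
      ((‖inclU f x‖ ^ 2 : ℝ) : ℂ) := fun x => by
    rw [SobolevAlg.toHCReal_apply, SobolevAlg.mul_apply, SobolevAlg.conj_apply, algOfU_apply,
      Complex.mul_conj, Complex.normSq_eq_norm_sq]
  have h1 : ∫ x, ‖inclU f x‖ ^ 2 ∂haarAddCircle = 1 := f.1.2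
  rw [dispOf, circleDeriv_antideriv]
  simp only [h]
  rw [integral_complex_ofReal, h1, ← Complex.ofReal_sub, Complex.ofReal_re]
  ring

/-- The diffeomorphism `φ` with `φ_x = |f|²`. -/
def diffeoOf (f : 𝒰 (s - 1)) : Diff0 s :=
  ⟨dispOf (algOfU f), fun x => by
    have h1 := one_add_circleDeriv_dispOf f x
    have h2 : 0 < ‖inclU f x‖ ^ 2 := by
      have := norm_pos_iff.mpr (algOfU_ne_zero f x)
      rw [algOfU_apply] at this
      positivity
    linarith⟩

theorem derivative_diffeoOf (f : 𝒰 (s - 1)) (x : S1) :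
    (diffeoOf f).derivative x = ‖inclU f x‖ ^ 2 := one_add_circleDeriv_dispOf f x

/-- Twice the imaginary part. -/
def twoIm {t : ℝ} [Fact (1 / 2 < t)] : SobolevAlg t →L[ℝ] HR t :=
  (2 : ℝ) • (SobolevAlg.re ∘L ((-Complex.I) • ContinuousLinearMap.id ℝ (SobolevAlg t)))

theorem twoIm_apply {t : ℝ} [Fact (1 / 2 < t)] (q : SobolevAlg t) (x : S1) :
    twoIm q x = 2 * (q x).im := by
  change 2 * SobolevAlg.re ((-Complex.I) • q) x = _
  rw [SobolevAlg.re_apply, SobolevAlg.smul_apply]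
  simp

/-- If `f = e^{2πikx} exp q`, then the angle of `f` is the class of `4πkx + 2 Im q`. -/
theorem eq_norm_mul_expHalf {t : ℝ} [Fact (1 / 2 < t)] {f q : SobolevAlg t} {k : ℤ}
    (h : f = SobolevAlg.monomial k * NormedSpace.exp q) (x : S1) :
    f x = (‖f x‖ : ℂ) * expHalf (CircMap.mk k (twoIm q) x) := by
  have h1 : ‖f x‖ = Real.exp (q x).re := by
    rw [h, SobolevAlg.mul_apply, SobolevAlg.exp_apply, SobolevAlg.monomial_apply, norm_mul,
      fourier_apply, Circle.norm_coe, one_mul, Complex.norm_exp]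
  have h2 : (f x : ℂ) = fourier k x * Complex.exp (q x) := by
    rw [h, SobolevAlg.mul_apply, SobolevAlg.exp_apply, SobolevAlg.monomial_apply]
  rw [h1, h2, expHalf_mk, twoIm_apply, Complex.ofReal_exp, mul_left_comm, ← Complex.exp_add]
  congr 2
  conv_lhs => rw [← Complex.re_add_im (q x)]
  push_cast
  ring

theorem norm_inclU_phi (g : G s) (x : S1) :
    ((‖inclU (phi g) x‖ : ℝ) : ℂ) = ((√(g.1.derivative x) : ℝ) : ℂ) := by
  rw [inclU_phi_apply, ← norm_sq_phiAlg, Real.sqrt_sq (norm_nonneg _)]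

/-- The angle of `Φ(φ, α)` is `α`. -/
theorem phi_snd_eq {g : G s} {α : CircMap (s - 1)}
    (h : ∀ x, inclU (phi g) x = (‖inclU (phi g) x‖ : ℂ) * expHalf (α x)) : g.2 = α := by
  refine DFunLike.ext _ _ fun x => expHalf_injective ?_
  have h1 := h x
  rw [norm_inclU_phi, inclU_phi_apply, phiAlg_apply] at h1
  have h2 : ((√(g.1.derivative x) : ℝ) : ℂ) ≠ 0 :=
    Complex.ofReal_ne_zero.mpr (Real.sqrt_pos.mpr (g.1.derivative_pos x)).ne'
  exact mul_left_cancel₀ h2 h1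

theorem phi_fst_eq (g : G s) : g.1 = diffeoOf (phi g) :=
  Diff0.ext_derivative fun x => by
    rw [derivative_diffeoOf, inclU_phi_apply, norm_sq_phiAlg]

theorem phi_injective : Injective (phi : G s → 𝒰 (s - 1)) := by
  intro g g' h
  refine Prod.ext ((phi_fst_eq g).trans ((congrArg diffeoOf h).trans (phi_fst_eq g').symm))
    (phi_snd_eq fun x => ?_)
  rw [h, norm_inclU_phi, inclU_phi_apply, phiAlg_apply]

theorem phi_surjective : Surjective (phi : G s → 𝒰 (s - 1)) := by
  intro f
  obtain ⟨k, q, hq⟩ := SobolevAlg.exists_monomial_mul_exp (algOfU_ne_zero f)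
  refine ⟨(diffeoOf f, CircMap.mk k (twoIm q)), Subtype.ext (Subtype.ext (DFunLike.ext _ _
    fun x => ?_))⟩
  change phiAlg (diffeoOf f, CircMap.mk k (twoIm q)) x = algOfU f x
  rw [phiAlg_apply, eq_norm_mul_expHalf hq x]
  simp only [derivative_diffeoOf, Real.sqrt_sq (norm_nonneg _), algOfU_apply]

/-- `Φ` as a bijection. -/
def phiEquiv (s : ℝ) [Fact (5 / 2 < s)] : G s ≃ 𝒰 (s - 1) :=
  Equiv.ofBijective phi ⟨phi_injective, phi_surjective⟩

theorem phi_phiEquiv_symm (f : 𝒰 (s - 1)) : phi ((phiEquiv s).symm f) = f :=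
  (phiEquiv s).apply_symm_apply f

theorem phiEquiv_symm_fst (f : 𝒰 (s - 1)) : ((phiEquiv s).symm f).1 = diffeoOf f := by
  rw [phi_fst_eq, phi_phiEquiv_symm]

theorem phiEquiv_symm_snd {f : 𝒰 (s - 1)} {q : SobolevAlg (s - 1)} {k : ℤ}
    (h : algOfU f = SobolevAlg.monomial k * NormedSpace.exp q) :
    ((phiEquiv s).symm f).2 = CircMap.mk k (twoIm q) :=
  phi_snd_eq fun x => by
    rw [phi_phiEquiv_symm]
    exact eq_norm_mul_expHalf h x

theorem contMDiff_phiEquiv_symm_fst : ContMDiff 𝓘(ℝ, onePerp (s - 1)) 𝓘(ℝ, H0 s) ∞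
    (fun f : 𝒰 (s - 1) => ((phiEquiv s).symm f).1) := by
  simp only [phiEquiv_symm_fst]
  intro f
  refine (ContMDiffAt.subtypeVal_comp_iff _ _ _).mp ?_
  exact (contDiff_dispOf.contMDiff.comp contMDiff_algOfU) f

/-- Near `f₀ = e^{2πikx} exp q₀` the angle is twice the imaginary part of a smooth logarithm of
`e^{-2πikx} f`. -/
theorem contMDiff_phiEquiv_symm_snd : ContMDiff 𝓘(ℝ, onePerp (s - 1)) 𝓘(ℝ, HR (s - 1)) ∞
    (fun f : 𝒰 (s - 1) => ((phiEquiv s).symm f).2) := by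
  intro f₀
  obtain ⟨k, q, hq⟩ := SobolevAlg.exists_monomial_mul_exp (algOfU_ne_zero f₀)
  obtain ⟨l, hl, hle⟩ := exists_local_log q
  have hcancel : ∀ w : SobolevAlg (s - 1),
      SobolevAlg.monomial k * (SobolevAlg.monomial (-k) * w) = w := fun w => by
    rw [← mul_assoc, ← SobolevAlg.monomial_add, add_neg_cancel, SobolevAlg.monomial_zero, one_mul]
  have hq' : SobolevAlg.monomial (-k) * algOfU f₀ = NormedSpace.exp q := by
    rw [hq, ← mul_assoc, ← SobolevAlg.monomial_add, neg_add_cancel, SobolevAlg.monomial_zero,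
      one_mul]
  rw [← hq'] at hl hle
  have h1 : ContMDiff 𝓘(ℝ, onePerp (s - 1)) 𝓘(ℝ, SobolevAlg (s - 1)) ∞
      (fun f : 𝒰 (s - 1) => SobolevAlg.monomial (-k) * algOfU f) :=
    (contDiff_const.mul contDiff_id).contMDiff.comp contMDiff_algOfU
  have h2 : ContMDiffAt 𝓘(ℝ, onePerp (s - 1)) 𝓘(ℝ, HR (s - 1)) ∞
      (fun f : 𝒰 (s - 1) => twoIm (l (SobolevAlg.monomial (-k) * algOfU f))) f₀ :=
    twoIm.contDiff.contMDiff.contMDiffAt.comp f₀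
      (ContMDiffAt.comp (g := l) f₀ hl.contMDiffAt (h1 f₀))
  refine (((CircMap.contMDiff_mk k).contMDiffAt).comp f₀ h2).congr_of_eventuallyEq ?_
  filter_upwards [h1.continuous.continuousAt.eventually hle] with f hf
  refine phiEquiv_symm_snd ?_
  rw [hf, hcancel]

/-- `Φ` as a diffeomorphism. -/
def phiDiffeomorph (s : ℝ) [Fact (5 / 2 < s)] :
    Diffeomorph (modelG s) 𝓘(ℝ, onePerp (s - 1)) (G s) (𝒰 (s - 1)) ∞ where
  toEquiv := phiEquiv s
  contMDiff_toFun := contMDiff_phi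
  contMDiff_invFun := contMDiff_phiEquiv_symm_fst.prodMk contMDiff_phiEquiv_symm_snd

end Inverse

/-! ### The isometry property -/

/-- In its own chart at `x`, the differential of the chart at `x` is the identity. -/
theorem hasMFDerivAt_extChartAt_self {E H M : Type*} [NormedAddCommGroup E] [NormedSpace ℝ E]
    [TopologicalSpace H] {I : ModelWithCorners ℝ E H} [TopologicalSpace M] [ChartedSpace H M]
    (x : M) : HasMFDerivAt I 𝓘(ℝ, E) (extChartAt I x) x (ContinuousLinearMap.id ℝ E) := by
  refine ⟨continuousAt_extChartAt x, ?_⟩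
  refine (hasFDerivWithinAt_id _ _).congr_of_eventuallyEq ?_ ?_
  · filter_upwards [extChartAt_target_mem_nhdsWithin x] with y hy
    exact PartialEquiv.right_inv (extChartAt I x) hy
  · exact PartialEquiv.right_inv (extChartAt I x) (mem_extChartAt_target x)

section Isometry

variable {s : ℝ} [hs : Fact (5 / 2 < s)]

/-- The differential of `√φ_x e^{iα/2}`, namely
`(U₁, U₂) ↦ √φ_x e^{iα/2} (U₁ₓ / φ_x + i U₂) / 2`. -/
def phiAlgDeriv (g : G s) : H0 s × HR (s - 1) →L[ℝ] SobolevAlg (s - 1) :=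
  (phiAlg g • polarExponentDeriv (dispDeriv g.1.1, g.2.someLift)) ∘L
    ((derivCLM s ∘L (H0 s).subtypeL).prodMap (ContinuousLinearMap.id ℝ (HR (s - 1))))

theorem phiAlgDeriv_apply (g : G s) (U : H0 s × HR (s - 1)) (x : S1) : phiAlgDeriv g U x =
    phiAlg g x * (1 / 2 *
      ((circleDeriv (U.1 : HR s) x / g.1.derivative x : ℝ) + Complex.I * U.2 x)) := by
  rw [← dispDeriv_apply, ← derivCLM_apply, ← polarExponentDeriv_apply (p := (dispDeriv g.1.1,
    g.2.someLift)) (dispDeriv_pos g.1) (derivCLM s U.1, U.2)]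
  rfl

theorem chart_someLift (α : CircMap (s - 1)) :
    CircMap.chart α.winding α.someLift α = α.someLift := by
  have h := (CircMap.chart α.winding α.someLift).right_inv (x := α.someLift)
    (CircMap.mem_nearby _)
  rwa [CircMap.chart_symm_apply, CircMap.mk_someLift] at h

theorem hasMFDerivAt_phiAlg (g : G s) : HasMFDerivAt (modelG s) 𝓘(ℝ, SobolevAlg (s - 1))
    (phiAlg : G s → SobolevAlg (s - 1)) g (phiAlgDeriv g) := by
  have h1 := hasMFDerivAt_extChartAt_self (I := modelG s) g
  have hpt : extChartAt (modelG s) g g = ((g.1.1, g.2.someLift) : H0 s × HR (s - 1)) :=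
    Prod.ext rfl (chart_someLift g.2)
  have h2 : HasFDerivAt (fun p : H0 s × HR (s - 1) => polar g.2.winding (dispDeriv p.1, p.2))
      (phiAlgDeriv g) (extChartAt (modelG s) g g) := by
    rw [hpt]
    exact (hasFDerivAt_polar g.2.winding (p := (dispDeriv g.1.1, g.2.someLift))
      (dispDeriv_pos g.1)).comp (g.1.1, g.2.someLift)
      ((hasFDerivAt_dispDeriv g.1.1).prodMap (p := (g.1.1, g.2.someLift)) (hasFDerivAt_id _))
  exact (h2.hasMFDerivAt.comp g h1).congr_of_eventuallyEq (phiAlg_eventuallyEq g)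

theorem mfderiv_inclU_phi (g : G s) (U : TangentSpace (modelG s) g) :
    (mfderiv 𝓘(ℝ, onePerp (s - 1)) 𝓘(ℝ, HC (s - 1)) inclU (phi g)
      (mfderiv (modelG s) 𝓘(ℝ, onePerp (s - 1)) phi g U) : HC (s - 1)) =
      SobolevAlg.toHCReal (phiAlgDeriv g U) := by
  have h1 : HasMFDerivAt (modelG s) 𝓘(ℝ, HC (s - 1)) (fun g : G s => inclU (phi g)) g
      (SobolevAlg.toHCReal.toContinuousLinearMap ∘L phiAlgDeriv g) :=
    SobolevAlg.toHCReal.hasFDerivAt.hasMFDerivAt.comp g (hasMFDerivAt_phiAlg g)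
  have h2 := mfderiv_comp g ((contMDiff_inclU (t := s - 1)).mdifferentiableAt (by simp))
    ((contMDiff_phi (s := s)).mdifferentiableAt (by simp))
  exact (DFunLike.congr_fun (h2.symm.trans h1.mfderiv) U)

/-- The inverse function rule on the circle. -/
theorem Diff0.circleDeriv_comp_symm (φ : Diff0 s) (u : HR s) (x : S1) :
    circleDeriv (u ∘ φ.toHomeomorph.symm) (φ.toFun x) = circleDeriv u x / φ.derivative x := by
  induction x using QuotientAddGroup.induction_on with
  | H y =>
    let e := StrictMono.orderIsoOfSurjective φ.lift φ.strictMono_lift φ.surjective_lift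
    have he : ∀ z, φ.lift (e.symm z) = z := e.apply_symm_apply
    have hy : e.symm (φ.lift y) = y := e.symm_apply_apply y
    have h1 : HasDerivAt e.symm (φ.derivative (y : S1))⁻¹ (φ.lift y) := by
      refine HasDerivAt.of_local_left_inverse e.symm.continuous.continuousAt ?_
        (φ.derivative_pos _).ne' (Filter.Eventually.of_forall he)
      rw [hy]
      exact φ.hasDerivAt_lift y
    have h2 : HasDerivAt (fun z : ℝ => u (z : S1)) (circleDeriv u (y : S1)) (e.symm (φ.lift y)) := by
      rw [hy]
      exact u.hasDerivAt (fact_three_half (s := s)).out y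
    have h3 := h2.comp _ h1
    have h4 : (fun z : ℝ => (u ∘ φ.toHomeomorph.symm) (z : S1)) =
        (fun z : ℝ => u (z : S1)) ∘ e.symm := by
      funext z
      have h5 : φ.toHomeomorph (e.symm z : S1) = (z : S1) :=
        (φ.toFun_coe _).trans (congrArg _ (he z))
      have : φ.toHomeomorph.symm (z : S1) = (e.symm z : S1) :=
        φ.toHomeomorph.symm_apply_eq.mpr h5.symm
      rw [comp_apply, comp_apply, this]
    rw [← h4] at h3
    have h5 := circleDeriv_eq h3
    rw [← Diff0.toFun_coe, ← div_eq_mul_inv] at h5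
    exact h5

theorem continuous_circleDeriv (u : HR s) : Continuous (circleDeriv u) := by
  have : circleDeriv u = derivCLM s u := funext fun x => (derivCLM_apply u x).symm
  rw [this]
  exact HR.continuous_coe _

/-- The metric of `G^s` in terms of the tangent vectors themselves. -/
theorem metricG_eq (g : G s) (U V : TangentSpace (modelG s) g) :
    metricG g U V = ∫ x, 1 / 4 * (circleDeriv ((U : H0 s × HR (s - 1)).1 : HR s) x /
        g.1.derivative x * (circleDeriv ((V : H0 s × HR (s - 1)).1 : HR s) x / g.1.derivative x) +
      (U : H0 s × HR (s - 1)).2 x * (V : H0 s × HR (s - 1)).2 x) * g.1.derivative x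
        ∂haarAddCircle := by
  obtain ⟨U₁, U₂⟩ := (U : H0 s × HR (s - 1))
  obtain ⟨V₁, V₂⟩ := (V : H0 s × HR (s - 1))
  set φ := g.1 with hφ
  let w : S1 → ℝ := fun x => 1 / 4 * (circleDeriv (U₁ : HR s) x / φ.derivative x *
    (circleDeriv (V₁ : HR s) x / φ.derivative x) + U₂ x * V₂ x)
  have hw : Continuous w := by
    have h1 := continuous_circleDeriv (U₁ : HR s)
    have h2 := continuous_circleDeriv (V₁ : HR s)
    have h3 := φ.continuous_derivative
    have h4 := U₂.continuous_coe
    have h5 := V₂.continuous_coe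
    have h6 : ∀ x, φ.derivative x ≠ 0 := fun x => (φ.derivative_pos x).ne'
    exact continuous_const.mul (((h1.div h3 h6).mul (h2.div h3 h6)).add (h4.mul h5))
  have hinv : ∀ x, φ.toHomeomorph.symm (φ.toFun x) = x := φ.toHomeomorph.symm_apply_apply
  have hinv' : ∀ x, φ.toFun (φ.toHomeomorph.symm x) = x := φ.toHomeomorph.apply_symm_apply
  have key := φ.integral_comp_mul_derivative (u := w ∘ φ.toHomeomorph.symm)
    (hw.comp φ.toHomeomorph.symm.continuous)
  simp only [comp_apply, hinv] at key
  refine Eq.trans ?_ key.symm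
  change 1 / 4 * ∫ x, (circleDeriv ((U₁ : HR s) ∘ φ.toHomeomorph.symm) x *
    circleDeriv ((V₁ : HR s) ∘ φ.toHomeomorph.symm) x +
    U₂ (φ.toHomeomorph.symm x) * V₂ (φ.toHomeomorph.symm x)) ∂haarAddCircle = _
  rw [← integral_const_mul]
  congr 1
  funext x
  have hU := φ.circleDeriv_comp_symm U₁ (φ.toHomeomorph.symm x)
  have hV := φ.circleDeriv_comp_symm V₁ (φ.toHomeomorph.symm x)
  rw [hinv'] at hU hV
  rw [hU, hV]

theorem re_mul_conj_eq (A : ℂ) (a b a' b' : ℝ) :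
    (A * (1 / 2 * ((a : ℂ) + Complex.I * b)) *
      (starRingEnd ℂ) (A * (1 / 2 * ((a' : ℂ) + Complex.I * b')))).re =
      1 / 4 * (a * a' + b * b') * ‖A‖ ^ 2 := by
  have h : A * (1 / 2 * ((a : ℂ) + Complex.I * b)) *
      (starRingEnd ℂ) (A * (1 / 2 * ((a' : ℂ) + Complex.I * b'))) =
      ((1 / 4 * ‖A‖ ^ 2 : ℝ) : ℂ) * ((a + Complex.I * b) * (a' - Complex.I * b')) := by
    simp only [map_mul, map_add, Complex.conj_ofReal, Complex.conj_I, map_div₀, map_one, map_ofNat]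
    have := Complex.mul_conj' A
    push_cast
    linear_combination (1 / 4 * ((a + Complex.I * b) * (a' - Complex.I * b'))) * this
  rw [h, Complex.re_ofReal_mul]
  simp
  ring

theorem metricU_mfderiv_phi (g : G s) (U V : TangentSpace (modelG s) g) :
    metricU (phi g) (mfderiv (modelG s) 𝓘(ℝ, onePerp (s - 1)) phi g U)
      (mfderiv (modelG s) 𝓘(ℝ, onePerp (s - 1)) phi g V) = metricG g U V := by
  rw [metricG_eq, metricU, mfderiv_inclU_phi, mfderiv_inclU_phi, HC.l2Inner]
  refine ((Complex.reCLM.integral_comp_comm (HC.integrable_mul_conj _ _)).symm).trans ?_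
  congr 1
  funext x
  have hU := phiAlgDeriv_apply g U x
  have hV := phiAlgDeriv_apply g V x
  change (phiAlgDeriv g U x * (starRingEnd ℂ) (phiAlgDeriv g V x)).re = _
  rw [hU, hV, re_mul_conj_eq, norm_sq_phiAlg]

theorem norm_toL2 {t : ℝ} (f : HC t) : ‖HC.toL2 f‖ ^ 2 = ∫ x, ‖f x‖ ^ 2 ∂haarAddCircle := by
  rw [← HC.l2Inner_self, HC.l2Inner, @norm_sq_eq_re_inner ℂ, HC.toL2, ContinuousMap.inner_toLp]
  rfl

end Isometry

end TwoHS

end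

theorem theorem3p1 (s : ℝ) [Fact (5 / 2 < s)] :
    ∃ Φ : Diffeomorph (TwoHS.modelG s) 𝓘(ℝ, TwoHS.onePerp (s - 1)) (TwoHS.G s) (TwoHS.𝒰 (s - 1)) ∞,
      (∀ (g : TwoHS.G s) (x : TwoHS.S1),
        TwoHS.inclU (Φ g) x =
          ((Real.sqrt (TwoHS.Diff0.derivative g.1 x) : ℝ) : ℂ) * TwoHS.expHalf (g.2 x)) ∧
      (∀ (g : TwoHS.G s) (U V : TangentSpace (TwoHS.modelG s) g),
        TwoHS.metricU (Φ g)
          (mfderiv (TwoHS.modelG s) 𝓘(ℝ, TwoHS.onePerp (s - 1)) Φ g U)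
          (mfderiv (TwoHS.modelG s) 𝓘(ℝ, TwoHS.onePerp (s - 1)) Φ g V) =
        TwoHS.metricG g U V) ∧
      Function.Injective (fun g : TwoHS.G s => TwoHS.HC.toL2 (TwoHS.inclU (Φ g))) ∧
      ∀ g : TwoHS.G s, TwoHS.HC.toL2 (TwoHS.inclU (Φ g)) ∈
        Metric.sphere (0 : Lp ℂ 2 (AddCircle.haarAddCircle (T := 1))) 1 := by
  refine ⟨TwoHS.phiDiffeomorph s, TwoHS.phiAlg_apply, TwoHS.metricU_mfderiv_phi, ?_, fun g => ?_⟩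
  · intro g g' h
    have h1 := ContinuousMap.toLp_injective (𝕜 := ℂ) haarAddCircle h
    exact TwoHS.phi_injective (Subtype.ext (Subtype.ext (TwoHS.HC.toCM_injective h1)))
  · have h : ‖TwoHS.HC.toL2 (TwoHS.inclU (TwoHS.phi g))‖ ^ 2 = 1 :=
      (TwoHS.norm_toL2 _).trans (TwoHS.phi g).1.2
    exact mem_sphere_zero_iff_norm.mpr ((pow_eq_one_iff_of_nonneg (norm_nonneg _) two_ne_zero).mp h)
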